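/- Let $k$ be a field, let $A$ be an associative unital $k$-algebra, let $B\subset A$ be a subalgebra, and let $X$ be an $A$-bimodule (on which $k$ acts centrally). Write $A^e=A\otimes_k A^{op}$, so that $A$-bimodules are $A^e$-modules; a $B$-bimodule is flat if it is flat as a $B^e$-module. For an algebra $\Lambda$ and a $\Lambda$-bimodule $X$ let $H_*(\Lambda,X)$ be the Hochschild homology, that is the homology of $X\otimes_{\Lambda^e}\mathrm{Bar}_*(\Lambda)\cong X\otimes_k\Lambda^{\otimes *}$, where $\mathrm{Bar}_n(\Lambda)=\Lambda\otimes\Lambda^{\otimes n}\otimes\Lambda$ is the bar resolution. An $A$-bimodule is relative projective if it has the lifting property for all maps of $A$-bimodules that split as maps of $B$-bimodules; a relative projective resolution $P_*\to A$ is an augmented complex of $A$-bimodules with all $P_n$ relative projective which has a contracting homotopy of $B$-bimodules. The relative Hochschild homology is $H_*(A|B,X)=\mathrm{Tor}_*^{A^e|B^e}(X,A)=H_*(X\otimes_{A^e}P_*)$; such resolutions exist. Let $I:H_m(B,X)\to H_m(A,X)$ be induced by the inclusion $B\subset A$, and let $K:H_m(A,X)\to H_m(A|B,X)$ be induced by a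 chain map of $A$-bimodules $\mathrm{Bar}_*(A)\to P_*$ lifting the identity of $A$; such chain maps exist. Assume that $A/B$ is a flat $B$-bimodule. Then, for every relative projective resolution $P_*$ of $A$ and every such chain map, there are linear maps $\delta:H_{m+1}(A|B,X)\to H_m(B,X)$ such that the Jacobi-Zariski sequence $$\cdots\xrightarrow{\delta} H_m(B,X)\xrightarrow{I}H_m(A,X)\xrightarrow{K}H_m(A|B,X)\xrightarrow{\delta}H_{m-1}(B,X)\xrightarrow{I}\cdots\xrightarrow{\delta}H_2(B,X)\xrightarrow{I}H_2(A,X)\xrightarrow{K}H_2(A|B,X)$$ is exact: at $H_m(B,X)$ and at $H_m(A,X)$ for all $m\ge 2$, and at $H_m(A|B,X)$ for all $m\geq 3$. If moreover $A$ and $X$ are finite dimensional over $k$, the sequence is exact down to degree $1$: with the same maps, $$\cdots\xrightarrow{\delta} H_m(B,X)\xrightarrow{I}H_m(A,X)\xrightarrow{K}H_m(A|B,X)\xrightarrow{\delta}\cdots\xrightarrow{\delta}H_1(B,X)\xrightarrow{I}H_1(A,X)\xrightarrow{K}H_1(A|B,X)$$ is exact, that is at $H_m(B,X)$ and $H_m(A,X)$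 for all $m\ge 1$ and at $H_m(A|B,X)$ for all $m\ge 2$. -/

import Mathlib

universe u

open CategoryTheory TensorProduct MulOpposite
open scoped ModuleCat

namespace JZ

/-- The enveloping algebra `Aᵉ = A ⊗ Aᵒᵖ`.  An `A`-bimodule over `k` is a left `Aᵉ`-module, the
element `a ⊗ b` acting by `x ↦ a x b`. -/
abbrev Env (k A : Type u) [Field k] [Ring A] [Algebra k A] : Type u := A ⊗[k] Aᵐᵒᵖ

/-- The category of `A`-bimodules (on which `k` acts centrally). -/
abbrev Bimodule (k A : Type u) [Field k] [Ring A] [Algebra k A] := ModuleCat.{u} (Env k A)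

noncomputable section

section Bimodules

variable (k : Type u) [Field k] {A : Type u} [Ring A] [Algebra k A]

/-- The two-sided multiplication `x ↦ a x b` on a bimodule. -/
abbrev act {X : Bimodule k A} (a b : A) (x : X) : X := (a ⊗ₜ[k] op b : Env k A) • x

/-- An additive map between modules over the enveloping algebra which respects the elements
`a ⊗ b` is linear. -/
theorem map_smul_of_act {M N : Type u} [AddCommGroup M] [AddCommGroup N] [Module (Env k A) M]
    [Module (Env k A) N] (f : M →+ N)
    (h : ∀ (a b : A) (x : M),
      f ((a ⊗ₜ[k] op b : Env k A) • x) = (a ⊗ₜ[k] op b : Env k A) • f x)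
    (r : Env k A) (x : M) : f (r • x) = r • f x :=
  TensorProduct.induction_on (motive := fun r : Env k A => f (r • x) = r • f x) r
    ((congrArg f (zero_smul (Env k A) x)).trans
      ((map_zero f).trans (zero_smul (Env k A) (f x)).symm))
    (fun a b => h a b.unop x)
    (fun r s hr hs => by rw [add_smul, add_smul, map_add, hr, hs])

variable (A) in
/-- The algebra `A` as an `A`-bimodule. -/
def regular : Bimodule k A :=
  letI : Module (Env k A) A := Module.compHom A (AlgHom.mulLeftRight k A).toRingHom
  ModuleCat.of (Env k A) A

/-- An element of `A` as an element of the bimodule `A`. -/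
def regular.of (x : A) : regular k A := x

theorem regular_act (a b x : A) :
    act k a b (regular.of k x) = regular.of k (a * x * b) :=
  AlgHom.mulLeftRight_apply k A a (op b) x

/-! ### The tensor product over the enveloping algebra -/

/-- The subspace of `X ⊗ P` spanned by all `(a x b) ⊗ p - x ⊗ (b p a)`. -/
def tensorRel (X P : Bimodule k A) : Submodule k (X ⊗[k] P) :=
  Submodule.span k
    {z | ∃ (a b : A) (x : X) (p : P), z = act k a b x ⊗ₜ[k] p - x ⊗ₜ[k] act k b a p}

/-- The vector space `X ⊗_{Aᵉ} P` of two `A`-bimodules `X` and `P`, where `X` is made into a right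
`Aᵉ`-module by `x · (b ⊗ a) = a x b`. -/
abbrev BTensor (X P : Bimodule k A) : Type u := (X ⊗[k] P) ⧸ tensorRel k X P

/-- The class of `x ⊗ p` in `X ⊗_{Aᵉ} P`. -/
def BTensor.mk {X P : Bimodule k A} (x : X) (p : P) : BTensor k X P :=
  Submodule.Quotient.mk (x ⊗ₜ[k] p)

theorem BTensor.hom_ext {X P : Bimodule k A} {N : Type u} [AddCommGroup N] [Module k N]
    {f g : BTensor k X P →ₗ[k] N} (h : ∀ x p, f (BTensor.mk k x p) = g (BTensor.mk k x p)) :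
    f = g :=
  Submodule.linearMap_qext _ (TensorProduct.ext' h)

/-- The map `X ⊗_{Aᵉ} P → Y ⊗_{Aᵉ} Q` induced by bimodule maps `X → Y` and `P → Q`. -/
def BTensor.map {X Y P Q : Bimodule k A} (f : X ⟶ Y) (g : P ⟶ Q) :
    BTensor k X P →ₗ[k] BTensor k Y Q :=
  (tensorRel k X P).mapQ (tensorRel k Y Q)
    (TensorProduct.map (f.hom.restrictScalars k) (g.hom.restrictScalars k)) <| by
      rw [tensorRel, Submodule.span_le]
      rintro _ ⟨a, b, x, p, rfl⟩
      refine Submodule.subset_span ⟨a, b, f.hom x, g.hom p, ?_⟩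
      simp

theorem BTensor.map_mk {X Y P Q : Bimodule k A} (f : X ⟶ Y) (g : P ⟶ Q) (x : X) (p : P) :
    BTensor.map k f g (BTensor.mk k x p) = BTensor.mk k (f.hom x) (g.hom p) := rfl

/-- The functor `X ⊗_{Aᵉ} -` from `A`-bimodules to vector spaces. -/
def tensorFunctor (X : Bimodule k A) : Bimodule k A ⥤ ModuleCat.{u} k where
  obj P := ModuleCat.of k (BTensor k X P)
  map g := ModuleCat.ofHom (BTensor.map k (𝟙 X) g)
  map_id _ := ModuleCat.hom_ext (BTensor.hom_ext k fun _ _ => rfl)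
  map_comp _ _ := ModuleCat.hom_ext (BTensor.hom_ext k fun _ _ => rfl)

instance (X : Bimodule k A) : (tensorFunctor k X).Additive where
  map_add {_ _ f g} := ModuleCat.hom_ext <| BTensor.hom_ext k fun x p =>
    congrArg (Submodule.Quotient.mk (p := tensorRel k X _))
      (TensorProduct.tmul_add x (f.hom p) (g.hom p))

/-- The bimodule `P` is flat: `- ⊗_{Aᵉ} P` preserves injections. -/
def IsFlat (P : Bimodule k A) : Prop :=
  ∀ (U V : Bimodule k A) (f : U ⟶ V), Function.Injective f.hom →
    Function.Injective (BTensor.map k f (𝟙 P))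

/-! ### The bar resolution -/

/-- The bimodule structure `a (c ⊗ m) b = a c ⊗ m b` on `A ⊗ M`. -/
def stepAct (M : Bimodule k A) : Env k A →ₐ[k] Module.End k (A ⊗[k] M) :=
  (Module.endTensorEndAlgHom (R := k) (S := k) (A := k) (M := A) (N := M)).comp
    (Algebra.TensorProduct.map (Algebra.lmul k A)
      ((Algebra.lsmul k k M : Env k A →ₐ[k] Module.End k M).comp
        Algebra.TensorProduct.includeRight))

/-- The bimodule `A ⊗ M`. -/
def step (M : Bimodule k A) : Bimodule k A :=
  @ModuleCat.of (Env k A) _ (A ⊗[k] M) _ (Module.compHom (A ⊗[k] M) (stepAct k M).toRingHom)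

theorem step_smul_def {M : Bimodule k A} (r : Env k A) (z : A ⊗[k] M) :
    r • (show step k M from z) = (show step k M from stepAct k M r z) := rfl

theorem step_smul_k {M : Bimodule k A} (c : k) (z : A ⊗[k] M) :
    c • (show step k M from z) = (show step k M from (c • z : A ⊗[k] M)) := by
  change stepAct k M (algebraMap k (Env k A) c) z = c • z
  rw [AlgHom.commutes]
  rfl

/-- The bilinear map `(c, m) ↦ c ⊗ m` to the bimodule `A ⊗ M`. -/
def stepMk (M : Bimodule k A) : A →ₗ[k] M →ₗ[k] step k M :=
  LinearMap.mk₂ k (fun c m => (show step k M from c ⊗ₜ[k] m))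
    (fun c c' m => TensorProduct.add_tmul c c' m)
    (fun r c m => by rw [step_smul_k]; rfl)
    (fun c m m' => TensorProduct.tmul_add c m m')
    (fun r c m => by rw [step_smul_k, ← TensorProduct.tmul_smul])

theorem act_stepMk {M : Bimodule k A} (a b c : A) (m : M) :
    act k a b (stepMk k M c m) = stepMk k M (a * c) (act k 1 b m) := rfl

theorem step_hom_ext {M N : Bimodule k A} {f g : step k M ⟶ N}
    (h : ∀ c m, f.hom (stepMk k M c m) = g.hom (stepMk k M c m)) : f = g := by
  refine ModuleCat.hom_ext (LinearMap.ext fun z => ?_)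
  exact TensorProduct.induction_on (motive := fun z => f.hom z = g.hom z) z
    ((map_zero f.hom).trans (map_zero g.hom).symm) h fun y z hy hz =>
      (map_add f.hom y z).trans ((congrArg₂ (· + ·) hy hz).trans (map_add g.hom y z).symm)

/-- The bimodule map `A ⊗ M → N` given by a bilinear map compatible with the actions. -/
def stepLift {M N : Bimodule k A} (f : A →ₗ[k] M →ₗ[k] N)
    (hf : ∀ a b c m, f (a * c) (act k 1 b m) = act k a b (f c m)) : step k M ⟶ N :=
  let g : step k M →+ N := (TensorProduct.lift f).toAddMonoidHom
  ModuleCat.ofHom (X := step k M) (Y := N)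
    { g with
      map_smul' := map_smul_of_act k g fun a b x =>
        TensorProduct.induction_on
          (motive := fun x => TensorProduct.lift f (stepAct k M (a ⊗ₜ[k] op b) x) =
            (a ⊗ₜ[k] op b : Env k A) • TensorProduct.lift f x) x
          (by simp) (fun c m => hf a b c m)
          (fun y z hy hz => by simp only [map_add, hy, hz, smul_add]) }

theorem stepLift_mk {M N : Bimodule k A} (f : A →ₗ[k] M →ₗ[k] N)
    (hf : ∀ a b c m, f (a * c) (act k 1 b m) = act k a b (f c m)) (c : A) (m : M) :
    (stepLift k f hf).hom (stepMk k M c m) = f c m := rfl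

/-- The bimodule map `A ⊗ M → M`, `c ⊗ m ↦ c m`. -/
def actMap (M : Bimodule k A) : step k M ⟶ M :=
  stepLift k ((Algebra.lsmul k k M : Env k A →ₐ[k] Module.End k M).toLinearMap.comp
      (Algebra.TensorProduct.includeLeft : A →ₐ[k] Env k A).toLinearMap) fun a b c m => by
    change act k (a * c) 1 (act k 1 b m) = act k a b (act k c 1 m)
    simp [act, smul_smul]

theorem actMap_mk {M : Bimodule k A} (c : A) (m : M) :
    (actMap k M).hom (stepMk k M c m) = act k c 1 m := rfl

/-- The bimodule map `A ⊗ M → A ⊗ N`, `c ⊗ m ↦ c ⊗ g m`. -/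
def stepMap {M N : Bimodule k A} (g : M ⟶ N) : step k M ⟶ step k N :=
  stepLift k ((stepMk k N).compl₂ (g.hom.restrictScalars k)) fun a b c m => by
    change stepMk k N (a * c) (g.hom (act k 1 b m)) = act k a b (stepMk k N c (g.hom m))
    rw [map_smul, act_stepMk]

theorem stepMap_mk {M N : Bimodule k A} (g : M ⟶ N) (c : A) (m : M) :
    (stepMap k g).hom (stepMk k M c m) = stepMk k N c (g.hom m) := rfl

theorem actMap_naturality {M N : Bimodule k A} (g : M ⟶ N) :
    actMap k M ≫ g = stepMap k g ≫ actMap k N :=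
  step_hom_ext k fun _ _ => map_smul g.hom _ _

theorem stepMap_comp {M N L : Bimodule k A} (g : M ⟶ N) (h : N ⟶ L) :
    stepMap k (g ≫ h) = stepMap k g ≫ stepMap k h :=
  step_hom_ext k fun _ _ => rfl

theorem stepMap_zero (M N : Bimodule k A) : stepMap k (0 : M ⟶ N) = 0 :=
  step_hom_ext k fun c _ => map_zero (stepMk k N c)

variable (A) in
/-- The bimodule `A^{⊗ (n+1)}`, with `A` acting on the left of the first factor and on the right of
the last one. -/
def barTerm : ℕ → Bimodule k A
  | 0 => regular k A
  | n + 1 => step k (barTerm n)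

/-- The map `A ⊗ A ⊗ N → A ⊗ N`, `a ⊗ y ↦ a y - a ⊗ d y`, attached to a map `d : A ⊗ N → N`. -/
def nextD {N : Bimodule k A} (d : step k N ⟶ N) : step k (step k N) ⟶ step k N :=
  actMap k (step k N) - stepMap k d

variable (A) in
/-- The differential `A^{⊗ (n+2)} → A^{⊗ (n+1)}` of the bar resolution,
`a₀ ⊗ ⋯ ⊗ aₙ₊₁ ↦ ∑ᵢ (-1)ⁱ a₀ ⊗ ⋯ ⊗ aᵢaᵢ₊₁ ⊗ ⋯ ⊗ aₙ₊₁`, through the recursion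
`d (a ⊗ y) = a y - a ⊗ d y`. -/
def barD : ∀ n : ℕ, step k (barTerm k A n) ⟶ barTerm k A n
  | 0 => actMap k (regular k A)
  | n + 1 => nextD k (barD n)

variable (A) in
theorem barD_comp (n : ℕ) : nextD k (barD k A n) ≫ barD k A n = 0 := by
  rw [nextD, Preadditive.sub_comp, actMap_naturality]
  induction n with
  | zero => exact sub_self _
  | succ n ih =>
    change stepMap k (nextD k (barD k A n)) ≫ actMap k (step k (barTerm k A n)) -
      stepMap k (nextD k (barD k A n)) ≫
        (actMap k (step k (barTerm k A n)) - stepMap k (barD k A n)) = 0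
    rw [← Preadditive.comp_sub, sub_sub_cancel, ← stepMap_comp]
    have h : nextD k (barD k A n) ≫ barD k A n = 0 := by
      rw [nextD, Preadditive.sub_comp, actMap_naturality]
      exact ih
    rw [h, stepMap_zero]

variable (A) in
/-- The bar resolution of `A`, with `A ⊗ A^{⊗ n} ⊗ A` in degree `n`. -/
def barComplex : ChainComplex (Bimodule k A) ℕ :=
  ChainComplex.of (fun n => barTerm k A (n + 1)) (fun n => barD k A (n + 1))
    (fun n => barD_comp k A (n + 1))

variable (A) in
theorem barComplex_d (n : ℕ) : (barComplex k A).d (n + 1) n = barD k A (n + 1) :=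
  ChainComplex.of_d (fun n => barTerm k A (n + 1)) (fun n => barD k A (n + 1)) n

variable (A) in
/-- The augmentation `A ⊗ A → A` of the bar resolution, given by the product. -/
def barAug : (barComplex k A).X 0 ⟶ regular k A := barD k A 0

/-- The Hochschild complex `C_*(A, X) = X ⊗_{Aᵉ} (A ⊗ A^{⊗ *} ⊗ A) ≃ X ⊗ A^{⊗ *}`. -/
def hochschildComplex (X : Bimodule k A) : ChainComplex (ModuleCat.{u} k) ℕ :=
  ((tensorFunctor k X).mapHomologicalComplex _).obj (barComplex k A)

/-- Hochschild homology `H_n(A, X)`. -/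
def HH (X : Bimodule k A) (n : ℕ) : ModuleCat.{u} k := (hochschildComplex k X).homology n

end Bimodules

section Extension

variable {k : Type u} [Field k] {A : Type u} [Ring A] [Algebra k A] (B : Subalgebra k A)

/-- The inclusion `Bᵉ → Aᵉ`. -/
def envIncl : Env k B →ₐ[k] Env k A := Algebra.TensorProduct.map B.val (AlgHom.op B.val)

/-- Every `A`-bimodule is a `B`-bimodule by restriction. -/
abbrev res : Bimodule k A ⥤ Bimodule k B := ModuleCat.restrictScalars (envIncl B).toRingHom

theorem res_smul {X : Bimodule k A} (c : k) (x : X) :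
    (c • (show (res B).obj X from x) : (res B).obj X) = (show (res B).obj X from (c • x : X)) := by
  change envIncl B (algebraMap k (Env k B) c) • x = algebraMap k (Env k A) c • x
  rw [AlgHom.commutes]

theorem res_act {X : Bimodule k A} (a b : B) (x : X) :
    act k (X := (res B).obj X) a b x = act k (X := X) (a : A) (b : A) x := rfl

/-- The inclusion `B → A` as a map of `B`-bimodules. -/
def inclBimod : regular k B ⟶ (res B).obj (regular k A) :=
  let f : regular k B →+ (res B).obj (regular k A) :=
    (B.val : B →+ A)
  ModuleCat.ofHom (X := regular k B) (Y := (res B).obj (regular k A))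
    { f with
      map_smul' := map_smul_of_act k f fun a b x =>
        (congrArg f (regular_act k a b x)).trans
          (regular_act k (a : A) (b : A) (B.val x)).symm }

/-- The `B`-bimodule `A / B`. -/
def quotBimod : Bimodule k B :=
  ModuleCat.of (Env k B) ((res B).obj (regular k A) ⧸ LinearMap.range (inclBimod B).hom)

/-! ### Functoriality of the Hochschild complex along `B ⊆ A` -/

/-- The map `X ⊗_{Bᵉ} P → X ⊗_{Aᵉ} Q`, `x ⊗ p ↦ x ⊗ g p`, for an `A`-bimodule `X` and a map `g` of
`B`-bimodules from `P` to the restriction of an `A`-bimodule `Q`. -/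
def tensorRes (X : Bimodule k A) {P : Bimodule k B} {Q : Bimodule k A} (g : P ⟶ (res B).obj Q) :
    BTensor k ((res B).obj X) P →ₗ[k] BTensor k X Q :=
  let i : (res B).obj X →ₗ[k] X :=
    { toFun := fun x => x, map_add' := fun _ _ => rfl, map_smul' := res_smul B }
  let j : P →ₗ[k] Q :=
    { toFun := fun p => g.hom p
      map_add' := map_add g.hom
      map_smul' := fun c p => (map_smul (g.hom.restrictScalars k) c p).trans (res_smul B c _) }
  (tensorRel k _ P).mapQ (tensorRel k X Q) (TensorProduct.map i j) <| by
    rw [tensorRel, Submodule.span_le]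
    rintro _ ⟨a, b, x, p, rfl⟩
    refine Submodule.subset_span ⟨a, b, x, g.hom p, ?_⟩
    rw [map_sub, TensorProduct.map_tmul, TensorProduct.map_tmul]
    have h : j (act k b a p) = act k (b : A) (a : A) (show Q from g.hom p) :=
      map_smul g.hom _ p
    rw [h]
    rfl

/-- The map `B ⊗ M → A ⊗ N`, `b ⊗ m ↦ b ⊗ g m`. -/
def stepRes {M : Bimodule k B} {N : Bimodule k A} (g : M ⟶ (res B).obj N) :
    step k M ⟶ (res B).obj (step k N) :=
  let f : B →ₗ[k] M →ₗ[k] (res B).obj (step k N) :=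
    LinearMap.mk₂ k (fun b m => stepMk k N b (g.hom m))
      (fun b b' m => LinearMap.map_add₂ (stepMk k N) b b' (g.hom m))
      (fun r b m => (LinearMap.map_smul₂ (stepMk k N) r (b : A) (g.hom m)).trans
        (res_smul B r _).symm)
      (fun b m m' => (congrArg (stepMk k N b) (map_add g.hom m m')).trans
        (map_add (stepMk k N b) _ _))
      (fun r b m => (congrArg (stepMk k N b)
        ((map_smul (g.hom.restrictScalars k) r m).trans (res_smul B r _))).trans
          ((map_smul (stepMk k N b) r _).trans (res_smul B r _).symm))
  stepLift k f fun a b c m =>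
    congrArg (stepMk k N (a * c : A)) (map_smul g.hom ((1 : B) ⊗ₜ[k] op b : Env k B) m)

theorem stepRes_mk {M : Bimodule k B} {N : Bimodule k A} (g : M ⟶ (res B).obj N) (b : B) (m : M) :
    (stepRes B g).hom (stepMk k M b m) = stepMk k N b (g.hom m) := rfl

theorem stepRes_actMap {M : Bimodule k B} {N : Bimodule k A} (g : M ⟶ (res B).obj N) :
    stepRes B g ≫ (res B).map (actMap k N) = actMap k M ≫ g :=
  step_hom_ext k fun b m => (map_smul g.hom (b ⊗ₜ[k] op 1 : Env k B) m).symm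

theorem stepRes_stepMap {M M' : Bimodule k B} {N N' : Bimodule k A} (g : M ⟶ (res B).obj N)
    (g' : M' ⟶ (res B).obj N') (d : M ⟶ M') (e : N ⟶ N') (h : g ≫ (res B).map e = d ≫ g') :
    stepRes B g ≫ (res B).map (stepMap k e) = stepMap k d ≫ stepRes B g' :=
  step_hom_ext k fun b m =>
    congrArg (stepMk k N' (b : A)) (LinearMap.congr_fun (congrArg ModuleCat.Hom.hom h) m)

/-- The inclusion `B^{⊗ (n+1)} → A^{⊗ (n+1)}`. -/
def barIncl : ∀ n : ℕ, barTerm k B n ⟶ (res B).obj (barTerm k A n)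
  | 0 => inclBimod B
  | n + 1 => stepRes B (barIncl n)

theorem barIncl_comm : ∀ n : ℕ,
    stepRes B (barIncl B n) ≫ (res B).map (barD k A n) = barD k B n ≫ barIncl B n
  | 0 => stepRes_actMap B _
  | n + 1 => by
    change stepRes B (stepRes B (barIncl B n)) ≫ (res B).map (nextD k (barD k A n)) =
      nextD k (barD k B n) ≫ stepRes B (barIncl B n)
    rw [nextD, nextD, Functor.map_sub, Preadditive.comp_sub, Preadditive.sub_comp,
      stepRes_actMap, stepRes_stepMap B _ _ _ _ (barIncl_comm n)]

/-- The chain map `C_*(B, X) → C_*(A, X)`, `x ⊗ y ↦ x ⊗ y`, induced by the inclusion. -/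
def inclComplex (X : Bimodule k A) :
    hochschildComplex k ((res B).obj X) ⟶ hochschildComplex k X where
  f n := ModuleCat.ofHom (tensorRes B X (barIncl B (n + 1)))
  comm' i j hij := by
    obtain rfl : j + 1 = i := hij
    refine ModuleCat.hom_ext (BTensor.hom_ext k fun x p => ?_)
    have h := LinearMap.congr_fun (congrArg ModuleCat.Hom.hom (barIncl_comm B (j + 1))) p
    change BTensor.mk k (P := barTerm k A (j + 1)) x
        (((barComplex k A).d (j + 1) j).hom ((stepRes B (barIncl B (j + 1))).hom p)) =
      BTensor.mk k (P := barTerm k A (j + 1)) x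
        ((barIncl B (j + 1)).hom (((barComplex k B).d (j + 1) j).hom p))
    rw [barComplex_d, barComplex_d]
    exact congrArg (BTensor.mk k (P := barTerm k A (j + 1)) x) h

/-! ### Relative homological algebra for `Bᵉ ⊆ Aᵉ` -/

/-- An `A`-bimodule `P` is projective relative to `B` if bimodule maps from `P` lift through all
maps of `A`-bimodules that split as maps of `B`-bimodules. -/
def IsRelProjective (P : Bimodule k A) : Prop :=
  ∀ (M N : Bimodule k A) (g : M ⟶ N) (s : (res B).obj N ⟶ (res B).obj M),
    s ≫ (res B).map g = 𝟙 _ → ∀ f : P ⟶ N, ∃ h : P ⟶ M, h ≫ g = f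

/-- A relative projective resolution of the `A`-bimodule `Y`: an augmented complex
`⋯ → P₁ → P₀ → Y → 0` of `A`-bimodules, with all `Pₙ` relative projective, which has a contracting
homotopy of `B`-bimodules (given by `Y → P₀` and maps `Pₙ → Pₙ₊₁`). -/
structure RelResolution (Y : Bimodule k A) where
  /-- The complex of the `Pₙ`. -/
  complex : ChainComplex (Bimodule k A) ℕ
  /-- The augmentation `P₀ → Y`. -/
  aug : complex.X 0 ⟶ Y
  relProjective : ∀ n, IsRelProjective B (complex.X n)
  d_comp_aug : complex.d 1 0 ≫ aug = 0
  contractible : ∃ (s' : (res B).obj Y ⟶ (res B).obj (complex.X 0))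
      (s : ∀ n, (res B).obj (complex.X n) ⟶ (res B).obj (complex.X (n + 1))),
    s' ≫ (res B).map aug = 𝟙 _ ∧
    (res B).map aug ≫ s' + s 0 ≫ (res B).map (complex.d 1 0) = 𝟙 _ ∧
    ∀ n, (res B).map (complex.d (n + 1) n) ≫ s n +
      s (n + 1) ≫ (res B).map (complex.d (n + 2) (n + 1)) = 𝟙 _

variable {B}

/-- The complex `X ⊗_{Aᵉ} P` for a relative projective resolution `P`. -/
def RelResolution.tensor {Y : Bimodule k A} (P : RelResolution B Y) (X : Bimodule k A) :
    ChainComplex (ModuleCat.{u} k) ℕ :=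
  ((tensorFunctor k X).mapHomologicalComplex _).obj P.complex

/-- The relative homology `Tor_n^{Aᵉ|Bᵉ}(X, Y)`, computed by the relative projective resolution `P`
of `Y`.  For `Y = A` this is the relative Hochschild homology `H_n(A|B, X)`. -/
def RelResolution.relTor {Y : Bimodule k A} (P : RelResolution B Y) (X : Bimodule k A) (n : ℕ) :
    ModuleCat.{u} k :=
  (P.tensor X).homology n

/-- A comparison map: a chain map of `A`-bimodules from the bar resolution of `A` to a relative
projective resolution of `A`, which lifts the identity of `A`. -/
def RelResolution.IsComparison (P : RelResolution B (regular k A))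
    (φ : barComplex k A ⟶ P.complex) : Prop :=
  φ.f 0 ≫ P.aug = barAug k A

/-- The map `K : H_n(A, X) → H_n(A|B, X)` induced by a comparison map. -/
def mapK {P : RelResolution B (regular k A)} (φ : barComplex k A ⟶ P.complex)
    (X : Bimodule k A) (n : ℕ) : HH k X n ⟶ P.relTor X n :=
  HomologicalComplex.homologyMap
    (((tensorFunctor k X).mapHomologicalComplex (ComplexShape.down ℕ)).map φ) n

variable (B) in
/-- The map `I : H_n(B, X) → H_n(A, X)` induced by the inclusion. -/
def mapI (X : Bimodule k A) (n : ℕ) : HH k ((res B).obj X) n ⟶ HH k X n :=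
  HomologicalComplex.homologyMap (inclComplex B X) n

end Extension
end

end JZ

open JZ

/-! For a `B`-bimodule `U` write `ind U = A ⊗_B U ⊗_B A`. Since `X ⊗_{Aᵉ} ind U` is `X ⊗_{Bᵉ} U`,
all three homologies in the sequence come from tensoring `X` with complexes of `A`-bimodules: `Q =
ind (Bar B)`, `Bar A`, and a relative resolution `R`. For `R` one takes the explicit one with `R₀ =
A ⊗_B A` and `Rₙ₊₁ = ind Ωₙ`, where `Ω₀` is the kernel of `A ⊗_B A → A` and each further `Ω` is the
kernel of the preceding cover.

There are chain maps `Q → Bar A → R`. Because `Q` is relatively projective, the composite is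
homotopic to the map that is `ε : Q₀ → A ⊗_B A` in degree zero and vanishes elsewhere
(`exists_barHomotopy`). Hence, once `R₀` is discarded, `Tₙ = Rₙ₊₁ ⊕ Barₙ A ⊕ Qₙ₋₁` is a complex. Two
consequences of the flatness of `A / B` carry the proof.

`T` is exact. Induction is exact (`ind_map_injective`, `ind_exact`), so `Q` resolves `A ⊗_B A`. As
`Bar A` resolves `A` and `R` in positive degrees resolves `Ω₀`, the exactness of `T` reflects that
of `0 → Ω₀ → A ⊗_B A → A → 0` (`IsExact.totDLinear_exact`).

`T` is flat. Over `B` the kernel `Ω₀` is a retract of `ind (A / B)`, which is flat over `Bᵉ`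
(`IsFlat.res_ind`), and the later kernels inherit this; so `Rₙ` is flat over `Aᵉ` for `n ≥ 1`
(`isFlat_relResolution`).

An exact complex of flat modules, bounded below, remains exact after tensoring
(`IsFlat.tensor_exact`). So the total complex of `C(B, X) → C(A, X) → X ⊗ R` is exact in positive
degrees (`IsTotalExact`), and the long exact sequence is read off from that by hand: a relative
cycle is homologous to some `g x + h q` with `q` a cycle and `d x = -f q`, and `δ` sends its class
to the class of `q`. The missing `R₀` is the reason why the sequence ends at `H₁(A|B, X)`. Any other
relative resolution is homotopy equivalent to `R` over the identity of `A`, and the sequence is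
transported along that equivalence (`exists_connecting`). -/

namespace JZ

noncomputable section

/-! ### Functoriality, symmetry and right exactness of the tensor product over the enveloping
algebra. -/

section TensorBasics

variable (k : Type u) [Field k] {A : Type u} [Ring A] [Algebra k A]

/-- The bilinear map `(x, p) ↦ x ⊗ p` to `X ⊗_{Aᵉ} P`. -/
def BTensor.mkBilin (X P : Bimodule k A) : X →ₗ[k] P →ₗ[k] BTensor k X P :=
  (TensorProduct.mk k X P).compr₂ (tensorRel k X P).mkQ

theorem BTensor.mkBilin_apply {X P : Bimodule k A} (x : X) (p : P) :
    BTensor.mkBilin k X P x p = BTensor.mk k x p := rfl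

theorem BTensor.act_mk {X P : Bimodule k A} (a b : A) (x : X) (p : P) :
    BTensor.mk k (act k a b x) p = BTensor.mk k x (act k b a p) :=
  (Submodule.Quotient.eq _).2 (Submodule.subset_span ⟨a, b, x, p, rfl⟩)

/-- The linear map on `X ⊗_{Aᵉ} P` given by a balanced bilinear map. -/
def BTensor.lift {X P : Bimodule k A} {N : Type u} [AddCommGroup N] [Module k N]
    (f : X →ₗ[k] P →ₗ[k] N)
    (hf : ∀ a b x p, f (act k a b x) p = f x (act k b a p)) : BTensor k X P →ₗ[k] N :=
  (tensorRel k X P).liftQ (TensorProduct.lift f) <| by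
    rw [tensorRel, Submodule.span_le]
    rintro _ ⟨a, b, x, p, rfl⟩
    change TensorProduct.lift f _ = 0
    rw [map_sub, TensorProduct.lift.tmul, TensorProduct.lift.tmul, hf, sub_self]

theorem BTensor.map_comp {X Y Z P Q R : Bimodule k A} (f : X ⟶ Y) (g : P ⟶ Q) (f' : Y ⟶ Z)
    (g' : Q ⟶ R) (z : BTensor k X P) :
    BTensor.map k f' g' (BTensor.map k f g z) = BTensor.map k (f ≫ f') (g ≫ g') z :=
  LinearMap.congr_fun (f := BTensor.map k f' g' ∘ₗ BTensor.map k f g)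
    (g := BTensor.map k (f ≫ f') (g ≫ g'))
    (BTensor.hom_ext k fun _ _ => rfl) z

theorem BTensor.map_id {X P : Bimodule k A} (z : BTensor k X P) :
    BTensor.map k (𝟙 X) (𝟙 P) z = z :=
  LinearMap.congr_fun (f := BTensor.map k (𝟙 X) (𝟙 P)) (g := LinearMap.id)
    (BTensor.hom_ext k fun _ _ => rfl) z

theorem BTensor.map_add_right {X Y P Q : Bimodule k A} (f : X ⟶ Y) (g g' : P ⟶ Q)
    (z : BTensor k X P) :
    BTensor.map k f (g + g') z = BTensor.map k f g z + BTensor.map k f g' z :=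
  LinearMap.congr_fun (g := BTensor.map k f g + BTensor.map k f g')
    (BTensor.hom_ext k fun x _ => (BTensor.mkBilin k Y Q (f.hom x)).map_add _ _) z

theorem BTensor.map_neg_right {X Y P Q : Bimodule k A} (f : X ⟶ Y) (g : P ⟶ Q)
    (z : BTensor k X P) :
    BTensor.map k f (-g) z = -BTensor.map k f g z :=
  LinearMap.congr_fun (g := -BTensor.map k f g)
    (BTensor.hom_ext k fun x _ => (BTensor.mkBilin k Y Q (f.hom x)).map_neg _) z

theorem BTensor.map_zero_right {X Y P Q : Bimodule k A} (f : X ⟶ Y)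
    (z : BTensor k X P) :
    BTensor.map k f (0 : P ⟶ Q) z = 0 :=
  LinearMap.congr_fun (g := 0)
    (BTensor.hom_ext k fun x _ => (BTensor.mkBilin k Y Q (f.hom x)).map_zero) z

/-- The symmetry `X ⊗_{Aᵉ} P → P ⊗_{Aᵉ} X`. -/
def BTensor.comm (X P : Bimodule k A) : BTensor k X P →ₗ[k] BTensor k P X :=
  BTensor.lift k (BTensor.mkBilin k P X).flip fun a b x p => (BTensor.act_mk k b a p x).symm

theorem BTensor.comm_comm {X P : Bimodule k A} (z : BTensor k X P) :
    BTensor.comm k P X (BTensor.comm k X P z) = z :=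
  LinearMap.congr_fun (f := BTensor.comm k P X ∘ₗ BTensor.comm k X P) (g := LinearMap.id)
    (BTensor.hom_ext k fun _ _ => rfl) z

theorem BTensor.comm_map {X Y P Q : Bimodule k A} (f : X ⟶ Y) (g : P ⟶ Q) (z : BTensor k X P) :
    BTensor.comm k Y Q (BTensor.map k f g z) = BTensor.map k g f (BTensor.comm k X P z) :=
  LinearMap.congr_fun (f := BTensor.comm k Y Q ∘ₗ BTensor.map k f g)
    (g := BTensor.map k g f ∘ₗ BTensor.comm k X P) (BTensor.hom_ext k fun _ _ => rfl) z

theorem BTensor.comm_injective (X P : Bimodule k A) : Function.Injective (BTensor.comm k X P) :=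
  Function.LeftInverse.injective (BTensor.comm_comm k)

/-- The symmetry of the tensor product is natural and involutive. This allows flatness, which is
defined with the flat bimodule as second factor, to be used with it as first factor. -/
theorem BTensor.map_swap_injective {X Y P Q : Bimodule k A} (f : X ⟶ Y) (g : P ⟶ Q)
    (h : Function.Injective (BTensor.map k g f)) : Function.Injective (BTensor.map k f g) := by
  intro z w hzw
  apply BTensor.comm_injective k
  apply h
  rw [← BTensor.comm_map, ← BTensor.comm_map, hzw]

theorem BTensor.mk_surjective (X P : Bimodule k A) :
    Function.Surjective (Submodule.Quotient.mk (p := tensorRel k X P)) :=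
  Submodule.Quotient.mk_surjective _

theorem BTensor.map_surjective {X Y P Q : Bimodule k A} (f : X ⟶ Y) (g : P ⟶ Q)
    (hf : Function.Surjective f.hom) (hg : Function.Surjective g.hom) :
    Function.Surjective (BTensor.map k f g) := by
  intro z
  obtain ⟨z, rfl⟩ := BTensor.mk_surjective k Y Q z
  obtain ⟨w, rfl⟩ := TensorProduct.map_surjective
    (g := f.hom.restrictScalars k) (g' := g.hom.restrictScalars k) hf hg z
  exact ⟨Submodule.Quotient.mk w, rfl⟩

/-- Right exactness of `X ⊗_{Aᵉ} -`. -/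
theorem BTensor.exact_right (X : Bimodule k A) {K L M : Bimodule k A} (f : K ⟶ L) (g : L ⟶ M)
    (hfg : Function.Exact f.hom g.hom) (hg : Function.Surjective g.hom) :
    Function.Exact (BTensor.map k (𝟙 X) f) (BTensor.map k (𝟙 X) g) := by
  have hex : Function.Exact (f.hom.restrictScalars k) (g.hom.restrictScalars k) := hfg
  -- A generating relation over `M` lifts to one over `L` by lifting its entry `p` along `g`. This
  -- reduces the claim to right exactness of the tensor product over `k`.
  have hrel : ∀ w ∈ tensorRel k X M, ∃ v ∈ tensorRel k X L,
      (g.hom.restrictScalars k).lTensor X v = w := by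
    intro w hw
    have : tensorRel k X M ≤ (tensorRel k X L).map ((g.hom.restrictScalars k).lTensor X) := by
      rw [tensorRel, Submodule.span_le]
      rintro _ ⟨a, b, x, p, rfl⟩
      obtain ⟨p, rfl⟩ := hg p
      refine ⟨_, Submodule.subset_span ⟨a, b, x, p, rfl⟩, ?_⟩
      rw [map_sub, LinearMap.lTensor_tmul, LinearMap.lTensor_tmul]
      simp
    exact this hw
  intro z
  constructor
  · intro hz
    obtain ⟨z, rfl⟩ := BTensor.mk_surjective k X L z
    obtain ⟨v, hv, hvz⟩ := hrel ((g.hom.restrictScalars k).lTensor X z)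
      ((Submodule.Quotient.mk_eq_zero _).1 hz)
    obtain ⟨y, hy⟩ := (lTensor_exact X hex hg (z - v)).1 (by rw [map_sub, hvz, sub_self])
    refine ⟨Submodule.Quotient.mk y, ?_⟩
    refine (Submodule.Quotient.eq _).2 ?_
    change (f.hom.restrictScalars k).lTensor X y - z ∈ _
    rw [hy, sub_sub_cancel_left]
    exact Submodule.neg_mem _ hv
  · rintro ⟨y, rfl⟩
    rw [BTensor.map_comp]
    have : f ≫ g = 0 := ModuleCat.hom_ext (LinearMap.ext fun x => hfg.apply_apply_eq_zero x)
    rw [this, BTensor.map_zero_right]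

end TensorBasics

/-! ### Extension of scalars along a homomorphism of noncommutative algebras. -/

section Extend

variable {k : Type u} [Field k] {S R : Type u} [Ring S] [Algebra k S] [Ring R] [Algebra k R]
  (f : S →ₐ[k] R)

/-- The `R`-submodule of `R ⊗ U` generated by all `f s ⊗ u - 1 ⊗ s u`. -/
def extendRel (U : ModuleCat.{u} S) : Submodule R (R ⊗[k] U) :=
  Submodule.span R {z | ∃ (s : S) (u : U), z = f s ⊗ₜ[k] u - 1 ⊗ₜ[k] (s • u)}

/-- The extension of scalars `R ⊗_S U` along a map `S → R` of (noncommutative) algebras. -/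
def extend (U : ModuleCat.{u} S) : ModuleCat.{u} R :=
  ModuleCat.of R ((R ⊗[k] U) ⧸ extendRel f U)

theorem extend_smul_k {U : ModuleCat.{u} S} (c : k) (z : R ⊗[k] U) :
    c • (show extend f U from Submodule.Quotient.mk z) =
      (show extend f U from Submodule.Quotient.mk (c • z : R ⊗[k] U)) := by
  change (Submodule.Quotient.mk (algebraMap k R c • z) : (R ⊗[k] U) ⧸ extendRel f U) = _
  rw [algebraMap_smul]

/-- The bilinear map `(r, u) ↦ r ⊗ u`. -/
def extendMk (U : ModuleCat.{u} S) : R →ₗ[k] U →ₗ[k] extend f U :=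
  LinearMap.mk₂ k
    (fun r u => (show extend f U from Submodule.Quotient.mk (p := extendRel f U) (r ⊗ₜ[k] u)))
    (fun r r' u => congrArg (Submodule.Quotient.mk (p := extendRel f U)) (add_tmul r r' u))
    (fun c r u => by rw [extend_smul_k]; rfl)
    (fun r u u' => congrArg (Submodule.Quotient.mk (p := extendRel f U)) (tmul_add r u u'))
    (fun c r u => by rw [extend_smul_k, ← tmul_smul])

theorem smul_extendMk {U : ModuleCat.{u} S} (r r' : R) (u : U) :
    r • extendMk f U r' u = extendMk f U (r * r') u := rfl

theorem extendMk_mul {U : ModuleCat.{u} S} (r : R) (s : S) (u : U) :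
    extendMk f U (r * f s) u = extendMk f U r (s • u) := by
  refine (Submodule.Quotient.eq (extendRel f U)).2 ?_
  have h : (r * f s) ⊗ₜ[k] u - r ⊗ₜ[k] (s • u) =
      r • (f s ⊗ₜ[k] u - 1 ⊗ₜ[k] (s • u) : R ⊗[k] U) := by
    rw [smul_sub, smul_tmul', smul_tmul', smul_eq_mul, smul_eq_mul, mul_one]
  rw [h]
  exact Submodule.smul_mem _ _ (Submodule.subset_span ⟨s, u, rfl⟩)

theorem extend_induction {U : ModuleCat.{u} S} {motive : extend f U → Prop}
    (mk : ∀ r u, motive (extendMk f U r u)) (add : ∀ y z, motive y → motive z → motive (y + z))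
    (z : extend f U) : motive z := by
  obtain ⟨z, rfl⟩ := Submodule.Quotient.mk_surjective (extendRel f U) z
  induction z with
  | zero =>
    have h := mk 0 0
    rwa [map_zero] at h
  | tmul r u => exact mk r u
  | add y z hy hz => exact add _ _ hy hz

theorem extend_hom_ext {U : ModuleCat.{u} S} {N : ModuleCat.{u} R} {g h : extend f U ⟶ N}
    (H : ∀ u, g.hom (extendMk f U 1 u) = h.hom (extendMk f U 1 u)) : g = h := by
  refine ModuleCat.hom_ext (LinearMap.ext fun z => ?_)
  induction z using extend_induction f with
  | mk r u =>
    have := smul_extendMk f r 1 u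
    rw [mul_one] at this
    rw [← this, map_smul, map_smul, H]
  | add y z hy hz => rw [map_add, map_add, hy, hz]

/-- The `k`-linear map on `R ⊗_S U` given by a balanced bilinear map. -/
def extendLiftLinear {U : ModuleCat.{u} S} {N : Type u} [AddCommGroup N] [Module k N]
    (g : R →ₗ[k] U →ₗ[k] N) (hg : ∀ r s u, g (r * f s) u = g r (s • u)) :
    extend f U →ₗ[k] N where
  toFun := QuotientAddGroup.lift (extendRel f U).toAddSubgroup
    (TensorProduct.lift g).toAddMonoidHom <| by
      intro z hz
      -- The relations form an `R`-span while `g` is only `k`-linear, so the induction has to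
      -- control all multiples `r • z` at once.
      have key : ∀ z ∈ extendRel f U, ∀ r : R, TensorProduct.lift g (r • z) = 0 := by
        intro z hz
        induction hz using Submodule.span_induction with
        | mem z hz =>
          obtain ⟨s, u, rfl⟩ := hz
          intro r
          rw [smul_sub, smul_tmul', smul_tmul', map_sub, lift.tmul, lift.tmul, smul_eq_mul,
            smul_eq_mul, mul_one, hg, sub_self]
        | zero => intro r; rw [smul_zero, map_zero]
        | add y z _ _ hy hz => intro r; rw [smul_add, map_add, hy, hz, add_zero]
        | smul a z _ hz => intro r; rw [smul_smul, hz]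
      have := key z hz 1
      rwa [one_smul] at this
  map_add' := map_add _
  map_smul' c z := by
    obtain ⟨z, rfl⟩ := Submodule.Quotient.mk_surjective (extendRel f U) z
    rw [RingHom.id_apply]
    refine (congrArg _ (extend_smul_k f c z)).trans ?_
    exact map_smul (TensorProduct.lift g) c z

/-- The unit `U → R ⊗_S U`, `u ↦ 1 ⊗ u`. -/
def extendUnit (U : ModuleCat.{u} S) :
    U ⟶ (ModuleCat.restrictScalars f.toRingHom).obj (extend f U) :=
  ModuleCat.ofHom (X := U) (Y := (ModuleCat.restrictScalars f.toRingHom).obj (extend f U))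
    { toFun := fun u => extendMk f U 1 u
      map_add' := fun u v => map_add (extendMk f U 1) u v
      map_smul' := fun s u => by
        refine (extendMk_mul f 1 s u).symm.trans ?_
        change extendMk f U (1 * f s) u = f s • extendMk f U 1 u
        rw [smul_extendMk, one_mul, mul_one] }

theorem extendUnit_apply {U : ModuleCat.{u} S} (u : U) :
    (extendUnit f U).hom u = extendMk f U 1 u := rfl

theorem smul_extendUnit {U : ModuleCat.{u} S} (r : R) (u : U) :
    r • (show extend f U from (extendUnit f U).hom u) = extendMk f U r u := by
  rw [extendUnit_apply]
  exact (smul_extendMk f r 1 u).trans (by rw [mul_one])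

/-- The `R`-linear map `R ⊗_S U → N`, `r ⊗ u ↦ r g(u)`, attached to an `S`-linear map `g`. -/
def extendLift {U : ModuleCat.{u} S} {N : ModuleCat.{u} R}
    (g : U ⟶ (ModuleCat.restrictScalars f.toRingHom).obj N) : extend f U ⟶ N :=
  let i : (ModuleCat.restrictScalars f.toRingHom).obj N →ₗ[k] N :=
    { toFun := fun x => x
      map_add' := fun _ _ => rfl
      map_smul' := fun c x => by
        change f (algebraMap k S c) • (show N from x) = algebraMap k R c • (show N from x)
        rw [AlgHom.commutes] }
  let G : R →ₗ[k] U →ₗ[k] N :=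
    (Algebra.lsmul k k N : R →ₐ[k] Module.End k N).toLinearMap.compl₂
      (i ∘ₗ g.hom.restrictScalars k)
  let G' := extendLiftLinear f G fun r s u => by
    change (r * f s) • (show N from g.hom u) = r • (show N from g.hom (s • u))
    rw [mul_smul, map_smul]
    rfl
  ModuleCat.ofHom (X := extend f U) (Y := N)
    { toFun := G'
      map_add' := map_add G'
      map_smul' := by
        have H : ∀ (r : R) (z : extend f U), G' (r • z) = r • G' z := fun r z => by
          induction z using extend_induction f with
          | mk r' u => exact mul_smul r r' (show N from g.hom u)
          | add y z hy hz => rw [smul_add, map_add, map_add, hy, hz, smul_add]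
        exact H }

theorem extendLift_mk {U : ModuleCat.{u} S} {N : ModuleCat.{u} R}
    (g : U ⟶ (ModuleCat.restrictScalars f.toRingHom).obj N) (r : R) (u : U) :
    (extendLift f g).hom (extendMk f U r u) = r • (show N from g.hom u) := rfl

theorem extendLift_one {U : ModuleCat.{u} S} {N : ModuleCat.{u} R}
    (g : U ⟶ (ModuleCat.restrictScalars f.toRingHom).obj N) (u : U) :
    (extendLift f g).hom (extendMk f U 1 u) = g.hom u := one_smul R (show N from g.hom u)

theorem extendLift_comp {U : ModuleCat.{u} S} {N N' : ModuleCat.{u} R}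
    (g : U ⟶ (ModuleCat.restrictScalars f.toRingHom).obj N) (h : N ⟶ N') :
    extendLift f g ≫ h = extendLift f (g ≫ (ModuleCat.restrictScalars f.toRingHom).map h) :=
  extend_hom_ext f fun u => by
    rw [extendLift_one, ModuleCat.hom_comp, LinearMap.comp_apply, extendLift_one]
    rfl

/-- The functor `R ⊗_S -`. -/
abbrev extendFunctor : ModuleCat.{u} S ⥤ ModuleCat.{u} R where
  obj := extend f
  map g := extendLift f (g ≫ extendUnit f _)
  map_id U := extend_hom_ext f fun u => extendLift_one f _ u
  map_comp g h := by
    rw [extendLift_comp]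
    refine congrArg (extendLift f) (ModuleCat.hom_ext (LinearMap.ext fun u => ?_))
    exact (extendLift_one f (h ≫ extendUnit f _) (g.hom u)).symm

theorem extendFunctor_map_mk {U V : ModuleCat.{u} S} (g : U ⟶ V) (r : R) (u : U) :
    ((extendFunctor f).map g).hom (extendMk f U r u) = extendMk f V r (g.hom u) :=
  (extendLift_mk f _ r u).trans (smul_extendUnit f r (g.hom u))

instance : (extendFunctor f).Additive where
  map_add {U V g h} := extend_hom_ext f fun u => by
    have := extendFunctor_map_mk f (g + h) 1 u
    refine this.trans ?_
    change extendMk f V 1 (g.hom u + h.hom u) = _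
    rw [map_add, ← extendFunctor_map_mk, ← extendFunctor_map_mk]
    rfl

theorem extendUnit_naturality {U V : ModuleCat.{u} S} (g : U ⟶ V) :
    extendUnit f U ≫ (ModuleCat.restrictScalars f.toRingHom).map ((extendFunctor f).map g) =
      g ≫ extendUnit f V :=
  ModuleCat.hom_ext (LinearMap.ext fun u => extendFunctor_map_mk f g 1 u)

theorem extendFunctor_map_surjective {U V : ModuleCat.{u} S} (g : U ⟶ V)
    (hg : Function.Surjective g.hom) : Function.Surjective ((extendFunctor f).map g).hom := by
  intro z
  induction z using extend_induction f with
  | mk r v =>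
    obtain ⟨u, rfl⟩ := hg v
    exact ⟨_, extendFunctor_map_mk f g r u⟩
  | add y z hy hz =>
    obtain ⟨y, rfl⟩ := hy
    obtain ⟨z, rfl⟩ := hz
    exact ⟨y + z, map_add _ _ _⟩

end Extend

/-! ### Free bimodules, kernels, and flat bimodules. -/

section Flatness

variable (k : Type u) [Field k] {A : Type u} [Ring A] [Algebra k A]

variable (A) in
/-- The anti-automorphism `a ⊗ b ↦ b ⊗ a` of the enveloping algebra. -/
def swapEnv : Env k A →ₗ[k] Env k A :=
  (TensorProduct.map (opLinearEquiv k).symm.toLinearMap (opLinearEquiv k).toLinearMap) ∘ₗ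
    (TensorProduct.comm k A Aᵐᵒᵖ).toLinearMap

theorem swapEnv_tmul (a b : A) : swapEnv k A (a ⊗ₜ[k] op b) = b ⊗ₜ[k] op a := rfl

theorem swapEnv_one : swapEnv k A 1 = 1 := rfl

theorem env_induction {motive : Env k A → Prop} (tmul : ∀ a b : A, motive (a ⊗ₜ[k] op b))
    (add : ∀ r s, motive r → motive s → motive (r + s)) (r : Env k A) : motive r :=
  TensorProduct.induction_on r (by simpa using tmul 0 0) (fun a b => tmul a b.unop) add

theorem swapEnv_mul (r s : Env k A) : swapEnv k A (r * s) = swapEnv k A s * swapEnv k A r := by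
  induction r using env_induction k with
  | tmul a b =>
    induction s using env_induction k with
    | tmul c d =>
      rw [swapEnv_tmul, swapEnv_tmul, Algebra.TensorProduct.tmul_mul_tmul,
        Algebra.TensorProduct.tmul_mul_tmul]
      rfl
    | add s t hs ht => rw [mul_add, map_add, map_add, add_mul, hs, ht]
  | add r t hr ht => rw [add_mul, map_add, map_add, mul_add, hr, ht]

/-- The defining relations concern pure tensors `a ⊗ b`; by additivity every element of the
enveloping algebra moves across, at the cost of the anti-automorphism. -/
theorem BTensor.mk_smul {X P : Bimodule k A} (r : Env k A) (x : X) (p : P) :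
    BTensor.mk k x (r • p) = BTensor.mk k (swapEnv k A r • x) p := by
  induction r using env_induction k with
  | tmul a b => exact (BTensor.act_mk k b a x p).symm
  | add r s hr hs =>
    rw [add_smul, map_add, add_smul, ← BTensor.mkBilin_apply, ← BTensor.mkBilin_apply, map_add,
      map_add, LinearMap.add_apply]
    exact congrArg₂ (· + ·) hr hs

/-! ### Free bimodules -/

variable (A) in
/-- The free bimodule `Aᵉ ⊗ E` on a vector space `E`. -/
def free (E : Type u) [AddCommGroup E] [Module k E] : Bimodule k A :=
  ModuleCat.of (Env k A) (Env k A ⊗[k] E)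

section Free

variable {E : Type u} [AddCommGroup E] [Module k E]

theorem free_smul_k (c : k) (z : Env k A ⊗[k] E) :
    c • (show free k A E from z) = (show free k A E from (c • z : Env k A ⊗[k] E)) := by
  change algebraMap k (Env k A) c • z = _
  rw [algebraMap_smul]

variable (A E) in
/-- The bilinear map `(r, e) ↦ r ⊗ e` to the free bimodule. -/
def freeMk : Env k A →ₗ[k] E →ₗ[k] free k A E :=
  LinearMap.mk₂ k (fun r e => (show free k A E from r ⊗ₜ[k] e))
    (fun r r' e => TensorProduct.add_tmul r r' e)
    (fun c r e => by rw [free_smul_k]; rfl)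
    (fun r e e' => TensorProduct.tmul_add r e e')
    (fun c r e => by rw [free_smul_k, ← TensorProduct.tmul_smul])

theorem smul_freeMk (r r' : Env k A) (e : E) : r • freeMk k A E r' e = freeMk k A E (r * r') e :=
  rfl

theorem free_induction {motive : free k A E → Prop} (mk : ∀ r e, motive (freeMk k A E r e))
    (add : ∀ y z, motive y → motive z → motive (y + z)) (z : free k A E) : motive z :=
  TensorProduct.induction_on (motive := motive) z
    (by have h := mk 0 0; rwa [map_zero] at h) mk add

/-- The linear map on the free bimodule given by a bilinear map. -/
def freeLiftLinear {N : Type u} [AddCommGroup N] [Module k N] (g : Env k A →ₗ[k] E →ₗ[k] N) :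
    free k A E →ₗ[k] N where
  toFun := TensorProduct.lift g
  map_add' := map_add (TensorProduct.lift g)
  map_smul' c z := (congrArg (TensorProduct.lift g) (free_smul_k k c z)).trans
    (LinearMap.map_smul (TensorProduct.lift g) c (show Env k A ⊗[k] E from z))

/-- The bimodule map on the free bimodule given by a linear map. -/
def freeLift {N : Bimodule k A} (g : E →ₗ[k] N) : free k A E ⟶ N :=
  let G := freeLiftLinear k
    ((Algebra.lsmul k k N : Env k A →ₐ[k] Module.End k N).toLinearMap.compl₂ g)
  ModuleCat.ofHom (X := free k A E) (Y := N)
    { toFun := G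
      map_add' := map_add G
      map_smul' := by
        have H : ∀ (r : Env k A) (z : free k A E), G (r • z) = r • G z := fun r z => by
          induction z using free_induction k with
          | mk r' u => exact mul_smul r r' (g u)
          | add y z hy hz => rw [smul_add, map_add, map_add, hy, hz, smul_add]
        exact H }

theorem freeLift_mk {N : Bimodule k A} (g : E →ₗ[k] N) (r : Env k A) (e : E) :
    (freeLift k g).hom (freeMk k A E r e) = r • g e := rfl

/-- The map `U ⊗_{Aᵉ} (Aᵉ ⊗ E) → U ⊗ E`. -/
def freeTensor (U : Bimodule k A) : BTensor k U (free k A E) →ₗ[k] U ⊗[k] E :=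
  BTensor.lift k
    (freeLiftLinear k ((LinearMap.llcomp k U U (U ⊗[k] E) ∘ₗ
      (TensorProduct.mk k U E).flip).compl₂
        ((Algebra.lsmul k k U : Env k A →ₐ[k] Module.End k U).toLinearMap ∘ₗ
          swapEnv k A)).flip).flip <| by
    intro a b u z
    induction z using free_induction k with
    | mk r e =>
      change (swapEnv k A r • act k a b u) ⊗ₜ[k] e =
        (swapEnv k A ((b ⊗ₜ[k] op a) * r) • u) ⊗ₜ[k] e
      rw [swapEnv_mul, swapEnv_tmul, mul_smul]
    | add y z hy hz =>
      have h : act k b a (y + z) = act k b a y + act k b a z := smul_add _ y z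
      rw [h, map_add, map_add, hy, hz]

theorem freeTensor_mk {U : Bimodule k A} (u : U) (r : Env k A) (e : E) :
    freeTensor k U (BTensor.mk k u (freeMk k A E r e)) = (swapEnv k A r • u) ⊗ₜ[k] e := rfl

/-- A left inverse is `u ⊗ e ↦ u ⊗ (1 ⊗ e)`, because the coefficient in `Aᵉ` can be moved onto `u`.
-/
theorem freeTensor_injective (U : Bimodule k A) :
    Function.Injective (freeTensor k U (E := E)) := by
  let g : U ⊗[k] E →ₗ[k] BTensor k U (free k A E) :=
    TensorProduct.lift ((BTensor.mkBilin k U (free k A E)).compl₂ (freeMk k A E 1))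
  have h : g ∘ₗ freeTensor k U = LinearMap.id := by
    refine BTensor.hom_ext k fun u z => ?_
    induction z using free_induction k with
    | mk r e =>
      change BTensor.mk k (swapEnv k A r • u) (freeMk k A E 1 e) = _
      rw [← BTensor.mk_smul, smul_freeMk, mul_one]
      rfl
    | add y z hy hz =>
      rw [← BTensor.mkBilin_apply, map_add, map_add, map_add]
      exact congrArg₂ (· + ·) hy hz
  exact Function.LeftInverse.injective (g := g) (LinearMap.congr_fun h)

variable (A E) in
-- Tensoring with `Aᵉ ⊗ E` amounts to tensoring with `E` over the field `k`, which preserves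
-- injections.
theorem isFlat_free : IsFlat k (free k A E) := by
  intro U V f hf z w hzw
  apply freeTensor_injective k U
  apply Module.Flat.rTensor_preserves_injective_linearMap (M := E) (f.hom.restrictScalars k) hf
  have h : ∀ z, (f.hom.restrictScalars k).rTensor E (freeTensor k U z) =
      freeTensor k V (BTensor.map k f (𝟙 (free k A E)) z) := by
    refine LinearMap.congr_fun (f := (f.hom.restrictScalars k).rTensor E ∘ₗ freeTensor k U)
      (g := freeTensor k V ∘ₗ BTensor.map k f (𝟙 (free k A E))) (BTensor.hom_ext k fun u z => ?_)
    change (f.hom.restrictScalars k).rTensor E (freeTensor k U (BTensor.mk k u z)) =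
      freeTensor k V (BTensor.mk k (f.hom u) z)
    induction z using free_induction k with
    | mk r e =>
      rw [freeTensor_mk, freeTensor_mk, LinearMap.rTensor_tmul, ← map_smul]
      rfl
    | add y z hy hz =>
      rw [← BTensor.mkBilin_apply, ← BTensor.mkBilin_apply] at *
      rw [map_add, map_add, map_add, hy, hz, map_add, map_add]
  rw [h, h, hzw]

end Free

/-- The action map from the free bimodule on the underlying space of `X` to `X`. -/
def freeCover (X : Bimodule k A) : free k A X ⟶ X := freeLift k LinearMap.id

theorem freeCover_surjective (X : Bimodule k A) : Function.Surjective (freeCover k X).hom :=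
  fun x => ⟨freeMk k A X 1 x, (freeLift_mk k _ _ _).trans (one_smul _ x)⟩

/-! ### Kernels -/

variable {k}

/-- The kernel of a bimodule map. -/
def kerObj {M N : Bimodule k A} (g : M ⟶ N) : Bimodule k A :=
  ModuleCat.of (Env k A) (LinearMap.ker g.hom)

/-- The inclusion of the kernel. -/
def kerIncl {M N : Bimodule k A} (g : M ⟶ N) : kerObj g ⟶ M :=
  ModuleCat.ofHom (X := LinearMap.ker g.hom) (LinearMap.ker g.hom).subtype

theorem kerIncl_injective {M N : Bimodule k A} (g : M ⟶ N) :
    Function.Injective (kerIncl g).hom := Subtype.val_injective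

theorem kerIncl_comp {M N : Bimodule k A} (g : M ⟶ N) : kerIncl g ≫ g = 0 :=
  ModuleCat.hom_ext (LinearMap.ext fun x => x.2)

theorem kerIncl_exact {M N : Bimodule k A} (g : M ⟶ N) :
    Function.Exact (kerIncl g).hom g.hom :=
  fun x => ⟨fun hx => ⟨⟨x, hx⟩, rfl⟩, fun ⟨y, hy⟩ => hy ▸ y.2⟩

/-- The factorization through the kernel. -/
def kerLift {L M N : Bimodule k A} (g : M ⟶ N) (f : L ⟶ M) (h : f ≫ g = 0) : L ⟶ kerObj g :=
  ModuleCat.ofHom (Y := LinearMap.ker g.hom)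
    (f.hom.codRestrict _ fun x => LinearMap.congr_fun (congrArg ModuleCat.Hom.hom h) x)

theorem kerLift_comp {L M N : Bimodule k A} (g : M ⟶ N) (f : L ⟶ M) (h : f ≫ g = 0) :
    kerLift g f h ≫ kerIncl g = f := rfl

/-! ### Flat bimodules -/

theorem IsFlat.map_injective_left {P U V : Bimodule k A} (hP : IsFlat k P) (f : U ⟶ V)
    (hf : Function.Injective f.hom) : Function.Injective (BTensor.map k (𝟙 P) f) :=
  BTensor.map_swap_injective k _ _ (hP U V f hf)

theorem BTensor.map_comm_square {X Y P Q : Bimodule k A} (f : X ⟶ Y) (g : P ⟶ Q)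
    (z : BTensor k X P) :
    BTensor.map k f (𝟙 Q) (BTensor.map k (𝟙 X) g z) =
      BTensor.map k (𝟙 Y) g (BTensor.map k f (𝟙 P) z) := by
  rw [BTensor.map_comp, BTensor.map_comp, Category.id_comp, Category.comp_id, Category.id_comp,
    Category.comp_id]

theorem BTensor.exact_left (P : Bimodule k A) {K L M : Bimodule k A} (f : K ⟶ L) (g : L ⟶ M)
    (hfg : Function.Exact f.hom g.hom) (hg : Function.Surjective g.hom) :
    Function.Exact (BTensor.map k f (𝟙 P)) (BTensor.map k g (𝟙 P)) := by
  intro z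
  have h := BTensor.exact_right k P f g hfg hg (BTensor.comm k L P z)
  rw [← BTensor.comm_map] at h
  constructor
  · intro hz
    obtain ⟨y, hy⟩ := h.1 (by rw [hz, map_zero])
    refine ⟨BTensor.comm k P K y, ?_⟩
    rw [← BTensor.comm_map, hy, BTensor.comm_comm]
  · rintro ⟨y, rfl⟩
    apply BTensor.comm_injective k
    rw [map_zero]
    exact h.2 ⟨BTensor.comm k K P y, (BTensor.comm_map k _ _ _).symm⟩

/-- A short exact sequence with flat quotient stays exact after tensoring. -/
theorem IsFlat.map_injective_of_exact {K F F' : Bimodule k A} (hF' : IsFlat k F') (i : K ⟶ F)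
    (p : F ⟶ F') (hi : Function.Injective i.hom) (hip : Function.Exact i.hom p.hom)
    (hp : Function.Surjective p.hom) (X : Bimodule k A) :
    Function.Injective (BTensor.map k (𝟙 X) i) := by
  -- This is the vanishing of `Tor₁(X, F')`, done as a chase with `0 → ker c → free → X → 0`. Lift
  -- `z` to the free cover; its image in `free ⊗ F` comes from some `y` in `ker c ⊗ F`. Flatness of
  -- `F'` pushes `y` back to `w` in `ker c ⊗ K`, and flatness of the free bimodule identifies the
  -- image of `w` with the lift of `z`, so `z` dies in `X ⊗ K`.
  let c := freeCover k X
  have hc : Function.Surjective c.hom := freeCover_surjective k X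
  rw [injective_iff_map_eq_zero]
  intro z hz
  obtain ⟨z, rfl⟩ := BTensor.map_surjective k c (𝟙 K) hc Function.surjective_id z
  rw [← BTensor.map_comm_square] at hz
  obtain ⟨y, hy⟩ := (BTensor.exact_left F (kerIncl c) c (kerIncl_exact c) hc _).1 hz
  have h1 : BTensor.map k (𝟙 _) p y = 0 := by
    apply hF' _ _ (kerIncl c) (kerIncl_injective c)
    rw [BTensor.map_comm_square, hy, BTensor.map_comp, map_zero]
    have : i ≫ p = 0 := ModuleCat.hom_ext (LinearMap.ext hip.apply_apply_eq_zero)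
    rw [this, BTensor.map_zero_right]
  obtain ⟨w, rfl⟩ := (BTensor.exact_right k _ i p hip hp y).1 h1
  have h2 : BTensor.map k (kerIncl c) (𝟙 K) w = z := by
    apply (isFlat_free k A X).map_injective_left i hi
    rw [← BTensor.map_comm_square, hy]
  rw [← h2]
  exact (BTensor.exact_left K (kerIncl c) c (kerIncl_exact c) hc).apply_apply_eq_zero w

/-- `U ⊗ K` embeds into `U ⊗ F` because `F'` is flat, and on `U ⊗ F` injections in `U` are preserved
because `F` is flat. -/
theorem IsFlat.of_exact {K F F' : Bimodule k A} (hF : IsFlat k F) (hF' : IsFlat k F') (i : K ⟶ F)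
    (p : F ⟶ F') (hi : Function.Injective i.hom) (hip : Function.Exact i.hom p.hom)
    (hp : Function.Surjective p.hom) : IsFlat k K := by
  intro U V f hf z w hzw
  apply hF'.map_injective_of_exact i p hi hip hp U
  apply hF U V f hf
  rw [BTensor.map_comm_square, BTensor.map_comm_square, hzw]

theorem IsFlat.of_retract {P Q : Bimodule k A} (hQ : IsFlat k Q) (i : P ⟶ Q) (r : Q ⟶ P)
    (h : i ≫ r = 𝟙 P) : IsFlat k P := by
  intro U V f hf z w hzw
  have hi : Function.Injective (BTensor.map k (𝟙 U) i) := by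
    refine Function.LeftInverse.injective (g := BTensor.map k (𝟙 U) r) fun z => ?_
    rw [BTensor.map_comp, h, Category.id_comp, BTensor.map_id]
  apply hi
  apply hQ U V f hf
  rw [BTensor.map_comm_square, BTensor.map_comm_square, hzw]

theorem IsFlat.of_subsingleton {P : Bimodule k A} [Subsingleton P] : IsFlat k P := by
  intro U V f _ z w _
  have : 𝟙 P = 0 := ModuleCat.hom_ext (LinearMap.ext fun x => Subsingleton.elim _ _)
  rw [← BTensor.map_id k z, ← BTensor.map_id k w, this, BTensor.map_zero_right,
    BTensor.map_zero_right]

/-- Two bimodules with maps as in a direct sum decomposition of `P`. -/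
theorem IsFlat.of_biproduct {P Q Q' : Bimodule k A} (hQ : IsFlat k Q) (hQ' : IsFlat k Q')
    (p : P ⟶ Q) (p' : P ⟶ Q') (i : Q ⟶ P) (i' : Q' ⟶ P) (h : p ≫ i + p' ≫ i' = 𝟙 P) :
    IsFlat k P := by
  intro U V f hf z w hzw
  have key : ∀ {T : Bimodule k A} (hT : IsFlat k T) (q : P ⟶ T),
      BTensor.map k (𝟙 U) q z = BTensor.map k (𝟙 U) q w := fun hT q => by
    apply hT U V f hf
    rw [BTensor.map_comm_square, BTensor.map_comm_square, hzw]
  have dec : ∀ z : BTensor k U P, z = BTensor.map k (𝟙 U) i (BTensor.map k (𝟙 U) p z) +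
      BTensor.map k (𝟙 U) i' (BTensor.map k (𝟙 U) p' z) := fun z => by
    rw [BTensor.map_comp, BTensor.map_comp, Category.id_comp, ← BTensor.map_add_right, h,
      BTensor.map_id]
  rw [dec z, dec w, key hQ, key hQ']

/-- A nonnegatively graded exact complex of flat bimodules stays exact after tensoring. -/
theorem IsFlat.tensor_exact (W : ℕ → Bimodule k A) (D : ∀ n, W (n + 1) ⟶ W n)
    (hW : ∀ n, IsFlat k (W n)) (hD : Function.Surjective (D 0).hom)
    (hex : ∀ n, Function.Exact (D (n + 1)).hom (D n).hom) (X : Bimodule k A) (n : ℕ) :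
    Function.Exact (BTensor.map k (𝟙 X) (D (n + 1))) (BTensor.map k (𝟙 X) (D n)) := by
  -- Each differential is factored as a surjection onto a flat image followed by an inclusion that
  -- stays injective after tensoring. The next image is the kernel of the surjection, so flatness
  -- propagates upwards.
  have key : ∀ n, ∃ (F : Bimodule k A) (p : W (n + 1) ⟶ F) (j : F ⟶ W n), IsFlat k F ∧
      Function.Surjective p.hom ∧ Function.Injective j.hom ∧ p ≫ j = D n ∧
      Function.Injective (BTensor.map k (𝟙 X) j) ∧
      ∃ (F' : Bimodule k A) (p' : W (n + 2) ⟶ F') (j' : F' ⟶ W (n + 1)), IsFlat k F' ∧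
      Function.Surjective p'.hom ∧ Function.Injective j'.hom ∧ p' ≫ j' = D (n + 1) ∧
      Function.Injective (BTensor.map k (𝟙 X) j') ∧ Function.Exact j'.hom p.hom := by
    have step : ∀ n (F : Bimodule k A) (p : W (n + 1) ⟶ F) (j : F ⟶ W n), IsFlat k F →
      Function.Surjective p.hom → Function.Injective j.hom → p ≫ j = D n →
      ∃ (F' : Bimodule k A) (p' : W (n + 2) ⟶ F') (j' : F' ⟶ W (n + 1)), IsFlat k F' ∧
      Function.Surjective p'.hom ∧ Function.Injective j'.hom ∧ p' ≫ j' = D (n + 1) ∧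
      Function.Injective (BTensor.map k (𝟙 X) j') ∧ Function.Exact j'.hom p.hom := by
      intro n F p j hF hp hj hpj
      have hz : D (n + 1) ≫ p = 0 := by
        refine ModuleCat.hom_ext (LinearMap.ext fun x => hj ?_)
        have := (hex n).apply_apply_eq_zero x
        rw [← hpj] at this
        exact this.trans (map_zero j.hom).symm
      refine ⟨kerObj p, kerLift p (D (n + 1)) hz, kerIncl p,
        (hW _).of_exact hF _ p (kerIncl_injective p) (kerIncl_exact p) hp, ?_,
        kerIncl_injective p, kerLift_comp _ _ _,
        hF.map_injective_of_exact _ p (kerIncl_injective p) (kerIncl_exact p) hp X,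
        kerIncl_exact p⟩
      intro y
      obtain ⟨x, hx⟩ := (hex n ((kerIncl p).hom y)).1 (by
        rw [← hpj]
        exact (congrArg j.hom ((kerIncl_exact p).apply_apply_eq_zero y)).trans (map_zero _))
      exact ⟨x, kerIncl_injective p hx⟩
    intro n
    induction n with
    | zero =>
      -- The last differential is onto, so its image is the flat bimodule `W 0` itself.
      exact ⟨W 0, D 0, 𝟙 _, hW 0, hD, Function.injective_id, Category.comp_id _,
        fun z w h => by rwa [BTensor.map_id, BTensor.map_id] at h,
        step 0 _ (D 0) (𝟙 _) (hW 0) hD Function.injective_id (Category.comp_id _)⟩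
    | succ n ih =>
      obtain ⟨-, -, -, -, -, -, -, -, F', p', j', h1, h2, h3, h4, h5, -⟩ := ih
      exact ⟨F', p', j', h1, h2, h3, h4, h5, step _ _ p' j' h1 h2 h3 h4⟩
  obtain ⟨F, p, j, hF, hp, hj, hpj, hXj, F', p', j', hF', hp', hj', hpj', hXj', hjp⟩ := key n
  rw [← hpj, ← hpj']
  intro z
  constructor
  · intro hz
    rw [← Category.id_comp (𝟙 X), ← BTensor.map_comp] at hz
    have hz' := hXj (hz.trans (map_zero _).symm)
    obtain ⟨y, rfl⟩ := (BTensor.exact_right k X j' p hjp hp z).1 hz'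
    obtain ⟨w, rfl⟩ := BTensor.map_surjective k (𝟙 X) p' Function.surjective_id hp' y
    exact ⟨w, by rw [BTensor.map_comp, Category.id_comp]⟩
  · rintro ⟨w, rfl⟩
    rw [BTensor.map_comp, hpj, hpj']
    have : D (n + 1) ≫ D n = 0 :=
      ModuleCat.hom_ext (LinearMap.ext (hex n).apply_apply_eq_zero)
    rw [this, BTensor.map_zero_right]

end Flatness

/-! ### Auxiliary linear maps. -/

section LinearAlgebra

variable {k : Type u} [Field k] {L M N Y Z : Type u} [AddCommGroup L] [AddCommGroup M]
  [AddCommGroup N] [AddCommGroup Y] [AddCommGroup Z] [Module k L] [Module k M] [Module k N]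
  [Module k Y] [Module k Z]

/-- The bilinear family of composites `p y ∘ q z`. -/
def compBilin (p : Y →ₗ[k] M →ₗ[k] N) (q : Z →ₗ[k] L →ₗ[k] M) : Y →ₗ[k] Z →ₗ[k] L →ₗ[k] N :=
  (LinearMap.llcomp k L M N ∘ₗ p).compl₂ q

/-- The action `R → End M` of an algebra on a module, as a linear map. -/
abbrev smulLinear {R : Type u} [Ring R] [Algebra k R] (M : ModuleCat.{u} R) :
    R →ₗ[k] M →ₗ[k] M :=
  (Algebra.lsmul k k M : R →ₐ[k] Module.End k M).toLinearMap

/-- The identity of `N`, as a `k`-linear map from the restriction of scalars of `N`. -/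
def restrictToLinear {S R : Type u} [Ring S] [Algebra k S] [Ring R] [Algebra k R] (f : S →ₐ[k] R)
    (N : ModuleCat.{u} R) : (ModuleCat.restrictScalars f.toRingHom).obj N →ₗ[k] N where
  toFun x := x
  map_add' _ _ := rfl
  map_smul' c x := by
    change f (algebraMap k S c) • (show N from x) = algebraMap k R c • (show N from x)
    rw [AlgHom.commutes]

/-- The identity of `N`, as a `k`-linear map to the restriction of scalars of `N`. -/
def restrictOfLinear {S R : Type u} [Ring S] [Algebra k S] [Ring R] [Algebra k R] (f : S →ₐ[k] R)
    (N : ModuleCat.{u} R) : N →ₗ[k] (ModuleCat.restrictScalars f.toRingHom).obj N where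
  toFun x := x
  map_add' _ _ := rfl
  map_smul' c x := (LinearMap.map_smul (restrictToLinear f N) c
    (show (ModuleCat.restrictScalars f.toRingHom).obj N from x)).symm

end LinearAlgebra

/-! ### The bimodules `A ⊗ M` and `M ⊗ A`, and their tensor products with `A`. -/

section Steps

variable (k : Type u) [Field k] {A : Type u} [Ring A] [Algebra k A]

variable (A) in
theorem regular_smul_k (c : k) (x : A) :
    c • (show regular k A from x) = (show regular k A from (c • x : A)) := by
  change AlgHom.mulLeftRight k A (algebraMap k (Env k A) c) x = c • x
  rw [AlgHom.commutes]
  rfl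

variable (A) in
/-- The identity of `A`, as a linear map from the bimodule `A`. -/
def regularTo : regular k A →ₗ[k] A where
  toFun x := x
  map_add' _ _ := rfl
  map_smul' c x := regular_smul_k k A c x

variable (A) in
/-- The identity of `A`, as a linear map to the bimodule `A`. -/
def regularOf : A →ₗ[k] regular k A where
  toFun x := x
  map_add' _ _ := rfl
  map_smul' c x := (regular_smul_k k A c x).symm

theorem regularOf_surjective : Function.Surjective (regularOf k A) := fun x => ⟨x, rfl⟩

theorem regularTo_act (a b : A) (x : regular k A) :
    regularTo k A (act k a b x) = a * regularTo k A x * b := regular_act k a b x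

theorem act_regularOf (a b x : A) :
    act k a b (regularOf k A x) = regularOf k A (a * x * b) := regular_act k a b x

theorem act_act {M : Bimodule k A} (a b c d : A) (m : M) :
    act k a b (act k c d m) = act k (a * c) (d * b) m := by
  rw [act, act, smul_smul, Algebra.TensorProduct.tmul_mul_tmul]
  rfl

theorem act_one {M : Bimodule k A} (m : M) : act k 1 1 m = m := one_smul (Env k A) m

theorem act_add {M : Bimodule k A} (a b : A) (m m' : M) :
    act k a b (m + m') = act k a b m + act k a b m' := smul_add _ m m'

/-- The linear map on `A ⊗ M` given by a bilinear map. -/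
def stepLiftLinear {M : Bimodule k A} {N : Type u} [AddCommGroup N] [Module k N]
    (f : A →ₗ[k] M →ₗ[k] N) : step k M →ₗ[k] N where
  toFun := TensorProduct.lift f
  map_add' := map_add (TensorProduct.lift f)
  map_smul' c z := (congrArg (TensorProduct.lift f) (step_smul_k k c z)).trans
    (LinearMap.map_smul (TensorProduct.lift f) c (show A ⊗[k] M from z))

theorem step_induction {M : Bimodule k A} {motive : step k M → Prop}
    (mk : ∀ c m, motive (stepMk k M c m)) (add : ∀ y z, motive y → motive z → motive (y + z))
    (z : step k M) : motive z :=
  TensorProduct.induction_on (motive := motive) z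
    (by have h := mk 0 0; rwa [map_zero] at h) mk add

theorem stepMap_injective {M N : Bimodule k A} (g : M ⟶ N) (hg : Function.Injective g.hom) :
    Function.Injective (stepMap k g).hom :=
  Module.Flat.lTensor_preserves_injective_linearMap (M := A) (g.hom.restrictScalars k) hg

/-- The bimodule structure `a (m ⊗ c) b = a m ⊗ c b` on `M ⊗ A`. -/
def stepRightAct (M : Bimodule k A) : Env k A →ₐ[k] Module.End k (M ⊗[k] A) :=
  (Module.endTensorEndAlgHom (R := k) (S := k) (A := k) (M := M) (N := A)).comp
    (Algebra.TensorProduct.map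
      ((Algebra.lsmul k k M : Env k A →ₐ[k] Module.End k M).comp
        Algebra.TensorProduct.includeLeft)
      (Algebra.lsmul k k A : Aᵐᵒᵖ →ₐ[k] Module.End k A))

/-- The bimodule `M ⊗ A`. -/
def stepRight (M : Bimodule k A) : Bimodule k A :=
  @ModuleCat.of (Env k A) _ (M ⊗[k] A) _ (Module.compHom (M ⊗[k] A) (stepRightAct k M).toRingHom)

theorem stepRight_smul_k {M : Bimodule k A} (c : k) (z : M ⊗[k] A) :
    c • (show stepRight k M from z) = (show stepRight k M from (c • z : M ⊗[k] A)) := by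
  change stepRightAct k M (algebraMap k (Env k A) c) z = c • z
  rw [AlgHom.commutes]
  rfl

/-- The bilinear map `(m, c) ↦ m ⊗ c` to the bimodule `M ⊗ A`. -/
def stepRightMk (M : Bimodule k A) : M →ₗ[k] A →ₗ[k] stepRight k M :=
  LinearMap.mk₂ k (fun m c => (show stepRight k M from m ⊗ₜ[k] c))
    (fun m m' c => TensorProduct.add_tmul m m' c)
    (fun r m c => by rw [stepRight_smul_k]; rfl)
    (fun m c c' => TensorProduct.tmul_add m c c')
    (fun r m c => by rw [stepRight_smul_k, ← TensorProduct.tmul_smul])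

theorem act_stepRightMk {M : Bimodule k A} (a b c : A) (m : M) :
    act k a b (stepRightMk k M m c) = stepRightMk k M (act k a 1 m) (c * b) := rfl

theorem stepRight_induction {M : Bimodule k A} {motive : stepRight k M → Prop}
    (mk : ∀ m c, motive (stepRightMk k M m c)) (add : ∀ y z, motive y → motive z → motive (y + z))
    (z : stepRight k M) : motive z :=
  TensorProduct.induction_on (motive := motive) z
    (by have h := mk 0 0; rwa [map_zero] at h) mk add

/-- The linear map on `M ⊗ A` given by a bilinear map. -/
def stepRightLiftLinear {M : Bimodule k A} {N : Type u} [AddCommGroup N] [Module k N]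
    (f : M →ₗ[k] A →ₗ[k] N) : stepRight k M →ₗ[k] N where
  toFun := TensorProduct.lift f
  map_add' := map_add (TensorProduct.lift f)
  map_smul' c z := (congrArg (TensorProduct.lift f) (stepRight_smul_k k c z)).trans
    (LinearMap.map_smul (TensorProduct.lift f) c (show M ⊗[k] A from z))

/-- The bimodule map `M ⊗ A → N ⊗ A`, `m ⊗ c ↦ g m ⊗ c`. -/
def stepRightMap {M N : Bimodule k A} (g : M ⟶ N) : stepRight k M ⟶ stepRight k N :=
  let G := stepRightLiftLinear k ((stepRightMk k N) ∘ₗ (g.hom.restrictScalars k))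
  ModuleCat.ofHom (X := stepRight k M) (Y := stepRight k N)
    { toFun := G
      map_add' := map_add G
      map_smul' := by
        refine map_smul_of_act k G.toAddMonoidHom fun a b z => ?_
        change G (act k a b z) = act k a b (G z)
        induction z using stepRight_induction k with
        | mk m c =>
          change stepRightMk k N (g.hom (act k a 1 m)) (c * b) =
            act k a b (stepRightMk k N (g.hom m) c)
          rw [map_smul]
          rfl
        | add y z hy hz => rw [act_add, map_add, map_add, hy, hz, act_add] }

theorem stepRightMap_mk {M N : Bimodule k A} (g : M ⟶ N) (m : M) (c : A) :
    (stepRightMap k g).hom (stepRightMk k M m c) = stepRightMk k N (g.hom m) c := rfl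

theorem stepRightMap_injective {M N : Bimodule k A} (g : M ⟶ N) (hg : Function.Injective g.hom) :
    Function.Injective (stepRightMap k g).hom :=
  Module.Flat.rTensor_preserves_injective_linearMap (M := A) (g.hom.restrictScalars k) hg

/-- The map `(A ⊗ M) ⊗_{Aᵉ} A → M`, `(c ⊗ m) ⊗ x ↦ m x c`. -/
def stepTensorRegular (M : Bimodule k A) : BTensor k (step k M) (regular k A) →ₗ[k] M :=
  BTensor.lift k
    (stepLiftLinear k (compBilin
      (((smulLinear M).comp
        ((Algebra.TensorProduct.includeRight : Aᵐᵒᵖ →ₐ[k] Env k A).toLinearMap ∘ₗ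
          (opLinearEquiv k).toLinearMap)).flip)
      ((LinearMap.mul k A).flip.compl₂ (regularTo k A))).flip) <| by
    intro a b z p
    induction z using step_induction k with
    | mk c m =>
      change act k 1 (regularTo k A p * (a * c)) (act k 1 b m) =
        act k 1 (regularTo k A (act k b a p) * c) m
      rw [act_act, regularTo_act]
      simp only [mul_assoc, one_mul]
    | add y z hy hz => rw [act_add, map_add, map_add, LinearMap.add_apply, LinearMap.add_apply, hy, hz]

theorem stepTensorRegular_mk {M : Bimodule k A} (c : A) (m : M) (x : A) :
    stepTensorRegular k M (BTensor.mk k (stepMk k M c m) (regularOf k A x)) = act k 1 (x * c) m :=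
  rfl

/-- A left inverse is `m ↦ (1 ⊗ m) ⊗ 1`: both `c` and `x` can be carried across the tensor sign to
act on `m` from the right. The left structure of `M` plays no role. -/
theorem stepTensorRegular_injective (M : Bimodule k A) :
    Function.Injective (stepTensorRegular k M) := by
  let g : M →ₗ[k] BTensor k (step k M) (regular k A) :=
    (BTensor.mkBilin k (step k M) (regular k A)).flip (regularOf k A 1) ∘ₗ stepMk k M 1
  have h : g ∘ₗ stepTensorRegular k M = LinearMap.id := by
    refine BTensor.hom_ext k fun z x => ?_
    obtain ⟨x, rfl⟩ := regularOf_surjective k x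
    change g (stepTensorRegular k M (BTensor.mk k z (regularOf k A x))) =
      BTensor.mk k z (regularOf k A x)
    induction z using step_induction k with
    | mk c m =>
      rw [stepTensorRegular_mk]
      have h1 : stepMk k M 1 (act k 1 (x * c) m) = act k 1 (x * c) (stepMk k M 1 m) := by
        rw [act_stepMk, one_mul]
      have h2 : stepMk k M c m = act k c 1 (stepMk k M 1 m) := by
        rw [act_stepMk, mul_one, act_one]
      change BTensor.mk k (stepMk k M 1 (act k 1 (x * c) m)) (regularOf k A 1) = _
      rw [h1, h2, BTensor.act_mk, BTensor.act_mk, act_regularOf, act_regularOf]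
      simp
    | add y z hy hz =>
      rw [← BTensor.mkBilin_apply] at *
      rw [map_add, LinearMap.add_apply, map_add, map_add]
      exact congrArg₂ (· + ·) hy hz
  exact Function.LeftInverse.injective (g := g) (LinearMap.congr_fun h)

/-- The map `(M ⊗ A) ⊗_{Aᵉ} A → M`, `(m ⊗ c) ⊗ x ↦ c x m`. -/
def stepRightTensorRegular (M : Bimodule k A) :
    BTensor k (stepRight k M) (regular k A) →ₗ[k] M :=
  BTensor.lift k
    (stepRightLiftLinear k (compBilin
      (((smulLinear M).comp
        (Algebra.TensorProduct.includeLeft : A →ₐ[k] Env k A).toLinearMap).flip)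
      ((LinearMap.mul k A).compl₂ (regularTo k A)))) <| by
    intro a b z p
    induction z using stepRight_induction k with
    | mk m c =>
      change act k (c * b * regularTo k A p) 1 (act k a 1 m) =
        act k (c * regularTo k A (act k b a p)) 1 m
      rw [act_act, regularTo_act]
      simp only [mul_assoc, one_mul]
    | add y z hy hz => rw [act_add, map_add, map_add, LinearMap.add_apply, LinearMap.add_apply, hy, hz]

theorem stepRightTensorRegular_mk {M : Bimodule k A} (c : A) (m : M) (x : A) :
    stepRightTensorRegular k M (BTensor.mk k (stepRightMk k M m c) (regularOf k A x)) =
      act k (c * x) 1 m :=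
  rfl

/-- Mirror image of `stepTensorRegular_injective`, with left inverse `m ↦ (m ⊗ 1) ⊗ 1`. -/
theorem stepRightTensorRegular_injective (M : Bimodule k A) :
    Function.Injective (stepRightTensorRegular k M) := by
  let g : M →ₗ[k] BTensor k (stepRight k M) (regular k A) :=
    (BTensor.mkBilin k (stepRight k M) (regular k A)).flip (regularOf k A 1) ∘ₗ
      (stepRightMk k M).flip 1
  have h : g ∘ₗ stepRightTensorRegular k M = LinearMap.id := by
    refine BTensor.hom_ext k fun z x => ?_
    obtain ⟨x, rfl⟩ := regularOf_surjective k x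
    change g (stepRightTensorRegular k M (BTensor.mk k z (regularOf k A x))) =
      BTensor.mk k z (regularOf k A x)
    induction z using stepRight_induction k with
    | mk m c =>
      rw [stepRightTensorRegular_mk]
      have h1 : stepRightMk k M (act k (c * x) 1 m) 1 =
          act k (c * x) 1 (stepRightMk k M m 1) := by
        rw [act_stepRightMk, one_mul]
      have h2 : stepRightMk k M m c = act k 1 c (stepRightMk k M m 1) := by
        rw [act_stepRightMk, one_mul, act_one]
      change BTensor.mk k (stepRightMk k M (act k (c * x) 1 m) 1) (regularOf k A 1) = _
      rw [h1, h2, BTensor.act_mk, BTensor.act_mk, act_regularOf, act_regularOf]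
      simp
    | add y z hy hz =>
      rw [← BTensor.mkBilin_apply] at *
      rw [map_add, LinearMap.add_apply, map_add, map_add]
      exact congrArg₂ (· + ·) hy hz
  exact Function.LeftInverse.injective (g := g) (LinearMap.congr_fun h)

/-- Under the embeddings `(A ⊗ M) ⊗_{Aᵉ} A → M` and the same for `N`, the map in question becomes
`f`. -/
theorem stepMap_tensorRegular_injective {M N : Bimodule k A} (f : M ⟶ N)
    (hf : Function.Injective f.hom) :
    Function.Injective (BTensor.map k (stepMap k f) (𝟙 (regular k A))) := by
  intro z w hzw
  apply stepTensorRegular_injective k M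
  apply hf
  have h : f.hom.restrictScalars k ∘ₗ stepTensorRegular k M =
      stepTensorRegular k N ∘ₗ BTensor.map k (stepMap k f) (𝟙 (regular k A)) := by
    refine BTensor.hom_ext k fun z x => ?_
    obtain ⟨x, rfl⟩ := regularOf_surjective k x
    change f.hom (stepTensorRegular k M (BTensor.mk k z (regularOf k A x))) =
      stepTensorRegular k N (BTensor.mk k ((stepMap k f).hom z) (regularOf k A x))
    induction z using step_induction k with
    | mk c m =>
      rw [stepMap_mk, stepTensorRegular_mk, stepTensorRegular_mk, map_smul]
    | add y z hy hz =>
      rw [← BTensor.mkBilin_apply, ← BTensor.mkBilin_apply] at *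
      rw [map_add, map_add, LinearMap.add_apply, map_add, map_add, hy, hz, map_add,
        LinearMap.add_apply, map_add]
  have := LinearMap.congr_fun h z
  have h' := LinearMap.congr_fun h w
  rw [LinearMap.comp_apply, LinearMap.comp_apply] at this h'
  rw [hzw] at this
  exact this.trans h'.symm

theorem stepRightMap_tensorRegular_injective {M N : Bimodule k A} (f : M ⟶ N)
    (hf : Function.Injective f.hom) :
    Function.Injective (BTensor.map k (stepRightMap k f) (𝟙 (regular k A))) := by
  intro z w hzw
  apply stepRightTensorRegular_injective k M
  apply hf
  have h : f.hom.restrictScalars k ∘ₗ stepRightTensorRegular k M =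
      stepRightTensorRegular k N ∘ₗ BTensor.map k (stepRightMap k f) (𝟙 (regular k A)) := by
    refine BTensor.hom_ext k fun z x => ?_
    obtain ⟨x, rfl⟩ := regularOf_surjective k x
    change f.hom (stepRightTensorRegular k M (BTensor.mk k z (regularOf k A x))) =
      stepRightTensorRegular k N (BTensor.mk k ((stepRightMap k f).hom z) (regularOf k A x))
    induction z using stepRight_induction k with
    | mk m c =>
      rw [stepRightMap_mk, stepRightTensorRegular_mk, stepRightTensorRegular_mk, map_smul]
    | add y z hy hz =>
      rw [← BTensor.mkBilin_apply, ← BTensor.mkBilin_apply] at *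
      rw [map_add, map_add, LinearMap.add_apply, map_add, map_add, hy, hz, map_add,
        LinearMap.add_apply, map_add]
  have := LinearMap.congr_fun h z
  have h' := LinearMap.congr_fun h w
  rw [LinearMap.comp_apply, LinearMap.comp_apply] at this h'
  rw [hzw] at this
  exact this.trans h'.symm

end Steps

/-! ### Induction `U ↦ A ⊗_B U ⊗_B A` preserves injections when `A / B` is flat. -/

section Induction

variable {k : Type u} [Field k] {A : Type u} [Ring A] [Algebra k A] (B : Subalgebra k A)

/-- The projection `A → A / B` of `B`-bimodules. -/
def quotProj : (res B).obj (regular k A) ⟶ quotBimod B :=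
  ModuleCat.ofHom (X := (res B).obj (regular k A)) (Y := quotBimod B)
    (LinearMap.range (inclBimod B).hom).mkQ

theorem quotProj_surjective : Function.Surjective (quotProj B).hom :=
  Submodule.mkQ_surjective _

theorem inclBimod_injective : Function.Injective (inclBimod B).hom := Subtype.val_injective

theorem inclBimod_quotProj_exact : Function.Exact (inclBimod B).hom (quotProj B).hom :=
  fun x => Submodule.Quotient.mk_eq_zero (LinearMap.range (inclBimod B).hom) (x := x)

variable {B}

/-- Compare the sequences `M ⊗ B → M ⊗ A → M ⊗ A / B` and the same for `N`. An element killed by `f`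
dies in the flat quotient, hence comes from `M ⊗ B`; and `N ⊗ B → N ⊗ A` is still injective, so the
hypothesis on `B` finishes. -/
theorem tensor_regular_injective (hflat : IsFlat k (quotBimod B)) {M N : Bimodule k B} (f : M ⟶ N)
    (hf : Function.Injective f.hom)
    (hf' : Function.Injective (BTensor.map k f (𝟙 (regular k B)))) :
    Function.Injective (BTensor.map k f (𝟙 ((res B).obj (regular k A)))) := by
  rw [injective_iff_map_eq_zero]
  intro z hz
  have h1 : BTensor.map k (𝟙 M) (quotProj B) z = 0 := by
    apply hflat _ _ f hf
    rw [BTensor.map_comm_square, hz, map_zero, map_zero]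
  obtain ⟨y, rfl⟩ := (BTensor.exact_right k M _ _ (inclBimod_quotProj_exact B)
    (quotProj_surjective B) z).1 h1
  rw [BTensor.map_comm_square] at hz
  have h2 := hflat.map_injective_of_exact _ _ (inclBimod_injective B) (inclBimod_quotProj_exact B)
    (quotProj_surjective B) N (hz.trans (map_zero _).symm)
  rw [hf' (h2.trans (map_zero _).symm), map_zero]

variable (B)

/-- The identity of `A`, as a linear map from the `B`-bimodule `A`. -/
def resRegularTo : (res B).obj (regular k A) →ₗ[k] A :=
  regularTo k A ∘ₗ restrictToLinear (envIncl B) (regular k A)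

/-- The identity of `A`, as a linear map to the `B`-bimodule `A`. -/
def resRegularOf : A →ₗ[k] (res B).obj (regular k A) :=
  restrictOfLinear (envIncl B) (regular k A) ∘ₗ regularOf k A

theorem resRegularOf_surjective : Function.Surjective (resRegularOf B) := fun x => ⟨x, rfl⟩

theorem resRegularTo_act (a b : B) (x : (res B).obj (regular k A)) :
    resRegularTo B (act k a b x) = a * resRegularTo B x * b := regular_act k (a : A) (b : A) x

theorem act_resRegularOf (a b : B) (x : A) :
    act k a b (resRegularOf B x) = resRegularOf B (a * x * b) := regular_act k (a : A) (b : A) x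

/-- The inclusion `B ⊗ Bᵒᵖ → A ⊗ Bᵒᵖ`. -/
def leftIncl : Env k B →ₐ[k] A ⊗[k] Bᵐᵒᵖ := Algebra.TensorProduct.map B.val (AlgHom.id k Bᵐᵒᵖ)

theorem leftIncl_tmul (a b : B) : leftIncl B (a ⊗ₜ[k] op b) = (a : A) ⊗ₜ[k] op b := rfl

/-- The inclusion `A ⊗ Bᵒᵖ → A ⊗ Aᵒᵖ`. -/
def rightIncl : A ⊗[k] Bᵐᵒᵖ →ₐ[k] Env k A :=
  Algebra.TensorProduct.map (AlgHom.id k A) (AlgHom.op B.val)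

theorem rightIncl_tmul (a : A) (b : B) : rightIncl B (a ⊗ₜ[k] op b) = a ⊗ₜ[k] op (b : A) := rfl

theorem envIncl_tmul (a b : B) : envIncl B (a ⊗ₜ[k] op b) = (a : A) ⊗ₜ[k] op (b : A) := rfl

theorem rightIncl_leftIncl (s : Env k B) : rightIncl B (leftIncl B s) = envIncl B s := by
  induction s using env_induction k with
  | tmul a b => rfl
  | add s t hs ht => rw [map_add, map_add, map_add, hs, ht]

variable {B} in
-- Both sides are additive in `r` and in `s`. This produces the balancing hypothesis of
-- `extendLiftLinear` from a check on pure tensors.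
theorem balanced_of_tmul {C D : Type u} [Ring C] [Algebra k C] [Ring D] [Algebra k D]
    {U : Bimodule k B} {N : Type u} [AddCommGroup N] [Module k N] (f : Env k B →ₐ[k] C ⊗[k] Dᵐᵒᵖ)
    (g : (C ⊗[k] Dᵐᵒᵖ) →ₗ[k] U →ₗ[k] N)
    (h : ∀ (c : C) (d : D) (a b : B) (u : U), g (c ⊗ₜ[k] op d * f (a ⊗ₜ[k] op b)) u =
      g (c ⊗ₜ[k] op d) (act k a b u)) (r : C ⊗[k] Dᵐᵒᵖ) (s : Env k B) (u : U) :
    g (r * f s) u = g r (s • u) := by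
  induction s using env_induction k with
  | tmul a b =>
    induction r with
    | zero => rw [zero_mul, map_zero, LinearMap.zero_apply, LinearMap.zero_apply]
    | tmul c d => exact h c d.unop a b u
    | add r r' hr hr' =>
      rw [add_mul, map_add, map_add, LinearMap.add_apply, LinearMap.add_apply, hr, hr']
  | add s t hs ht => rw [map_add, mul_add, map_add, LinearMap.add_apply, hs, ht, add_smul, map_add]

/-- The `B`-bimodule `A ⊗_B U`. -/
def leftExtend (U : Bimodule k B) : Bimodule k B :=
  (ModuleCat.restrictScalars (leftIncl B).toRingHom).obj (extend (leftIncl B) U)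

/-- The map `A ⊗_B U → A ⊗_B V`. -/
def leftExtendMap {U V : Bimodule k B} (f : U ⟶ V) : leftExtend B U ⟶ leftExtend B V :=
  (ModuleCat.restrictScalars (leftIncl B).toRingHom).map ((extendFunctor (leftIncl B)).map f)

/-- The bilinear map to `A ⊗_B U`. -/
def leftExtendMk (U : Bimodule k B) : (A ⊗[k] Bᵐᵒᵖ) →ₗ[k] U →ₗ[k] leftExtend B U :=
  (extendMk (leftIncl B) U).compr₂ (restrictOfLinear (leftIncl B) _)

theorem act_leftExtendMk {U : Bimodule k B} (a b : B) (r : A ⊗[k] Bᵐᵒᵖ) (u : U) :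
    act k a b (leftExtendMk B U r u) = leftExtendMk B U ((a : A) ⊗ₜ[k] op b * r) u := rfl

theorem leftExtendMap_mk {U V : Bimodule k B} (f : U ⟶ V) (r : A ⊗[k] Bᵐᵒᵖ) (u : U) :
    (leftExtendMap B f).hom (leftExtendMk B U r u) = leftExtendMk B V r (f.hom u) :=
  extendFunctor_map_mk (leftIncl B) f r u

theorem leftExtend_induction {U : Bimodule k B} {motive : leftExtend B U → Prop}
    (mk : ∀ a u, motive (leftExtendMk B U (a ⊗ₜ[k] 1) u))
    (add : ∀ y z, motive y → motive z → motive (y + z))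
    (z : leftExtend B U) : motive z := by
  refine extend_induction (leftIncl B) (motive := motive) (fun r u => ?_) add z
  induction r with
  | zero => have h := mk 0 0; rw [map_zero] at h; rwa [map_zero, LinearMap.zero_apply]
  | tmul a b =>
    -- The factor in `Bᵒᵖ` already comes from `Bᵉ`, so it can be absorbed into `u`.
    have h := extendMk_mul (leftIncl B) (a ⊗ₜ[k] 1) (1 ⊗ₜ[k] b) u
    have h' : a ⊗ₜ[k] 1 * leftIncl B (1 ⊗ₜ[k] b) = a ⊗ₜ[k] b := by
      change a ⊗ₜ[k] 1 * (B.val 1) ⊗ₜ[k] b = a ⊗ₜ[k] b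
      rw [Algebra.TensorProduct.tmul_mul_tmul, map_one, mul_one, one_mul]
    rw [h'] at h
    rw [h]
    exact mk a _
  | add r r' hr hr' => rw [map_add, LinearMap.add_apply]; exact add _ _ hr hr'

/-- The `k`-linear map on `A ⊗_B U` given by a balanced bilinear map. -/
def leftExtendLift {U : Bimodule k B} {N : Type u} [AddCommGroup N] [Module k N]
    (g : (A ⊗[k] Bᵐᵒᵖ) →ₗ[k] U →ₗ[k] N) (hg : ∀ r s u, g (r * leftIncl B s) u = g r (s • u)) :
    leftExtend B U →ₗ[k] N :=
  extendLiftLinear (leftIncl B) g hg ∘ₗ restrictToLinear (leftIncl B) _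

/-- The map `A ⊗_B U → (U ⊗ B) ⊗_{Bᵉ} A`, `a ⊗ u ↦ (u ⊗ 1) ⊗ a`. -/
def leftExtendToTensor (U : Bimodule k B) :
    leftExtend B U →ₗ[k] BTensor k (stepRight k U) ((res B).obj (regular k A)) :=
  leftExtendLift B (TensorProduct.lift (compBilin
      (((BTensor.mkBilin k (stepRight k U) ((res B).obj (regular k A))) ∘ₗ
        (stepRightMk k U).flip 1).flip ∘ₗ resRegularOf B)
      ((smulLinear U) ∘ₗ
        (Algebra.TensorProduct.includeRight : Bᵐᵒᵖ →ₐ[k] Env k B).toLinearMap))) <|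
    balanced_of_tmul _ _ fun c d a b u => by
      rw [leftIncl_tmul, Algebra.TensorProduct.tmul_mul_tmul]
      change BTensor.mk k (stepRightMk k U (act k 1 (b * d) u) 1) (resRegularOf B (c * a)) =
        BTensor.mk k (stepRightMk k U (act k 1 d (act k a b u)) 1) (resRegularOf B c)
      have h : stepRightMk k U (act k 1 d (act k a b u)) 1 =
          act k a 1 (stepRightMk k U (act k 1 (b * d) u) 1) := by
        rw [act_stepRightMk, act_act, act_act]
        simp
      rw [h, BTensor.act_mk, act_resRegularOf]
      simp

theorem leftExtendToTensor_mk {U : Bimodule k B} (a : A) (b : B) (u : U) :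
    leftExtendToTensor B U (leftExtendMk B U (a ⊗ₜ[k] op b) u) =
      BTensor.mk k (stepRightMk k U (act k 1 b u) 1) (resRegularOf B a) := rfl

/-- The left inverse is `(u ⊗ c) ⊗ x ↦ c x ⊗ u`. In `(U ⊗ B) ⊗_{Bᵉ} A` the left action on `U` is
paired with the right action on `A`, and the free factor `B` uses up the other action; thus a
one-sided tensor product is written over `Bᵉ`, where the flatness hypothesis lives. -/
theorem leftExtendToTensor_injective (U : Bimodule k B) :
    Function.Injective (leftExtendToTensor B U) := by
  let g : BTensor k (stepRight k U) ((res B).obj (regular k A)) →ₗ[k] leftExtend B U :=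
    BTensor.lift k (stepRightLiftLinear k (compBilin (leftExtendMk B U).flip
      (((LinearMap.mul k A).compl₁₂ B.val.toLinearMap (resRegularTo B)).compr₂
        (Algebra.TensorProduct.includeLeft : A →ₐ[k] A ⊗[k] Bᵐᵒᵖ).toLinearMap))) <| by
    intro a b z p
    induction z using stepRight_induction k with
    | mk m c =>
      change leftExtendMk B U ((((c * b : B) : A) * resRegularTo B p) ⊗ₜ[k] 1) (act k a 1 m) =
        leftExtendMk B U (((c : A) * resRegularTo B (act k b a p)) ⊗ₜ[k] 1) m
      refine (extendMk_mul (leftIncl B) _ _ _).symm.trans ?_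
      rw [leftIncl_tmul, Algebra.TensorProduct.tmul_mul_tmul, resRegularTo_act]
      simp [mul_assoc]
      rfl
    | add y z hy hz =>
      rw [act_add, map_add, map_add, LinearMap.add_apply, LinearMap.add_apply, hy, hz]
  refine Function.LeftInverse.injective (g := g) fun z => ?_
  induction z using leftExtend_induction B with
  | mk a u =>
    refine (congrArg g (leftExtendToTensor_mk B a 1 u)).trans ?_
    change leftExtendMk B U ((((1 : B) : A) * a) ⊗ₜ[k] 1) (act k 1 1 u) = _
    rw [act_one]
    simp
  | add y z hy hz => rw [map_add, map_add, hy, hz]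

variable {B}

/-- Through `leftExtendToTensor` this is `tensor_regular_injective` for `U ⊗ B → V ⊗ B`: tensoring
these over `Bᵉ` with `B` gives back `f`, so the remaining hypothesis there holds. -/
theorem leftExtendMap_injective (hflat : IsFlat k (quotBimod B)) {U V : Bimodule k B} (f : U ⟶ V)
    (hf : Function.Injective f.hom) : Function.Injective (leftExtendMap B f).hom := by
  have key := tensor_regular_injective hflat (stepRightMap k f) (stepRightMap_injective k f hf)
    (stepRightMap_tensorRegular_injective k f hf)
  have nat : ∀ z, leftExtendToTensor B V ((leftExtendMap B f).hom z) =
      BTensor.map k (stepRightMap k f) (𝟙 _) (leftExtendToTensor B U z) := by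
    intro z
    induction z using leftExtend_induction B with
    | mk a u =>
      rw [leftExtendMap_mk]
      refine (leftExtendToTensor_mk B a 1 _).trans ?_
      refine Eq.trans ?_ (congrArg _ (leftExtendToTensor_mk B a 1 u).symm)
      rw [BTensor.map_mk, stepRightMap_mk, act_one, act_one]
      rfl
    | add y z hy hz => rw [map_add, map_add, map_add, map_add, hy, hz]
  intro z w hzw
  apply leftExtendToTensor_injective B U
  apply key
  rw [← nat, ← nat, hzw]

variable (B)

/-- The `A`-bimodule `A ⊗_B U ⊗_B A`, as a functor of the `B`-bimodule `U`. -/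
abbrev ind : Bimodule k B ⥤ Bimodule k A := extendFunctor (envIncl B)

/-- The bilinear map to `A ⊗_B U ⊗_B A`. -/
abbrev indMk (U : Bimodule k B) : Env k A →ₗ[k] U →ₗ[k] (ind B).obj U := extendMk (envIncl B) U

theorem act_indMk {U : Bimodule k B} (a b c d : A) (u : U) :
    act k a b (indMk B U (c ⊗ₜ[k] op d) u) = indMk B U ((a * c) ⊗ₜ[k] op (d * b)) u := by
  refine (smul_extendMk (envIncl B) _ _ u).trans ?_
  rw [Algebra.TensorProduct.tmul_mul_tmul]
  rfl

theorem ind_induction {U : Bimodule k B} {motive : (ind B).obj U → Prop}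
    (mk : ∀ a b u, motive (indMk B U (a ⊗ₜ[k] op b) u))
    (add : ∀ y z, motive y → motive z → motive (y + z))
    (z : (ind B).obj U) : motive z := by
  refine extend_induction (envIncl B) (motive := motive) (fun r u => ?_) add z
  induction r using env_induction k with
  | tmul a b => exact mk a b u
  | add r s hr hs =>
    rw [map_add, LinearMap.add_apply]
    exact add _ _ hr hs

/-- The map `A ⊗_B U ⊗_B A → (B ⊗ (A ⊗_B U)) ⊗_{Bᵉ} A`, `a ⊗ u ⊗ b ↦ (1 ⊗ (a ⊗ u)) ⊗ b`. -/
def indToTensor (U : Bimodule k B) : (ind B).obj U →ₗ[k]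
    BTensor k (step k (leftExtend B U)) ((res B).obj (regular k A)) :=
  extendLiftLinear (envIncl B) (TensorProduct.lift (compBilin
      (((BTensor.mkBilin k (step k (leftExtend B U)) ((res B).obj (regular k A))) ∘ₗ
        stepMk k (leftExtend B U) 1).flip ∘ₗ resRegularOf B ∘ₗ
          (opLinearEquiv k).symm.toLinearMap)
      (leftExtendMk B U ∘ₗ
        (Algebra.TensorProduct.includeLeft : A →ₐ[k] A ⊗[k] Bᵐᵒᵖ).toLinearMap)).flip) <|
    balanced_of_tmul _ _ fun c d a b u => by
      rw [envIncl_tmul, Algebra.TensorProduct.tmul_mul_tmul]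
      change BTensor.mk k (stepMk k (leftExtend B U) 1 (leftExtendMk B U ((c * a) ⊗ₜ[k] 1) u))
          (resRegularOf B (b * d)) =
        BTensor.mk k (stepMk k (leftExtend B U) 1 (leftExtendMk B U (c ⊗ₜ[k] 1) (act k a b u)))
          (resRegularOf B d)
      have h : stepMk k (leftExtend B U) 1 (leftExtendMk B U (c ⊗ₜ[k] 1) (act k a b u)) =
          act k 1 b
            (stepMk k (leftExtend B U) 1 (leftExtendMk B U ((c * a) ⊗ₜ[k] 1) u)) := by
        rw [act_stepMk, act_leftExtendMk, mul_one]
        refine congrArg (stepMk k (leftExtend B U) 1) ?_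
        refine (extendMk_mul (leftIncl B) _ _ _).symm.trans ?_
        rw [leftIncl_tmul]
        simp
        rfl
      rw [h, BTensor.act_mk, act_resRegularOf]
      simp

theorem indToTensor_mk {U : Bimodule k B} (a b : A) (u : U) :
    indToTensor B U (indMk B U (a ⊗ₜ[k] op b) u) =
      BTensor.mk k (stepMk k (leftExtend B U) 1 (leftExtendMk B U (a ⊗ₜ[k] 1) u))
        (resRegularOf B b) := rfl

/-- The map `A ⊗_B U → A ⊗_B U ⊗_B A`, `z ↦ z ⊗ 1`. -/
def leftExtendToInd (U : Bimodule k B) : leftExtend B U →ₗ[k] (ind B).obj U :=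
  leftExtendLift B (indMk B U ∘ₗ (rightIncl B).toLinearMap) fun r s u => by
    change indMk B U (rightIncl B (r * leftIncl B s)) u = indMk B U (rightIncl B r) (s • u)
    rw [map_mul, rightIncl_leftIncl]
    exact extendMk_mul (envIncl B) _ _ _

theorem leftExtendToInd_mk {U : Bimodule k B} (r : A ⊗[k] Bᵐᵒᵖ) (u : U) :
    leftExtendToInd B U (leftExtendMk B U r u) = indMk B U (rightIncl B r) u := rfl

theorem leftExtendToInd_act {U : Bimodule k B} (a b : B) (z : leftExtend B U) :
    leftExtendToInd B U (act k a b z) = act k (a : A) (b : A) (leftExtendToInd B U z) := by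
  induction z using leftExtend_induction B with
  | mk c u =>
    rw [act_leftExtendMk, leftExtendToInd_mk, map_mul, rightIncl_tmul]
    exact (smul_extendMk (envIncl B) _ _ u).symm
  | add y z hy hz => rw [act_add, map_add, map_add, hy, hz, act_add]

/-- The same device on the right-hand side, applied to `A ⊗_B U` in place of `U`; the left inverse
is `(c ⊗ t) ⊗ x ↦ t ⊗ x c`. -/
theorem indToTensor_injective (U : Bimodule k B) :
    Function.Injective (indToTensor B U) := by
  let g : BTensor k (step k (leftExtend B U)) ((res B).obj (regular k A)) →ₗ[k] (ind B).obj U :=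
    BTensor.lift k (stepLiftLinear k (compBilin
      ((smulLinear ((ind B).obj U)).flip ∘ₗ leftExtendToInd B U)
      (((LinearMap.mul k A).flip.compl₁₂ B.val.toLinearMap (resRegularTo B)).compr₂
        ((Algebra.TensorProduct.includeRight : Aᵐᵒᵖ →ₐ[k] Env k A).toLinearMap ∘ₗ
          (opLinearEquiv k).toLinearMap))).flip) <| by
    intro a b z p
    induction z using step_induction k with
    | mk c t =>
      change act k 1 (resRegularTo B p * ((a * c : B) : A)) (leftExtendToInd B U (act k 1 b t)) =
        act k 1 (resRegularTo B (act k b a p) * (c : A)) (leftExtendToInd B U t)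
      rw [leftExtendToInd_act, act_act, resRegularTo_act]
      simp [mul_assoc]
    | add y z hy hz =>
      rw [act_add, map_add, map_add, LinearMap.add_apply, LinearMap.add_apply, hy, hz]
  refine Function.LeftInverse.injective (g := g) fun z => ?_
  induction z using ind_induction B with
  | mk a b u =>
    rw [indToTensor_mk]
    change act k 1 (b * ((1 : B) : A)) (indMk B U (rightIncl B (a ⊗ₜ[k] op 1)) u) = _
    rw [rightIncl_tmul, act_indMk]
    simp
  | add y z hy hz => rw [map_add, map_add, hy, hz]

variable {B}

/-- Induction is extension on the left followed by extension on the right, and the flat quotient `A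
/ B` makes each of the two preserve injections. -/
theorem ind_map_injective (hflat : IsFlat k (quotBimod B)) {U V : Bimodule k B} (f : U ⟶ V)
    (hf : Function.Injective f.hom) : Function.Injective ((ind B).map f).hom := by
  have hf' := leftExtendMap_injective hflat f hf
  have key := tensor_regular_injective hflat (stepMap k (leftExtendMap B f))
    (stepMap_injective k _ hf') (stepMap_tensorRegular_injective k _ hf')
  have nat : ∀ z, indToTensor B V (((ind B).map f).hom z) =
      BTensor.map k (stepMap k (leftExtendMap B f)) (𝟙 _) (indToTensor B U z) := by
    intro z
    induction z using ind_induction B with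
    | mk a b u =>
      rw [indToTensor_mk, BTensor.map_mk, stepMap_mk, leftExtendMap_mk]
      exact (congrArg _ (extendFunctor_map_mk (envIncl B) f _ u)).trans (indToTensor_mk B a b _)
    | add y z hy hz => rw [map_add, map_add, map_add, map_add, hy, hz]
  intro z w hzw
  apply indToTensor_injective B U
  apply key
  rw [← nat, ← nat, hzw]

end Induction

/-! ### Induction and tensor products: adjunction, flatness, exactness. -/

section InductionFlat

variable {k : Type u} [Field k] {A : Type u} [Ring A] [Algebra k A] (B : Subalgebra k A)

theorem swapEnv_envIncl (s : Env k B) :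
    swapEnv k A (envIncl B s) = envIncl B (swapEnv k B s) := by
  induction s using env_induction k with
  | tmul a b => rfl
  | add s t hs ht => rw [map_add, map_add, map_add, map_add, hs, ht]

theorem tensorRes_comp (X : Bimodule k A) {P P' : Bimodule k B} {Q Q' : Bimodule k A}
    (g : P ⟶ (res B).obj Q) (g' : P' ⟶ (res B).obj Q') (p : P ⟶ P') (q : Q ⟶ Q')
    (h : g ≫ (res B).map q = p ≫ g') (z : BTensor k ((res B).obj X) P) :
    BTensor.map k (𝟙 X) q (tensorRes B X g z) =
      tensorRes B X g' (BTensor.map k (𝟙 _) p z) :=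
  LinearMap.congr_fun (f := BTensor.map k (𝟙 X) q ∘ₗ tensorRes B X g)
    (g := tensorRes B X g' ∘ₗ BTensor.map k (𝟙 _) p)
    (BTensor.hom_ext k fun x y => congrArg (BTensor.mk k (P := Q') (show X from x))
      (LinearMap.congr_fun (congrArg ModuleCat.Hom.hom h) y)) z

/-- The map `X ⊗_{Bᵉ} V → X ⊗_{Aᵉ} (A ⊗_B V ⊗_B A)`. -/
abbrev toTensorInd (X : Bimodule k A) (V : Bimodule k B) :
    BTensor k ((res B).obj X) V →ₗ[k] BTensor k X ((ind B).obj V) :=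
  tensorRes B X (extendUnit (envIncl B) V)

/-- The map `X ⊗_{Aᵉ} (A ⊗_B V ⊗_B A) → X ⊗_{Bᵉ} V`. -/
def ofTensorInd (X : Bimodule k A) (V : Bimodule k B) :
    BTensor k X ((ind B).obj V) →ₗ[k] BTensor k ((res B).obj X) V :=
  BTensor.lift k (extendLiftLinear (envIncl B)
    (compBilin
      ((BTensor.mkBilin k ((res B).obj X) V) ∘ₗ restrictOfLinear (envIncl B) X).flip
      (smulLinear X ∘ₗ swapEnv k A)).flip (by
        intro r s v
        refine LinearMap.ext fun x => ?_
        change BTensor.mk k (X := (res B).obj X) (swapEnv k A (r * envIncl B s) • x) v =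
          BTensor.mk k (X := (res B).obj X) (swapEnv k A r • x) (s • v)
        refine Eq.trans ?_ (BTensor.mk_smul k (X := (res B).obj X) s (swapEnv k A r • x) v).symm
        rw [swapEnv_mul, mul_smul, swapEnv_envIncl]
        rfl)).flip <| by
    intro a b x z
    induction z using extend_induction (envIncl B) with
    | mk r v =>
      change BTensor.mk k (X := (res B).obj X) (swapEnv k A r • act k a b x) v =
        BTensor.mk k (X := (res B).obj X) (swapEnv k A ((b ⊗ₜ[k] op a) * r) • x) v
      rw [swapEnv_mul, mul_smul, swapEnv_tmul]
    | add y z hy hz =>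
      exact (map_add _ y z).trans
        ((congrArg₂ (· + ·) hy hz).trans
          ((map_add _ (act k b a y) (act k b a z)).symm.trans
            (congrArg _ (act_add k (M := (ind B).obj V) b a y z).symm)))

/-- Together with the next lemma this identifies `X ⊗_{Bᵉ} V` with `X ⊗_{Aᵉ} ind V`, which brings
Hochschild chains of `B` into the world of `A`-bimodules. -/
theorem ofTensorInd_toTensorInd (X : Bimodule k A) (V : Bimodule k B)
    (z : BTensor k ((res B).obj X) V) : ofTensorInd B X V (toTensorInd B X V z) = z := by
  refine LinearMap.congr_fun (f := ofTensorInd B X V ∘ₗ toTensorInd B X V) (g := LinearMap.id)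
    (BTensor.hom_ext k fun x v => ?_) z
  change BTensor.mk k (X := (res B).obj X) (swapEnv k A 1 • (show X from x)) v = _
  rw [swapEnv_one, one_smul]
  rfl

theorem toTensorInd_ofTensorInd (X : Bimodule k A) (V : Bimodule k B)
    (z : BTensor k X ((ind B).obj V)) : toTensorInd B X V (ofTensorInd B X V z) = z := by
  refine LinearMap.congr_fun (f := toTensorInd B X V ∘ₗ ofTensorInd B X V) (g := LinearMap.id)
    (BTensor.hom_ext k fun x z => ?_) z
  induction z using extend_induction (envIncl B) with
  | mk r v =>
    change BTensor.mk k (swapEnv k A r • x) (indMk B V 1 v) = BTensor.mk k x (indMk B V r v)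
    rw [← BTensor.mk_smul]
    exact congrArg (BTensor.mk k x) (smul_extendUnit (envIncl B) r v)
  | add y z hy hz =>
    rw [← BTensor.mkBilin_apply] at *
    rw [map_add, map_add, map_add, hy, hz]

theorem toTensorInd_injective (X : Bimodule k A) (V : Bimodule k B) :
    Function.Injective (toTensorInd B X V) :=
  Function.LeftInverse.injective (ofTensorInd_toTensorInd B X V)

theorem toTensorInd_surjective (X : Bimodule k A) (V : Bimodule k B) :
    Function.Surjective (toTensorInd B X V) :=
  Function.RightInverse.surjective (toTensorInd_ofTensorInd B X V)

theorem toTensorInd_map_left {X Y : Bimodule k A} (V : Bimodule k B) (f : X ⟶ Y)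
    (z : BTensor k ((res B).obj X) V) :
    toTensorInd B Y V (BTensor.map k ((res B).map f) (𝟙 V) z) =
      BTensor.map k f (𝟙 _) (toTensorInd B X V z) :=
  LinearMap.congr_fun (f := toTensorInd B Y V ∘ₗ BTensor.map k ((res B).map f) (𝟙 V))
    (g := BTensor.map k f (𝟙 _) ∘ₗ toTensorInd B X V) (BTensor.hom_ext k fun _ _ => rfl) z

theorem toTensorInd_map_right (X : Bimodule k A) {V W : Bimodule k B} (g : V ⟶ W)
    (z : BTensor k ((res B).obj X) V) :
    BTensor.map k (𝟙 X) ((ind B).map g) (toTensorInd B X V z) =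
      toTensorInd B X W (BTensor.map k (𝟙 _) g z) :=
  tensorRes_comp B X _ _ g _ (extendUnit_naturality (envIncl B) g) z

/-- Tensoring with `ind V` over `Aᵉ` is restricting to `B` and tensoring with `V`, and restriction
preserves injections. -/
theorem IsFlat.ind {V : Bimodule k B} (hV : IsFlat k V) : IsFlat k ((ind B).obj V) := by
  intro X Y f hf z w hzw
  obtain ⟨z, rfl⟩ := toTensorInd_surjective B X V z
  obtain ⟨w, rfl⟩ := toTensorInd_surjective B X V w
  rw [← toTensorInd_map_left, ← toTensorInd_map_left] at hzw
  exact congrArg _ (hV _ _ ((res B).map f) hf (toTensorInd_injective B Y V hzw))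

variable {B}

/-- By the adjunction in the other variable, tensoring `U` over `Bᵉ` with `ind V` is tensoring `ind
U` over `Aᵉ` with `ind V`. Here `ind V` is flat and `U ↦ ind U` preserves injections. -/
theorem IsFlat.res_ind (hflat : IsFlat k (quotBimod B)) {V : Bimodule k B} (hV : IsFlat k V) :
    IsFlat k ((res B).obj ((JZ.ind B).obj V)) := by
  intro U W f hf z w hzw
  apply BTensor.comm_injective k
  apply toTensorInd_injective B ((JZ.ind B).obj V) U
  apply (hV.ind B).map_injective_left _ (ind_map_injective hflat f hf)
  rw [toTensorInd_map_right, toTensorInd_map_right, ← BTensor.comm_map, ← BTensor.comm_map, hzw]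

/-- Induction is exact. -/
theorem ind_exact (hflat : IsFlat k (quotBimod B)) {U V W : Bimodule k B} (f : U ⟶ V) (g : V ⟶ W)
    (hfg : Function.Exact f.hom g.hom) :
    Function.Exact ((ind B).map f).hom ((ind B).map g).hom := by
  have h0 : f ≫ g = 0 := ModuleCat.hom_ext (LinearMap.ext hfg.apply_apply_eq_zero)
  intro z
  constructor
  swap
  · rintro ⟨z, rfl⟩
    change ((ind B).map f ≫ (ind B).map g).hom z = 0
    rw [← Functor.map_comp, h0, Functor.map_zero]
    rfl
  intro hz
  -- Factor `g` through its image: `ind j` is injective, so `z` already dies under `ind p`, and only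
  -- right exactness of induction remains.
  let N : Bimodule k B := ModuleCat.of (Env k B) (V ⧸ LinearMap.ker g.hom)
  let p : V ⟶ N := ModuleCat.ofHom (X := V) (Y := N) (LinearMap.ker g.hom).mkQ
  let j : N ⟶ W := ModuleCat.ofHom (X := N) (Y := W)
    ((LinearMap.ker g.hom).liftQ g.hom le_rfl)
  have hj : Function.Injective j.hom :=
    LinearMap.ker_eq_bot.1 (Submodule.ker_liftQ_eq_bot _ _ _ le_rfl)
  have hpj : p ≫ j = g := rfl
  have hpz : ((ind B).map p).hom z = 0 := by
    apply ind_map_injective hflat j hj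
    rw [← hpj, Functor.map_comp] at hz
    exact hz.trans (map_zero ((ind B).map j).hom).symm
  obtain ⟨M, q, hq, hq'⟩ : ∃ (M : Bimodule k A) (q : (ind B).obj V ⟶ M),
      (ind B).map f ≫ q = 0 ∧ ∀ z, q.hom z = 0 → z ∈ Set.range ((ind B).map f).hom :=
    ⟨ModuleCat.of (Env k A) ((ind B).obj V ⧸ LinearMap.range ((ind B).map f).hom),
      ModuleCat.ofHom (X := (ind B).obj V) (LinearMap.range ((ind B).map f).hom).mkQ,
      ModuleCat.hom_ext (LinearMap.range_mkQ_comp _),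
      fun z hz => (Submodule.Quotient.mk_eq_zero _).1 hz⟩
  apply hq'
  -- The adjoint `t` of the cokernel map `q` vanishes on `ker g`, the range of `f`. Hence `q`
  -- factors through `ind p`, which kills `z`.
  let t : V ⟶ (res B).obj M := extendUnit (envIncl B) V ≫ (res B).map q
  have ht : ∀ v ∈ LinearMap.ker g.hom, t.hom v = 0 := by
    intro v hv
    obtain ⟨u, rfl⟩ := (hfg v).1 hv
    have h1 : f ≫ t = 0 := by
      rw [← Category.assoc, ← extendUnit_naturality, Category.assoc, ← Functor.map_comp]
      erw [hq]
      rw [Functor.map_zero, Limits.comp_zero]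
    exact LinearMap.congr_fun (congrArg ModuleCat.Hom.hom h1) u
  let t' : N ⟶ (res B).obj M := ModuleCat.ofHom (X := N) (Y := (res B).obj M)
    ((LinearMap.ker g.hom).liftQ t.hom ht)
  have htt : (ind B).map p ≫ extendLift (envIncl B) t' = q := by
    refine extend_hom_ext (envIncl B) fun v => ?_
    have h1 := extendFunctor_map_mk (envIncl B) p 1 v
    refine (congrArg (extendLift (envIncl B) t').hom h1).trans ?_
    exact extendLift_one (envIncl B) t' (p.hom v)
  rw [← htt]
  exact (congrArg (extendLift (envIncl B) t').hom hpz).trans (map_zero _)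

end InductionFlat

/-! ### An explicit relative projective resolution of `A`, with flat terms in positive degrees. -/

section Resolution

variable {k : Type u} [Field k] {A : Type u} [Ring A] [Algebra k A] (B : Subalgebra k A)

/-- The bimodule map given by an additive map that respects the two-sided multiplications. -/
def homOfAct {C : Type u} [Ring C] [Algebra k C] {M N : Bimodule k C} (f : M →+ N)
    (h : ∀ (a b : C) (x : M), f (act k a b x) = act k a b (f x)) : M ⟶ N :=
  ModuleCat.ofHom (X := M) (Y := N) { f with map_smul' := map_smul_of_act k f h }

/-! ### The multiplication `A ⊗_B A → A` -/

/-- The multiplication map `A ⊗_B A → A`. -/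
def indAug : (ind B).obj (regular k B) ⟶ regular k A :=
  extendLift (envIncl B) (inclBimod B)

theorem indAug_mk (a a' : A) (b : B) :
    (indAug B).hom (indMk B (regular k B) (a ⊗ₜ[k] op a') (regularOf k B b)) =
      regularOf k A (a * b * a') := regular_act k a a' (b : A)

theorem act_sub {M : Bimodule k A} (a b : A) (m m' : M) :
    act k a b (m - m') = act k a b m - act k a b m' := smul_sub _ m m'

theorem quotProj_act (a b : B) (x : (res B).obj (regular k A)) :
    (quotProj B).hom (act k a b x) = act k a b ((quotProj B).hom x) := map_smul (quotProj B).hom _ x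

theorem indMk_act {U : Bimodule k B} (a a' : A) (b b' : B) (u : U) :
    indMk B U (a ⊗ₜ[k] op a') (act k b b' u) =
      indMk B U ((a * b) ⊗ₜ[k] op ((b' : A) * a')) u := by
  refine (extendMk_mul (envIncl B) _ _ u).symm.trans ?_
  rw [envIncl_tmul, Algebra.TensorProduct.tmul_mul_tmul]
  rfl

theorem indMk_regularOf (a a' : A) (b : B) :
    indMk B (regular k B) (a ⊗ₜ[k] op a') (regularOf k B b) =
      indMk B (regular k B) ((a * b) ⊗ₜ[k] op a') (regularOf k B 1) := by
  have h : regularOf k B b = act k b 1 (regularOf k B 1) := by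
    rw [act_regularOf, mul_one, mul_one]
  rw [h, indMk_act]
  simp

theorem indMk_regularOf_right (a a' : A) (b : B) :
    indMk B (regular k B) (a ⊗ₜ[k] op a') (regularOf k B b) =
      indMk B (regular k B) (a ⊗ₜ[k] op (b * a')) (regularOf k B 1) := by
  have h : regularOf k B b = act k 1 b (regularOf k B 1) := by
    rw [act_regularOf, mul_one, one_mul]
  rw [h, indMk_act]
  simp

theorem ind_regular_induction {motive : (ind B).obj (regular k B) → Prop}
    (mk : ∀ a a', motive (indMk B _ (a ⊗ₜ[k] op a') (regularOf k B 1)))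
    (add : ∀ y z, motive y → motive z → motive (y + z))
    (z : (ind B).obj (regular k B)) : motive z := by
  refine ind_induction B (fun a a' b => ?_) add z
  obtain ⟨b, rfl⟩ := regularOf_surjective k b
  rw [indMk_regularOf]
  exact mk _ _

/-- The section `a ↦ a ⊗ 1` of the multiplication `A ⊗_B A → A`. -/
def indAugSection : (res B).obj (regular k A) ⟶ (res B).obj ((ind B).obj (regular k B)) :=
  let f : A →ₗ[k] (ind B).obj (regular k B) :=
    (indMk B (regular k B)).flip (regularOf k B 1) ∘ₗ
      (Algebra.TensorProduct.includeLeft : A →ₐ[k] Env k A).toLinearMap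
  homOfAct (f ∘ₗ resRegularTo B).toAddMonoidHom fun a b x => by
    change indMk B _ (resRegularTo B (act k a b x) ⊗ₜ[k] op 1) (regularOf k B 1) =
      act k (a : A) (b : A) (indMk B _ (resRegularTo B x ⊗ₜ[k] op 1) (regularOf k B 1))
    rw [resRegularTo_act, act_indMk, ← indMk_regularOf, indMk_regularOf_right]
    simp

theorem indAugSection_comp : indAugSection B ≫ (res B).map (indAug B) = 𝟙 _ := by
  refine ModuleCat.hom_ext (LinearMap.ext fun x => ?_)
  obtain ⟨x, rfl⟩ := resRegularOf_surjective B x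
  refine (indAug_mk B x 1 1).trans ?_
  simp
  rfl

/-- The map `a ↦ a ⊗ 1 - 1 ⊗ a` from `A` to `A ⊗_B A`. -/
def commutator : (res B).obj (regular k A) ⟶ (res B).obj ((ind B).obj (regular k B)) :=
  let f : A →ₗ[k] (ind B).obj (regular k B) :=
    (indMk B (regular k B)).flip (regularOf k B 1) ∘ₗ
      ((Algebra.TensorProduct.includeLeft : A →ₐ[k] Env k A).toLinearMap -
        (Algebra.TensorProduct.includeRight : Aᵐᵒᵖ →ₐ[k] Env k A).toLinearMap ∘ₗ
          (opLinearEquiv k).toLinearMap)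
  homOfAct (f ∘ₗ resRegularTo B).toAddMonoidHom fun a b x => by
    have hf : ∀ x, f x = indMk B _ (x ⊗ₜ[k] op 1) (regularOf k B 1) -
        indMk B _ (1 ⊗ₜ[k] op x) (regularOf k B 1) := fun x =>
      map_sub ((indMk B (regular k B)).flip (regularOf k B 1)) _ _
    change f (resRegularTo B (act k a b x)) = act k (a : A) (b : A) (f (resRegularTo B x))
    rw [hf, hf, act_sub, resRegularTo_act, act_indMk, act_indMk, ← indMk_regularOf,
      indMk_regularOf_right, mul_one, one_mul, mul_one]
    congr 1
    have h := indMk_regularOf_right B 1 (resRegularTo B x * b) a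
    rw [indMk_regularOf, one_mul] at h
    rw [h, mul_assoc]

theorem commutator_apply (a : A) : (commutator B).hom (resRegularOf B a) =
    (show (ind B).obj (regular k B) from
      indMk B (regular k B) (a ⊗ₜ[k] op 1) (regularOf k B 1) -
        indMk B (regular k B) (1 ⊗ₜ[k] op a) (regularOf k B 1)) :=
  map_sub ((indMk B (regular k B)).flip (regularOf k B 1)) _ _

theorem inclBimod_commutator (b : regular k B) : (commutator B).hom ((inclBimod B).hom b) = 0 := by
  obtain ⟨b, rfl⟩ := regularOf_surjective k b
  refine (commutator_apply B (b : A)).trans (sub_eq_zero.2 ?_)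
  have h := indMk_regularOf_right B 1 1 b
  rw [indMk_regularOf, one_mul, mul_one] at h
  exact h

/-- The map `A ⊗_B (A / B) ⊗_B A → A ⊗_B A`, `a ⊗ x ⊗ b ↦ a x ⊗ b - a ⊗ x b`. -/
def indCommutator : (ind B).obj (quotBimod B) ⟶ (ind B).obj (regular k B) :=
  extendLift (envIncl B) <|
    ModuleCat.ofHom (X := quotBimod B) (Y := (res B).obj ((ind B).obj (regular k B)))
      ((LinearMap.range (inclBimod B).hom).liftQ (commutator B).hom (by
        rintro _ ⟨b, rfl⟩
        exact inclBimod_commutator B b))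

theorem indCommutator_mk (a a' x : A) :
    (indCommutator B).hom
      (indMk B (quotBimod B) (a ⊗ₜ[k] op a') ((quotProj B).hom (resRegularOf B x))) =
      indMk B (regular k B) ((a * x) ⊗ₜ[k] op a') (regularOf k B 1) -
        indMk B (regular k B) (a ⊗ₜ[k] op (x * a')) (regularOf k B 1) := by
  refine (extendLift_mk (envIncl B) _ (a ⊗ₜ[k] op a') _).trans ?_
  refine (congrArg (act k (X := (ind B).obj (regular k B)) a a') (commutator_apply B x)).trans ?_
  refine (smul_sub _ _ _).trans ?_
  refine congrArg₂ (· - ·) ((act_indMk B _ _ _ _ _).trans ?_) ((act_indMk B _ _ _ _ _).trans ?_)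
  · rw [one_mul]
  · rw [mul_one]

theorem indCommutator_indAug : indCommutator B ≫ indAug B = 0 := by
  refine extend_hom_ext (envIncl B) fun u => ?_
  obtain ⟨x, rfl⟩ := quotProj_surjective B u
  obtain ⟨x, rfl⟩ := resRegularOf_surjective B x
  refine (congrArg (indAug B).hom (indCommutator_mk B 1 1 x)).trans ?_
  refine (map_sub (indAug B).hom _ _).trans ?_
  rw [indAug_mk, indAug_mk]
  simp

/-- The map `A ⊗_B A → A ⊗_B (A / B) ⊗_B A`, `a ⊗ a' ↦ 1 ⊗ a ⊗ a'`. -/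
def indQuot : (ind B).obj (regular k B) →ₗ[k] (ind B).obj (quotBimod B) :=
  extendLiftLinear (envIncl B) (TensorProduct.lift (compBilin
    (indMk B (quotBimod B) ∘ₗ
      (Algebra.TensorProduct.includeRight : Aᵐᵒᵖ →ₐ[k] Env k A).toLinearMap)
    (((LinearMap.mul k A).compl₂ (B.val.toLinearMap ∘ₗ regularTo k B)).compr₂
      ((quotProj B).hom.restrictScalars k ∘ₗ resRegularOf B))).flip) <|
    balanced_of_tmul _ _ fun c d a b u => by
      rw [envIncl_tmul, Algebra.TensorProduct.tmul_mul_tmul]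
      change indMk B (quotBimod B) (1 ⊗ₜ[k] op ((b : A) * d))
          ((quotProj B).hom (resRegularOf B (c * a * (regularTo k B u : B)))) =
        indMk B (quotBimod B) (1 ⊗ₜ[k] op d)
          ((quotProj B).hom (resRegularOf B (c * (regularTo k B (act k a b u) : B))))
      have h : (quotProj B).hom (resRegularOf B (c * (regularTo k B (act k a b u) : B))) =
          act k 1 b ((quotProj B).hom (resRegularOf B (c * a * (regularTo k B u : B)))) := by
        rw [← quotProj_act, act_resRegularOf, regularTo_act]
        simp [mul_assoc]
      rw [h, indMk_act]
      simp

theorem indQuot_mk (a a' : A) :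
    indQuot B (indMk B (regular k B) (a ⊗ₜ[k] op a') (regularOf k B 1)) =
      indMk B (quotBimod B) (1 ⊗ₜ[k] op a') ((quotProj B).hom (resRegularOf B a)) := by
  change indMk B (quotBimod B) (1 ⊗ₜ[k] op a')
    ((quotProj B).hom (resRegularOf B (a * ((1 : B) : A)))) = _
  rw [OneMemClass.coe_one, mul_one]

theorem indQuot_act (a b : B) (z : (ind B).obj (regular k B)) :
    indQuot B (act k (a : A) (b : A) z) = act k (a : A) (b : A) (indQuot B z) := by
  induction z using ind_regular_induction B with
  | mk c d =>
    rw [act_indMk, indQuot_mk, indQuot_mk, act_indMk]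
    have h : (quotProj B).hom (resRegularOf B ((a : A) * c)) =
        act k a 1 ((quotProj B).hom (resRegularOf B c)) := by
      rw [← quotProj_act, act_resRegularOf, OneMemClass.coe_one, mul_one]
    rw [h, indMk_act]
    simp
  | add y z hy hz => rw [act_add, map_add, map_add, hy, hz, act_add]

/-- On generators, `a ⊗ a' ↦ 1 ⊗ a ⊗ a' ↦ a ⊗ a' - 1 ⊗ a a'`. So on the kernel of the multiplication
the composite is the identity. -/
theorem indCommutator_indQuot (z : (ind B).obj (regular k B)) :
    (indCommutator B).hom (indQuot B z) =
      z - indMk B (regular k B) (1 ⊗ₜ[k] op (regularTo k A ((indAug B).hom z)))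
        (regularOf k B 1) := by
  induction z using ind_regular_induction B with
  | mk a a' =>
    rw [indQuot_mk, indCommutator_mk, indAug_mk, one_mul, OneMemClass.coe_one, mul_one]
    rfl
  | add y z hy hz =>
    rw [map_add, map_add, map_add, map_add, hy, hz, MulOpposite.op_add, tmul_add, map_add,
      LinearMap.add_apply, add_sub_add_comm]

variable {B}

/-- By `indCommutator_indQuot` the kernel of `A ⊗_B A → A` is, over `B`, a retract of `A ⊗_B (A / B)
⊗_B A`. Flatness of `A / B` thus enters twice through `IsFlat.res_ind`: as the coefficient bimodule
and as the hypothesis on induction. -/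
theorem isFlat_res_ker_indAug (hflat : IsFlat k (quotBimod B)) :
    IsFlat k ((res B).obj (kerObj (indAug B))) := by
  let i₀ : kerObj (indAug B) →ₗ[k] (ind B).obj (quotBimod B) :=
    indQuot B ∘ₗ (kerIncl (indAug B)).hom.restrictScalars k
  let i : (res B).obj (kerObj (indAug B)) ⟶ (res B).obj ((ind B).obj (quotBimod B)) :=
    homOfAct i₀.toAddMonoidHom fun a b x =>
      (congrArg (indQuot B) (map_smul (kerIncl (indAug B)).hom _ (show kerObj (indAug B) from x))).trans
        (indQuot_act B a b _)
  refine (IsFlat.res_ind hflat hflat).of_retract i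
    ((res B).map (kerLift _ (indCommutator B) (indCommutator_indAug B))) ?_
  refine ModuleCat.hom_ext (LinearMap.ext fun x => ?_)
  apply kerIncl_injective (indAug B)
  change (indCommutator B).hom (indQuot B ((kerIncl (indAug B)).hom x)) =
    (kerIncl (indAug B)).hom x
  rw [indCommutator_indQuot, (kerIncl_exact (indAug B)).apply_apply_eq_zero x, map_zero, MulOpposite.op_zero,
    tmul_zero, map_zero]
  exact sub_zero _

/-! ### Relative syzygies -/

/-- A map out of `ind V` is a `B`-map out of `V`, and that one lifts by composing with the section
over `B`. -/
theorem isRelProjective_ind (V : Bimodule k B) : IsRelProjective B ((ind B).obj V) := by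
  intro M N g s hs f
  refine ⟨extendLift (envIncl B) (extendUnit (envIncl B) V ≫ (res B).map f ≫ s), ?_⟩
  refine extend_hom_ext (envIncl B) fun v => ?_
  rw [ModuleCat.hom_comp, LinearMap.comp_apply, extendLift_one]
  exact LinearMap.congr_fun (congrArg ModuleCat.Hom.hom hs) (f.hom (indMk B V 1 v))

/-- The projection to the kernel of a map of `A`-bimodules with a section of `B`-bimodules. -/
def kerProj {M N : Bimodule k A} (p : M ⟶ N) (t : (res B).obj N ⟶ (res B).obj M)
    (h : t ≫ (res B).map p = 𝟙 _) : (res B).obj M ⟶ (res B).obj (kerObj p) :=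
  let g : (res B).obj M ⟶ (res B).obj M := 𝟙 _ - (res B).map p ≫ t
  have h' : g ≫ (res B).map p = 0 := by
    rw [Preadditive.sub_comp, Category.assoc, h, Category.comp_id, Category.id_comp, sub_self]
  ModuleCat.ofHom (X := (res B).obj M) (Y := (res B).obj (kerObj p))
    { toFun := fun x =>
        ⟨g.hom x, LinearMap.congr_fun (congrArg ModuleCat.Hom.hom h') x⟩
      map_add' := fun x y => Subtype.ext (map_add g.hom x y)
      map_smul' := fun r x => Subtype.ext (map_smul g.hom r x) }

theorem kerProj_comp {M N : Bimodule k A} (p : M ⟶ N) (t : (res B).obj N ⟶ (res B).obj M)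
    (h : t ≫ (res B).map p = 𝟙 _) :
    kerProj p t h ≫ (res B).map (kerIncl p) = 𝟙 _ - (res B).map p ≫ t :=
  ModuleCat.hom_ext (LinearMap.ext fun _ => rfl)

theorem kerIncl_kerProj {M N : Bimodule k A} (p : M ⟶ N) (t : (res B).obj N ⟶ (res B).obj M)
    (h : t ≫ (res B).map p = 𝟙 _) : (res B).map (kerIncl p) ≫ kerProj p t h = 𝟙 _ := by
  have h1 : ((res B).map (kerIncl p) ≫ kerProj p t h) ≫ (res B).map (kerIncl p) =
      (res B).map (kerIncl p) := by
    rw [Category.assoc, kerProj_comp, Preadditive.comp_sub, Category.comp_id, ← Category.assoc,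
      ← Functor.map_comp, kerIncl_comp, Functor.map_zero, Limits.zero_comp, sub_zero]
  refine ModuleCat.hom_ext (LinearMap.ext fun x => kerIncl_injective p ?_)
  exact LinearMap.congr_fun (congrArg ModuleCat.Hom.hom h1) x

variable (B)

/-- A relatively projective `A`-bimodule `M` with a map `M → N` that splits over `B`. -/
structure RelCover where
  /-- The covering bimodule. -/
  M : Bimodule k A
  /-- The covered bimodule. -/
  N : Bimodule k A
  /-- The covering map. -/
  p : M ⟶ N
  /-- The section over `B`. -/
  t : (res B).obj N ⟶ (res B).obj M
  comp_eq : t ≫ (res B).map p = 𝟙 _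
  relProjective : IsRelProjective B M

/-- The cover `A ⊗_B N ⊗_B A → N`. -/
def indCover (N : Bimodule k A) : RelCover B where
  M := (ind B).obj ((res B).obj N)
  N := N
  p := extendLift (envIncl B) (𝟙 _)
  t := extendUnit (envIncl B) _
  comp_eq := ModuleCat.hom_ext (LinearMap.ext fun x => extendLift_one (envIncl B) (𝟙 _) x)
  relProjective := isRelProjective_ind _

/-- The covers `A ⊗_B A → A` and, iteratively, `A ⊗_B Ω ⊗_B A → Ω` where `Ω` is the kernel of the
preceding cover. -/
def relCover : ℕ → RelCover B
  | 0 =>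
    { M := (ind B).obj (regular k B)
      N := regular k A
      p := indAug B
      t := indAugSection B
      comp_eq := indAugSection_comp B
      relProjective := isRelProjective_ind _ }
  | n + 1 => indCover B (kerObj (relCover n).p)

/-- The inclusion of the kernel of a cover. -/
def relIncl (n : ℕ) : (relCover B (n + 1)).N ⟶ (relCover B n).M := kerIncl (relCover B n).p

theorem relIncl_comp (n : ℕ) : relIncl B n ≫ (relCover B n).p = 0 := kerIncl_comp _

/-- The projection to the kernel of a cover. -/
def relProj (n : ℕ) : (res B).obj (relCover B n).M ⟶ (res B).obj (relCover B (n + 1)).N :=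
  kerProj (relCover B n).p (relCover B n).t (relCover B n).comp_eq

theorem relProj_relIncl (n : ℕ) : relProj B n ≫ (res B).map (relIncl B n) =
    𝟙 _ - (res B).map (relCover B n).p ≫ (relCover B n).t := kerProj_comp _ _ _

theorem relIncl_relProj (n : ℕ) : (res B).map (relIncl B n) ≫ relProj B n = 𝟙 _ :=
  kerIncl_kerProj _ _ _

/-- The differential of the resolution by relative covers. -/
def relD (n : ℕ) : (relCover B (n + 1)).M ⟶ (relCover B n).M :=
  (relCover B (n + 1)).p ≫ relIncl B n

theorem relD_p (n : ℕ) : relD B n ≫ (relCover B n).p = 0 := by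
  rw [relD, Category.assoc, relIncl_comp, Limits.comp_zero]

theorem relD_comp (n : ℕ) : relD B (n + 1) ≫ relD B n = 0 := by
  rw [relD.eq_1 B n, ← Category.assoc, relD_p, Limits.zero_comp]

/-- The contracting homotopy of the resolution by relative covers. -/
def relS (n : ℕ) : (res B).obj (relCover B n).M ⟶ (res B).obj (relCover B (n + 1)).M :=
  relProj B n ≫ (relCover B (n + 1)).t

theorem relS_relD (n : ℕ) : relS B n ≫ (res B).map (relD B n) =
    𝟙 _ - (res B).map (relCover B n).p ≫ (relCover B n).t := by
  rw [relS, relD, Functor.map_comp, Category.assoc, ← Category.assoc (relCover B (n + 1)).t,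
    (relCover B (n + 1)).comp_eq, Category.id_comp, relProj_relIncl]

theorem relD_relS (n : ℕ) : (res B).map (relD B n) ≫ relS B n =
    (res B).map (relCover B (n + 1)).p ≫ (relCover B (n + 1)).t := by
  rw [relD, relS, Functor.map_comp, Category.assoc, ← Category.assoc ((res B).map (relIncl B n)),
    relIncl_relProj, Category.id_comp]

/-- The complex of iterated relative covers. -/
def relComplex : ChainComplex (Bimodule k A) ℕ :=
  ChainComplex.of (fun n => (relCover B n).M) (relD B) (relD_comp B)

theorem relComplex_d (n : ℕ) : (relComplex B).d (n + 1) n = relD B n :=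
  ChainComplex.of_d (fun n => (relCover B n).M) (relD B) n

/-- The relative projective resolution of `A` by iterated relative covers. -/
def relResolution : RelResolution B (regular k A) where
  complex := relComplex B
  aug := (relCover B 0).p
  relProjective n := (relCover B n).relProjective
  d_comp_aug := (congrArg (fun f : (relCover B 1).M ⟶ (relCover B 0).M => f ≫ (relCover B 0).p)
    (relComplex_d B 0)).trans (relD_p B 0)
  contractible := by
    refine ⟨(relCover B 0).t, relS B, (relCover B 0).comp_eq, ?_, fun n => ?_⟩
    · refine (congrArg (fun f : (relCover B 1).M ⟶ (relCover B 0).M =>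
        (res B).map (relCover B 0).p ≫ (relCover B 0).t + relS B 0 ≫ (res B).map f)
        (relComplex_d B 0)).trans ?_
      rw [relS_relD, add_sub_cancel]
      rfl
    · refine (congrArg₂ (fun (f : (relCover B (n + 1)).M ⟶ (relCover B n).M)
        (g : (relCover B (n + 2)).M ⟶ (relCover B (n + 1)).M) =>
        (res B).map f ≫ relS B n + relS B (n + 1) ≫ (res B).map g)
        (relComplex_d B n) (relComplex_d B (n + 1))).trans ?_
      rw [relD_relS, relS_relD, add_sub_cancel]
      rfl

variable {B}

/-- Each cover splits over `B`, so its kernel is a retract of the cover, which is induced from the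
preceding kernel. -/
theorem isFlat_res_ker_relCover (hflat : IsFlat k (quotBimod B)) (n : ℕ) :
    IsFlat k ((res B).obj (kerObj (relCover B n).p)) := by
  induction n with
  | zero => exact isFlat_res_ker_indAug hflat
  | succ n ih =>
    exact (IsFlat.res_ind hflat ih).of_retract ((res B).map (kerIncl (relCover B (n + 1)).p))
      (kerProj (relCover B (n + 1)).p (relCover B (n + 1)).t (relCover B (n + 1)).comp_eq)
      (kerIncl_kerProj _ _ _)

/-- Only positive degrees are induced from a kernel. The degree zero term `A ⊗_B A` is left out
here, and also from the total complex below. -/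
theorem isFlat_relResolution (hflat : IsFlat k (quotBimod B)) (n : ℕ) :
    IsFlat k ((relResolution B).complex.X (n + 1)) :=
  (isFlat_res_ker_relCover hflat n).ind B

end Resolution

/-! ### The bar resolution is exact and consists of projective bimodules. -/

section Bar

variable (k : Type u) [Field k] {A : Type u} [Ring A] [Algebra k A]

theorem hom_act {M N : Bimodule k A} (f : M ⟶ N) (a b : A) (x : M) :
    f.hom (act k a b x) = act k a b (f.hom x) := map_smul f.hom _ x

/-- The bimodule `P` is projective. -/
def IsProj (P : Bimodule k A) : Prop :=
  ∀ (M N : Bimodule k A) (g : M ⟶ N), Function.Surjective g.hom →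
    ∀ f : P ⟶ N, ∃ h : P ⟶ M, h ≫ g = f

variable {k} in
theorem IsProj.isFlat {P : Bimodule k A} (hP : IsProj k P) : IsFlat k P := by
  obtain ⟨s, hs⟩ := hP _ _ (freeCover k P) (freeCover_surjective k P) (𝟙 P)
  exact (isFlat_free k A P).of_retract s _ hs

variable {k} in
theorem IsProj.isRelProjective {P : Bimodule k A} (hP : IsProj k P) (B : Subalgebra k A) :
    IsRelProjective B P := fun M N g s hs f =>
  hP M N g (Function.RightInverse.surjective (g := s.hom)
    (LinearMap.congr_fun (congrArg ModuleCat.Hom.hom hs))) f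

/-- The space of maps of right modules. -/
def RightHom (M N : Bimodule k A) : Submodule k (M →ₗ[k] N) where
  carrier := {f | ∀ b m, f (act k 1 b m) = act k 1 b (f m)}
  add_mem' {f g} hf hg b m := by
    rw [LinearMap.add_apply, LinearMap.add_apply, hf, hg, act_add]
  zero_mem' b m := (smul_zero _).symm
  smul_mem' c f hf b m := by
    rw [LinearMap.smul_apply, LinearMap.smul_apply, hf]
    exact (smul_comm _ _ _)

/-- Composition with a bimodule map on the space of maps of right modules. -/
def RightHom.post (M : Bimodule k A) {N N' : Bimodule k A} (g : N ⟶ N') :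
    RightHom k M N →ₗ[k] RightHom k M N' :=
  ((LinearMap.compRight k (g.hom.restrictScalars k)).comp (RightHom k M N).subtype).codRestrict _
    fun f b m => (congrArg g.hom (f.2 b m)).trans (map_smul g.hom _ _)

theorem RightHom.post_apply (M : Bimodule k A) {N N' : Bimodule k A} (g : N ⟶ N')
    (f : RightHom k M N) (m : M) : (RightHom.post k M g f).1 m = g.hom (f.1 m) := rfl

/-- The bimodule `M` is projective as a right module. -/
def IsRightProj (M : Bimodule k A) : Prop :=
  ∀ (N N' : Bimodule k A) (g : N ⟶ N'), Function.Surjective g.hom →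
    Function.Surjective (RightHom.post k M g)

variable (A) in
theorem isRightProj_regular : IsRightProj k (regular k A) := by
  intro N N' g hg f
  obtain ⟨n, hn⟩ := hg (f.1 (regularOf k A 1))
  refine ⟨⟨(smulLinear N).flip n ∘ₗ
    (Algebra.TensorProduct.includeRight : Aᵐᵒᵖ →ₐ[k] Env k A).toLinearMap ∘ₗ
      (opLinearEquiv k).toLinearMap ∘ₗ regularTo k A, fun b m => ?_⟩, Subtype.ext ?_⟩
  · change act k 1 (regularTo k A (act k 1 b m)) n = act k 1 b (act k 1 (regularTo k A m) n)
    rw [act_act, regularTo_act, one_mul, one_mul]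
  · refine LinearMap.ext fun m => ?_
    obtain ⟨m, rfl⟩ := regularOf_surjective k m
    change g.hom (act k 1 m n) = f.1 (regularOf k A m)
    rw [map_smul, hn]
    have h := f.2 m (regularOf k A 1)
    rw [act_regularOf, one_mul, one_mul] at h
    exact h.symm

variable {k}

/-- Currying turns right module maps `A ⊗ M → N` into linear maps from the vector space `A` to the
right module maps `M → N`; these lift by a `k`-linear section. -/
theorem IsRightProj.step {M : Bimodule k A} (hM : IsRightProj k M) :
    IsRightProj k (step k M) := by
  intro N N' g hg f
  obtain ⟨s, hs⟩ := LinearMap.exists_rightInverse_of_surjective _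
    (LinearMap.range_eq_top.2 (hM N N' g hg))
  let φ : A →ₗ[k] RightHom k M N' := LinearMap.codRestrict _ ((stepMk k M).compr₂ f.1)
    fun c b m => by
      have h := f.2 b (stepMk k M c m)
      rw [act_stepMk, one_mul] at h
      exact h
  refine ⟨⟨stepLiftLinear k ((RightHom k M N).subtype ∘ₗ s ∘ₗ φ), fun b z => ?_⟩,
    Subtype.ext (LinearMap.ext fun z => ?_)⟩
  · induction z using step_induction k with
    | mk c m =>
      rw [act_stepMk, one_mul]
      exact (s (φ c)).2 b m
    | add y z hy hz => rw [act_add, map_add, map_add, hy, hz, act_add]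
  · rw [RightHom.post_apply]
    change g.hom (stepLiftLinear k ((RightHom k M N).subtype ∘ₗ s ∘ₗ φ) z) = f.1 z
    induction z using step_induction k with
    | mk c m =>
      have h := congrArg (fun f => f.1 m) (LinearMap.congr_fun hs (φ c))
      exact h
    | add y z hy hz => rw [map_add, map_add, map_add, hy, hz]

/-- A bimodule map out of `A ⊗ M` is determined by its restriction to `1 ⊗ M`, an arbitrary map of
right modules. -/
theorem IsRightProj.isProj_step {M : Bimodule k A} (hM : IsRightProj k M) :
    IsProj k (JZ.step k M) := by
  intro N N' g hg f
  obtain ⟨h, hh⟩ := hM N N' g hg ⟨(f.hom.restrictScalars k) ∘ₗ stepMk k M 1, fun b m => by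
    change f.hom (stepMk k M 1 (act k 1 b m)) = act k 1 b (f.hom (stepMk k M 1 m))
    rw [← hom_act, act_stepMk, one_mul]⟩
  refine ⟨stepLift k (((smulLinear N).comp
    (Algebra.TensorProduct.includeLeft : A →ₐ[k] Env k A).toLinearMap).compl₂ h.1)
    fun a b c m => ?_, step_hom_ext k fun c m => ?_⟩
  · change act k (a * c) 1 (h.1 (act k 1 b m)) = act k a b (act k c 1 (h.1 m))
    rw [h.2, act_act, act_act, mul_one, one_mul, mul_one]
  · change g.hom (act k c 1 (h.1 m)) = f.hom (stepMk k M c m)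
    have h1 : g.hom (h.1 m) = f.hom (stepMk k M 1 m) := congrArg (fun f => f.1 m) hh
    rw [hom_act, h1, ← hom_act, act_stepMk, mul_one, act_one]

variable (k A)

theorem isRightProj_barTerm (n : ℕ) : IsRightProj k (barTerm k A n) := by
  induction n with
  | zero => exact isRightProj_regular k A
  | succ n ih => exact ih.step

theorem isProj_barComplex (n : ℕ) : IsProj k ((barComplex k A).X n) :=
  (isRightProj_barTerm k A n).isProj_step

theorem barD_zero_surjective : Function.Surjective (barD k A 0).hom := fun x =>
  ⟨stepMk k (regular k A) 1 x, act_one k (M := regular k A) x⟩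

theorem nextD_mk_one (n : ℕ) (y : step k (barTerm k A n)) :
    (nextD k (barD k A n)).hom (stepMk k (step k (barTerm k A n)) 1 y) =
      y - stepMk k (barTerm k A n) 1 ((barD k A n).hom y) := by
  change (actMap k _).hom (stepMk k (step k (barTerm k A n)) 1 y) -
    (stepMap k (barD k A n)).hom (stepMk k (step k (barTerm k A n)) 1 y) = _
  rw [stepMap_mk, actMap_mk, act_one]

/-- The recursion for the differential makes `y ↦ 1 ⊗ y` a contracting homotopy. -/
theorem barD_exact (n : ℕ) :
    Function.Exact (nextD k (barD k A n)).hom (barD k A n).hom := by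
  intro y
  constructor
  · intro hy
    refine ⟨stepMk k (step k (barTerm k A n)) 1 y, ?_⟩
    rw [nextD_mk_one, hy, map_zero, sub_zero]
  · rintro ⟨x, rfl⟩
    exact LinearMap.congr_fun (congrArg ModuleCat.Hom.hom (barD_comp k A n)) x

theorem barComplex_exact (n : ℕ) : Function.Exact ((barComplex k A).d (n + 2) (n + 1)).hom
    ((barComplex k A).d (n + 1) n).hom := by
  rw [barComplex_d, barComplex_d]
  exact barD_exact k A (n + 1)

theorem barComplex_exact_zero : Function.Exact ((barComplex k A).d 1 0).hom (barAug k A).hom := by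
  rw [barComplex_d]
  exact barD_exact k A 0

theorem barAug_surjective : Function.Surjective (barAug k A).hom := barD_zero_surjective k A

theorem barComplex_d_barAug : (barComplex k A).d 1 0 ≫ barAug k A = 0 :=
  ModuleCat.hom_ext (LinearMap.ext (barComplex_exact_zero k A).apply_apply_eq_zero)

end Bar

/-! ### Exactness and lifting properties of relative resolutions. -/

section RelResolutionExact

variable {k : Type u} [Field k] {A : Type u} [Ring A] [Algebra k A] {B : Subalgebra k A}
  {Y : Bimodule k A} (P : RelResolution B Y)

theorem RelResolution.exact_zero : Function.Exact (P.complex.d 1 0).hom P.aug.hom := by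
  obtain ⟨s', s, -, h, -⟩ := P.contractible
  intro y
  constructor
  · intro hy
    refine ⟨(s 0).hom y, ?_⟩
    have h1 := LinearMap.congr_fun (congrArg ModuleCat.Hom.hom h) y
    have h2 : (show P.complex.X 0 from s'.hom (P.aug.hom y)) +
      (P.complex.d 1 0).hom ((s 0).hom y) = y := h1
    have h3 : (show P.complex.X 0 from s'.hom (P.aug.hom y)) = 0 :=
      (congrArg s'.hom hy).trans (map_zero s'.hom)
    rwa [h3, zero_add] at h2
  · rintro ⟨x, rfl⟩
    exact LinearMap.congr_fun (congrArg ModuleCat.Hom.hom P.d_comp_aug) x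

theorem RelResolution.exact_succ (n : ℕ) : Function.Exact (P.complex.d (n + 2) (n + 1)).hom
    (P.complex.d (n + 1) n).hom := by
  obtain ⟨s', s, -, -, h⟩ := P.contractible
  intro y
  constructor
  · intro hy
    refine ⟨(s (n + 1)).hom y, ?_⟩
    have h1 := LinearMap.congr_fun (congrArg ModuleCat.Hom.hom (h n)) y
    have h2 : (show P.complex.X (n + 1) from (s n).hom ((P.complex.d (n + 1) n).hom y)) +
      (P.complex.d (n + 2) (n + 1)).hom ((s (n + 1)).hom y) = y := h1
    have h3 : (show P.complex.X (n + 1) from (s n).hom ((P.complex.d (n + 1) n).hom y)) = 0 :=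
      (congrArg (s n).hom hy).trans (map_zero (s n).hom)
    rwa [h3, zero_add] at h2
  · rintro ⟨x, rfl⟩
    exact LinearMap.congr_fun (congrArg ModuleCat.Hom.hom
      (P.complex.d_comp_d (n + 2) (n + 1) n)) x

/-- Relatively projective bimodules have the lifting property at the augmentation. -/
theorem RelResolution.lift_zero {C : Bimodule k A} (hC : IsRelProjective B C) (f : C ⟶ Y) :
    ∃ h : C ⟶ P.complex.X 0, h ≫ P.aug = f := by
  obtain ⟨s', -, h, -⟩ := P.contractible
  exact hC _ _ P.aug s' h f

/-- Relatively projective bimodules have the lifting property at a map `M → N → L` which is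
exact by means of a contraction over `B`. -/
theorem IsRelProjective.exists_lift {C M N L : Bimodule k A} (hC : IsRelProjective B C)
    (d : M ⟶ N) (e : N ⟶ L) (hde : d ≫ e = 0) (s : (res B).obj N ⟶ (res B).obj M)
    (t : (res B).obj L ⟶ (res B).obj N)
    (hst : (res B).map e ≫ t + s ≫ (res B).map d = 𝟙 _) (f : C ⟶ N) (hf : f ≫ e = 0) :
    ∃ h : C ⟶ M, h ≫ d = f := by
  -- On `ker e` the contraction identity loses its first term, so `s` restricts there to a
  -- `B`-section of `M → ker e`, and relative projectivity applies.
  obtain ⟨h, hh⟩ := hC M (kerObj e) (kerLift e d hde) ((res B).map (kerIncl e) ≫ s) (by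
    refine ModuleCat.hom_ext (LinearMap.ext fun x => kerIncl_injective e ?_)
    have h1 := congrArg ((res B).map (kerIncl e) ≫ ·) hst
    simp only [Preadditive.comp_add, Category.comp_id] at h1
    rw [← Category.assoc, ← Functor.map_comp, kerIncl_comp, Functor.map_zero, Limits.zero_comp,
      zero_add] at h1
    exact LinearMap.congr_fun (congrArg ModuleCat.Hom.hom h1) x) (kerLift e f hf)
  refine ⟨h, ?_⟩
  rw [← kerLift_comp e f hf, ← hh, Category.assoc, kerLift_comp]

theorem RelResolution.lift_one {C : Bimodule k A} (hC : IsRelProjective B C)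
    (f : C ⟶ P.complex.X 0) (hf : f ≫ P.aug = 0) :
    ∃ h : C ⟶ P.complex.X 1, h ≫ P.complex.d 1 0 = f := by
  obtain ⟨s', s, -, h, -⟩ := P.contractible
  exact hC.exists_lift _ _ P.d_comp_aug (s 0) s' h f hf

theorem RelResolution.lift_succ {C : Bimodule k A} (hC : IsRelProjective B C) (n : ℕ)
    (f : C ⟶ P.complex.X (n + 1)) (hf : f ≫ P.complex.d (n + 1) n = 0) :
    ∃ h : C ⟶ P.complex.X (n + 2), h ≫ P.complex.d (n + 2) (n + 1) = f := by
  obtain ⟨s', s, -, -, h⟩ := P.contractible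
  exact hC.exists_lift _ _ (P.complex.d_comp_d _ _ _) (s (n + 1)) (s n) (h n) f hf

end RelResolutionExact

/-! ### The comparison theorem for relative projective resolutions. -/

section Comparison

variable {k : Type u} [Field k] {A : Type u} [Ring A] [Algebra k A] {B : Subalgebra k A}
  {Y : Bimodule k A} (P : RelResolution B Y) {C : ChainComplex (Bimodule k A) ℕ}

theorem RelResolution.exists_hom (hC : ∀ n, IsRelProjective B (C.X n))
    (f : C.X 0 ⟶ Y) (hf : C.d 1 0 ≫ f = 0) :
    ∃ φ : C ⟶ P.complex, φ.f 0 ≫ P.aug = f := by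
  obtain ⟨zero, h_zero⟩ := P.lift_zero (hC 0) f
  obtain ⟨one, h_one⟩ := P.lift_one (hC 1) (C.d 1 0 ≫ zero) (by rw [Category.assoc, h_zero, hf])
  refine ⟨ChainComplex.mkHom C P.complex zero one h_one fun n p => ?_, h_zero⟩
  have h := P.lift_succ (hC (n + 2)) n (C.d (n + 2) (n + 1) ≫ p.2.1) (by
    rw [Category.assoc, p.2.2, ← Category.assoc, C.d_comp_d, Limits.zero_comp])
  exact ⟨h.choose, h.choose_spec⟩

theorem RelResolution.exists_homotopy_zero (hC : ∀ n, IsRelProjective B (C.X n))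
    (e : C ⟶ P.complex) (he : e.f 0 ≫ P.aug = 0) :
    Nonempty (Homotopy e 0) := by
  obtain ⟨zero, h_zero⟩ := P.lift_one (hC 0) (e.f 0) he
  obtain ⟨one, h_one⟩ := P.lift_succ (hC 1) 0 (e.f 1 - C.d 1 0 ≫ zero) (by
    rw [Preadditive.sub_comp, Category.assoc, h_zero, e.comm, sub_self])
  refine ⟨Homotopy.mkInductive e zero h_zero.symm one (by rw [h_one, add_sub_cancel])
    fun n p => ?_⟩
  have h := P.lift_succ (hC (n + 2)) (n + 1) (e.f (n + 2) - C.d (n + 2) (n + 1) ≫ p.2.1) (by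
    obtain ⟨f, f', hp⟩ := p
    dsimp only
    rw [Preadditive.sub_comp, e.comm, hp, Preadditive.comp_add, ← Category.assoc, C.d_comp_d,
      Limits.zero_comp, zero_add, Category.assoc, sub_self])
  exact ⟨h.choose, by rw [h.choose_spec, add_sub_cancel]⟩

theorem RelResolution.exists_homotopy (hC : ∀ n, IsRelProjective B (C.X n))
    (f g : C ⟶ P.complex) (h : f.f 0 ≫ P.aug = g.f 0 ≫ P.aug) : Nonempty (Homotopy f g) := by
  obtain ⟨H⟩ := P.exists_homotopy_zero hC (f - g) (by
    rw [HomologicalComplex.sub_f_apply, Preadditive.sub_comp, h, sub_self])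
  exact ⟨Homotopy.equivSubZero.symm H⟩

/-- Any two relative projective resolutions are homotopy equivalent over the identity. -/
theorem RelResolution.exists_homotopyEquiv (P Q : RelResolution B Y) :
    ∃ e : HomotopyEquiv P.complex Q.complex, e.hom.f 0 ≫ Q.aug = P.aug := by
  obtain ⟨f, hf⟩ := Q.exists_hom P.relProjective P.aug P.d_comp_aug
  obtain ⟨g, hg⟩ := P.exists_hom Q.relProjective Q.aug Q.d_comp_aug
  obtain ⟨H⟩ := P.exists_homotopy P.relProjective (f ≫ g) (𝟙 _) (by
    rw [HomologicalComplex.comp_f, Category.assoc, hg, hf, HomologicalComplex.id_f,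
      Category.id_comp])
  obtain ⟨H'⟩ := Q.exists_homotopy Q.relProjective (g ≫ f) (𝟙 _) (by
    rw [HomologicalComplex.comp_f, Category.assoc, hf, hg, HomologicalComplex.id_f,
      Category.id_comp])
  exact ⟨⟨f, g, H, H'⟩, hf⟩

theorem RelResolution.exists_isComparison (P : RelResolution B (regular k A)) :
    ∃ φ : barComplex k A ⟶ P.complex, P.IsComparison φ :=
  P.exists_hom (fun n => (isProj_barComplex k A n).isRelProjective B) (barAug k A)
    (barComplex_d_barAug k A)

end Comparison

/-! ### The total complex of `Q → P → R` without the degree zero term of `R`, and its exactness. -/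

section Triangle

variable {k : Type u} [Field k] {A : Type u} [Ring A] [Algebra k A]

variable (k A) in
/-- Chain maps `Q → P → R` with a homotopy between the composite `Q → R` and a map `Q → R`
concentrated in degree zero. -/
structure Triangle where
  /-- The first complex. -/
  Q : ChainComplex (Bimodule k A) ℕ
  /-- The second complex. -/
  P : ChainComplex (Bimodule k A) ℕ
  /-- The third complex. -/
  R : ChainComplex (Bimodule k A) ℕ
  /-- The first map. -/
  ι : Q ⟶ P
  /-- The second map. -/
  φ : P ⟶ R
  /-- The homotopy. -/
  h : ∀ n, Q.X n ⟶ R.X (n + 1)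
  /-- The map in degree zero to which the composite is homotopic. -/
  ε : Q.X 0 ⟶ R.X 0
  comm_zero : ι.f 0 ≫ φ.f 0 = ε + h 0 ≫ R.d 1 0
  comm_succ : ∀ n, ι.f (n + 1) ≫ φ.f (n + 1) = Q.d (n + 1) n ≫ h n + h (n + 1) ≫ R.d (n + 2) (n + 1)

namespace Triangle

variable (T : Triangle k A)

/-- The complex `Q`, shifted by one degree. -/
def shift : ℕ → Bimodule k A
  | 0 => ModuleCat.of (Env k A) PUnit
  | n + 1 => T.Q.X n

/-- The differential of `Q`. -/
def shiftD : ∀ n, T.Q.X n ⟶ T.shift n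
  | 0 => 0
  | n + 1 => T.Q.d (n + 1) n

/-- The terms of the total complex. -/
def tot (n : ℕ) : Bimodule k A :=
  ModuleCat.of (Env k A) (T.R.X (n + 1) × T.P.X n × T.shift n)

/-- The differential of the total complex on elements. -/
def totDLinear (n : ℕ) : (T.R.X (n + 2) × T.P.X (n + 1) × T.Q.X n) →ₗ[Env k A]
    (T.R.X (n + 1) × T.P.X n × T.shift n) where
  toFun w := ((T.R.d (n + 2) (n + 1)).hom w.1 + (T.φ.f (n + 1)).hom w.2.1 + (T.h n).hom w.2.2,
    -(T.P.d (n + 1) n).hom w.2.1 - (T.ι.f n).hom w.2.2, (T.shiftD n).hom w.2.2)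
  map_add' v w := by
    simp only [Prod.fst_add, Prod.snd_add, map_add, Prod.mk_add_mk]
    refine Prod.ext ?_ (Prod.ext ?_ rfl)
    · dsimp only; abel
    · dsimp only; abel
  map_smul' r w := by
    simp only [Prod.smul_fst, Prod.smul_snd, map_smul, Prod.smul_mk, smul_add, smul_sub, smul_neg,
      RingHom.id_apply]

/-- The differential of the total complex. -/
def totD (n : ℕ) : T.tot (n + 1) ⟶ T.tot n :=
  ModuleCat.ofHom (X := T.tot (n + 1)) (Y := T.tot n) (T.totDLinear n)

theorem hom_comp_apply {L M N : Bimodule k A} {f : L ⟶ M} {g : M ⟶ N} {h : L ⟶ N} (e : f ≫ g = h)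
    (x : L) : g.hom (f.hom x) = h.hom x := LinearMap.congr_fun (congrArg ModuleCat.Hom.hom e) x

theorem d_d_apply (C : ChainComplex (Bimodule k A) ℕ) (n : ℕ) (x : C.X (n + 2)) :
    (C.d (n + 1) n).hom ((C.d (n + 2) (n + 1)).hom x) = 0 :=
  hom_comp_apply (C.d_comp_d _ _ _) x

theorem f_d_apply {C D : ChainComplex (Bimodule k A) ℕ} (f : C ⟶ D) (n : ℕ) (x : C.X (n + 1)) :
    (f.f n).hom ((C.d (n + 1) n).hom x) = (D.d (n + 1) n).hom ((f.f (n + 1)).hom x) :=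
  (hom_comp_apply (f.comm (n + 1) n).symm x).trans rfl

theorem comm_zero_apply (q : T.Q.X 0) : (T.φ.f 0).hom ((T.ι.f 0).hom q) =
    T.ε.hom q + (T.R.d 1 0).hom ((T.h 0).hom q) := hom_comp_apply T.comm_zero q

theorem comm_succ_apply (n : ℕ) (q : T.Q.X (n + 1)) :
    (T.φ.f (n + 1)).hom ((T.ι.f (n + 1)).hom q) = (T.h n).hom ((T.Q.d (n + 1) n).hom q) +
      (T.R.d (n + 2) (n + 1)).hom ((T.h (n + 1)).hom q) := hom_comp_apply (T.comm_succ n) q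

theorem shiftD_d (n : ℕ) (q : T.Q.X (n + 1)) :
    (T.shiftD n).hom ((T.Q.d (n + 1) n).hom q) = 0 := by
  cases n with
  | zero => rfl
  | succ n => exact d_d_apply T.Q n q

/-- Since `R` enters only from degree one on, the homotopy identity is needed only in positive
degrees, where `ε` does not occur. -/
theorem totDLinear_comp (n : ℕ) (w : T.R.X (n + 3) × T.P.X (n + 2) × T.Q.X (n + 1)) :
    T.totDLinear n (T.totDLinear (n + 1) w) = 0 := by
  obtain ⟨r, x, q⟩ := w
  refine Prod.ext ?_ (Prod.ext ?_ ?_)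
  · change (T.R.d (n + 2) (n + 1)).hom ((T.R.d (n + 3) (n + 2)).hom r + (T.φ.f (n + 2)).hom x +
        (T.h (n + 1)).hom q) + (T.φ.f (n + 1)).hom (-(T.P.d (n + 2) (n + 1)).hom x -
          (T.ι.f (n + 1)).hom q) + (T.h n).hom ((T.Q.d (n + 1) n).hom q) = 0
    rw [map_add, map_add, map_sub, map_neg, d_d_apply, f_d_apply, comm_succ_apply]
    abel
  · change -(T.P.d (n + 1) n).hom (-(T.P.d (n + 2) (n + 1)).hom x - (T.ι.f (n + 1)).hom q) -
      (T.ι.f n).hom ((T.Q.d (n + 1) n).hom q) = 0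
    rw [map_sub, map_neg, d_d_apply, f_d_apply]
    abel
  · exact T.shiftD_d n q

/-- The hypotheses under which the total complex is exact. -/
structure IsExact : Prop where
  surjective_ε : Function.Surjective T.ε.hom
  exact_ε : Function.Exact (T.Q.d 1 0).hom T.ε.hom
  exact_Q : ∀ n, Function.Exact (T.Q.d (n + 2) (n + 1)).hom (T.Q.d (n + 1) n).hom
  exact_P : ∀ n, Function.Exact (T.P.d (n + 2) (n + 1)).hom (T.P.d (n + 1) n).hom
  exact_R : ∀ n, Function.Exact (T.R.d (n + 2) (n + 1)).hom (T.R.d (n + 1) n).hom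
  mem_range_P : ∀ x, (T.φ.f 0).hom x ∈ LinearMap.range (T.R.d 1 0).hom →
    x ∈ LinearMap.range (T.P.d 1 0).hom

variable {T}

theorem IsExact.totDLinear_zero_surjective (hT : T.IsExact) :
    Function.Surjective (T.totDLinear 0) := by
  rintro ⟨r, x, z⟩
  -- This choice of `q` gives `φ (-x - ι q) = d (r - h q)`. So `-x - ι q` is a boundary `d x'`, and
  -- what remains of `r` is a cycle of `R`.
  obtain ⟨q, hq⟩ := hT.surjective_ε (-((T.R.d 1 0).hom r + (T.φ.f 0).hom x))
  obtain ⟨x', hx'⟩ := hT.mem_range_P (-x - (T.ι.f 0).hom q)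
    ⟨r - (T.h 0).hom q, by rw [map_sub, map_sub, map_neg, comm_zero_apply, hq]; abel⟩
  obtain ⟨r', hr'⟩ := (hT.exact_R 0 (r - (T.φ.f 1).hom x' - (T.h 0).hom q)).1 (by
    rw [map_sub, map_sub, ← f_d_apply, hx', map_sub, map_neg, comm_zero_apply, hq]
    abel)
  refine ⟨(r', x', q), Prod.ext ?_ (Prod.ext ?_ rfl)⟩
  · change (T.R.d 2 1).hom r' + (T.φ.f 1).hom x' + (T.h 0).hom q = r
    rw [hr']
    abel
  · change -(T.P.d 1 0).hom x' - (T.ι.f 0).hom q = x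
    rw [hx']
    abel

theorem IsExact.mem_range_d (hT : T.IsExact) (n : ℕ) (r : T.R.X (n + 2)) (x : T.P.X (n + 1))
    (q : T.Q.X n)
    (hr : (T.R.d (n + 2) (n + 1)).hom r + (T.φ.f (n + 1)).hom x + (T.h n).hom q = 0)
    (hx : -(T.P.d (n + 1) n).hom x - (T.ι.f n).hom q = 0) (hq : (T.shiftD n).hom q = 0) :
    ∃ q', (T.Q.d (n + 1) n).hom q' = q := by
  cases n with
  | zero =>
    -- In degree zero `shiftD` carries no information. Applying `d` to the first equation and `φ` to
    -- the second and adding, everything cancels except `-ε q`.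
    refine (hT.exact_ε q).1 ?_
    have h1 := congrArg (T.R.d 1 0).hom hr
    have h2 := congrArg (T.φ.f 0).hom hx
    rw [map_add, map_add, map_zero, d_d_apply, ← f_d_apply] at h1
    rw [map_sub, map_neg, comm_zero_apply, map_zero] at h2
    have h3 : _ + _ = (0 : T.R.X 0) + 0 := congrArg₂ (· + ·) h1 h2
    rw [← neg_eq_zero, ← add_zero (0 : T.R.X 0), ← h3]
    abel
  | succ n => exact (hT.exact_Q n q).1 hq

/-- The differential is triangular, so a preimage is found one component at a time: in `Q`, then in
`P`, then in `R`, each step using exactness of one complex. -/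
theorem IsExact.totDLinear_exact (hT : T.IsExact) (n : ℕ) :
    Function.Exact (T.totDLinear (n + 1)) (T.totDLinear n) := by
  intro w
  constructor
  swap
  · rintro ⟨w, rfl⟩
    exact T.totDLinear_comp n w
  obtain ⟨r, x, q⟩ := w
  intro hw
  have hr : (T.R.d (n + 2) (n + 1)).hom r + (T.φ.f (n + 1)).hom x + (T.h n).hom q = 0 :=
    congrArg Prod.fst hw
  have hx : -(T.P.d (n + 1) n).hom x - (T.ι.f n).hom q = 0 :=
    congrArg (fun w => w.2.1) hw
  obtain ⟨q', rfl⟩ := hT.mem_range_d n r x q hr hx (congrArg (fun w => w.2.2) hw)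
  obtain ⟨x', hx'⟩ := (hT.exact_P n (-x - (T.ι.f (n + 1)).hom q')).1 (by
    rw [map_sub, map_neg, ← f_d_apply, hx])
  obtain ⟨r', hr'⟩ := (hT.exact_R (n + 1) (r - (T.φ.f (n + 2)).hom x' - (T.h (n + 1)).hom q')).1 (by
    rw [map_sub, map_sub, ← f_d_apply, hx', map_sub, map_neg, comm_succ_apply, ← hr]
    abel)
  refine ⟨(r', x', q'), Prod.ext ?_ (Prod.ext ?_ rfl)⟩
  · change (T.R.d (n + 3) (n + 2)).hom r' + (T.φ.f (n + 2)).hom x' + (T.h (n + 1)).hom q' = r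
    rw [hr']
    abel
  · change -(T.P.d (n + 2) (n + 1)).hom x' - (T.ι.f (n + 1)).hom q' = x
    rw [hx']
    abel

end Triangle

end Triangle

/-! ### The total complex tensored with a bimodule. -/

section TriangleTensor

variable {k : Type u} [Field k] {A : Type u} [Ring A] [Algebra k A]

namespace Triangle

variable (T : Triangle k A)

/-- The projection of the total complex to `R`. -/
def totR (n : ℕ) : T.tot n ⟶ T.R.X (n + 1) :=
  ModuleCat.ofHom (X := T.tot n) (LinearMap.fst (Env k A) (T.R.X (n + 1)) (T.P.X n × T.shift n))

/-- The projection of the total complex to `P`. -/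
def totP (n : ℕ) : T.tot n ⟶ T.P.X n :=
  ModuleCat.ofHom (X := T.tot n) (LinearMap.fst (Env k A) (T.P.X n) (T.shift n) ∘ₗ
    LinearMap.snd (Env k A) (T.R.X (n + 1)) (T.P.X n × T.shift n))

/-- The projection of the total complex to the shifted complex `Q`. -/
def totQ (n : ℕ) : T.tot n ⟶ T.shift n :=
  ModuleCat.ofHom (X := T.tot n) (LinearMap.snd (Env k A) (T.P.X n) (T.shift n) ∘ₗ
    LinearMap.snd (Env k A) (T.R.X (n + 1)) (T.P.X n × T.shift n))

/-- The inclusion of `R`. -/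
def ofR (n : ℕ) : T.R.X (n + 1) ⟶ T.tot n :=
  ModuleCat.ofHom (Y := T.tot n) (LinearMap.inl (Env k A) (T.R.X (n + 1)) (T.P.X n × T.shift n))

/-- The inclusion of `P`. -/
def ofP (n : ℕ) : T.P.X n ⟶ T.tot n :=
  ModuleCat.ofHom (Y := T.tot n)
    (LinearMap.inr (Env k A) (T.R.X (n + 1)) (T.P.X n × T.shift n) ∘ₗ
      LinearMap.inl (Env k A) (T.P.X n) (T.shift n))

/-- The inclusion of the shifted complex `Q`. -/
def ofQ (n : ℕ) : T.shift n ⟶ T.tot n :=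
  ModuleCat.ofHom (Y := T.tot n)
    (LinearMap.inr (Env k A) (T.R.X (n + 1)) (T.P.X n × T.shift n) ∘ₗ
      LinearMap.inr (Env k A) (T.P.X n) (T.shift n))

/-- The projection of the total complex in positive degrees to `Q`. -/
def totQSucc (n : ℕ) : T.tot (n + 1) ⟶ T.Q.X n := T.totQ (n + 1)

/-- The inclusion of `Q`. -/
def ofQSucc (n : ℕ) : T.Q.X n ⟶ T.tot (n + 1) := T.ofQ (n + 1)

theorem isFlat_tot (hR : ∀ n, IsFlat k (T.R.X (n + 1))) (hP : ∀ n, IsFlat k (T.P.X n))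
    (hQ : ∀ n, IsFlat k (T.Q.X n)) (n : ℕ) : IsFlat k (T.tot n) := by
  have hs : IsFlat k (T.shift n) := by
    cases n with
    | zero => exact IsFlat.of_subsingleton (P := ModuleCat.of (Env k A) PUnit)
    | succ n => exact hQ n
  let S : Bimodule k A := ModuleCat.of (Env k A) (T.P.X n × T.shift n)
  have hS : IsFlat k S := (hP n).of_biproduct hs
    (ModuleCat.ofHom (X := S) (LinearMap.fst (Env k A) (T.P.X n) (T.shift n)))
    (ModuleCat.ofHom (X := S) (LinearMap.snd (Env k A) (T.P.X n) (T.shift n)))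
    (ModuleCat.ofHom (Y := S) (LinearMap.inl (Env k A) (T.P.X n) (T.shift n)))
    (ModuleCat.ofHom (Y := S) (LinearMap.inr (Env k A) (T.P.X n) (T.shift n)))
    (ModuleCat.hom_ext (LinearMap.ext fun x => Prod.ext (add_zero x.1) (zero_add x.2)))
  exact (hR n).of_biproduct hS (T.totR n)
    (ModuleCat.ofHom (X := T.tot n) (Y := S)
      (LinearMap.snd (Env k A) (T.R.X (n + 1)) (T.P.X n × T.shift n)))
    (T.ofR n)
    (ModuleCat.ofHom (X := S) (Y := T.tot n)
      (LinearMap.inr (Env k A) (T.R.X (n + 1)) (T.P.X n × T.shift n)))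
    (ModuleCat.hom_ext (LinearMap.ext fun x => Prod.ext (add_zero x.1) (zero_add x.2)))

theorem totD_totR (n : ℕ) : T.totD n ≫ T.totR n = T.totR (n + 1) ≫ T.R.d (n + 2) (n + 1) +
    T.totP (n + 1) ≫ T.φ.f (n + 1) + T.totQSucc n ≫ T.h n := rfl

theorem totD_totP (n : ℕ) : T.totD n ≫ T.totP n = -(T.totP (n + 1) ≫ T.P.d (n + 1) n) +
    -(T.totQSucc n ≫ T.ι.f n) :=
  ModuleCat.hom_ext (LinearMap.ext fun _ => sub_eq_add_neg _ _)

theorem totD_totQSucc (n : ℕ) :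
    T.totD (n + 1) ≫ T.totQSucc n = T.totQSucc (n + 1) ≫ T.Q.d (n + 1) n := rfl

theorem ofR_totR (n : ℕ) : T.ofR n ≫ T.totR n = 𝟙 _ := rfl
theorem ofR_totP (n : ℕ) : T.ofR n ≫ T.totP n = 0 := rfl
theorem ofR_totQSucc (n : ℕ) : T.ofR (n + 1) ≫ T.totQSucc n = 0 := rfl
theorem ofP_totR (n : ℕ) : T.ofP n ≫ T.totR n = 0 := rfl
theorem ofP_totP (n : ℕ) : T.ofP n ≫ T.totP n = 𝟙 _ := rfl
theorem ofP_totQSucc (n : ℕ) : T.ofP (n + 1) ≫ T.totQSucc n = 0 := rfl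
theorem ofQSucc_totR (n : ℕ) : T.ofQSucc n ≫ T.totR (n + 1) = 0 := rfl
theorem ofQSucc_totP (n : ℕ) : T.ofQSucc n ≫ T.totP (n + 1) = 0 := rfl
theorem ofQSucc_totQSucc (n : ℕ) : T.ofQSucc n ≫ T.totQSucc n = 𝟙 _ := rfl

theorem ofR_totD (n : ℕ) : T.ofR (n + 1) ≫ T.totD n = T.R.d (n + 2) (n + 1) ≫ T.ofR n := by
  refine ModuleCat.hom_ext (LinearMap.ext fun x => Prod.ext ?_ (Prod.ext ?_ (map_zero _)))
  · change _ + (T.φ.f (n + 1)).hom 0 + (T.h n).hom 0 = _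
    rw [map_zero, map_zero, add_zero, add_zero]
    rfl
  · change -(T.P.d (n + 1) n).hom 0 - (T.ι.f n).hom 0 = 0
    rw [map_zero, map_zero, sub_zero, neg_zero]

theorem ofP_totD (n : ℕ) : T.ofP (n + 1) ≫ T.totD n =
    T.φ.f (n + 1) ≫ T.ofR n + -(T.P.d (n + 1) n ≫ T.ofP n) := by
  refine ModuleCat.hom_ext (LinearMap.ext fun x => Prod.ext ?_ (Prod.ext ?_ ?_))
  · change (T.R.d (n + 2) (n + 1)).hom 0 + (T.φ.f (n + 1)).hom x + (T.h n).hom 0 =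
      (T.φ.f (n + 1)).hom x + -0
    rw [map_zero, map_zero, add_zero, zero_add, neg_zero, add_zero]
  · change -(T.P.d (n + 1) n).hom x - (T.ι.f n).hom 0 = 0 + -(T.P.d (n + 1) n).hom x
    rw [map_zero, sub_zero, zero_add]
  · change (T.shiftD n).hom 0 = 0 + -0
    rw [map_zero, neg_zero, add_zero]

theorem ofQSucc_totD (n : ℕ) : T.ofQSucc n ≫ T.totD n =
    T.h n ≫ T.ofR n + -(T.ι.f n ≫ T.ofP n) + T.shiftD n ≫ T.ofQ n := by
  refine ModuleCat.hom_ext (LinearMap.ext fun x => Prod.ext ?_ (Prod.ext ?_ ?_))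
  · change (T.R.d (n + 2) (n + 1)).hom 0 + (T.φ.f (n + 1)).hom 0 + (T.h n).hom x =
      (T.h n).hom x + -0 + 0
    rw [map_zero, map_zero, add_zero, zero_add, neg_zero, add_zero, add_zero]
  · change -(T.P.d (n + 1) n).hom 0 - (T.ι.f n).hom x = 0 + -(T.ι.f n).hom x + 0
    rw [map_zero, neg_zero, zero_sub, zero_add, add_zero]
  · change (T.shiftD n).hom x = 0 + -0 + (T.shiftD n).hom x
    rw [neg_zero, add_zero, zero_add]

variable {T}

theorem tensor_map_comp (X : Bimodule k A) {L M N : Bimodule k A} (f : L ⟶ M) (g : M ⟶ N)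
    (z : BTensor k X L) :
    BTensor.map k (𝟙 X) g (BTensor.map k (𝟙 X) f z) = BTensor.map k (𝟙 X) (f ≫ g) z := by
  rw [BTensor.map_comp, Category.id_comp]

/-- The total complex remains exact after tensoring with `X`. -/
theorem IsExact.exists_of_tensor (hT : T.IsExact) (hR : ∀ n, IsFlat k (T.R.X (n + 1)))
    (hP : ∀ n, IsFlat k (T.P.X n)) (hQ : ∀ n, IsFlat k (T.Q.X n)) (X : Bimodule k A) (n : ℕ)
    (r : BTensor k X (T.R.X (n + 2))) (x : BTensor k X (T.P.X (n + 1)))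
    (q : BTensor k X (T.Q.X n))
    (hr : BTensor.map k (𝟙 X) (T.R.d (n + 2) (n + 1)) r +
      BTensor.map k (𝟙 X) (T.φ.f (n + 1)) x + BTensor.map k (𝟙 X) (T.h n) q = 0)
    (hx : BTensor.map k (𝟙 X) (T.P.d (n + 1) n) x + BTensor.map k (𝟙 X) (T.ι.f n) q = 0)
    (hq : BTensor.map k (𝟙 X) (T.shiftD n) q = 0) :
    ∃ (r' : BTensor k X (T.R.X (n + 3))) (x' : BTensor k X (T.P.X (n + 2)))
      (q' : BTensor k X (T.Q.X (n + 1))),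
      BTensor.map k (𝟙 X) (T.R.d (n + 3) (n + 2)) r' +
        BTensor.map k (𝟙 X) (T.φ.f (n + 2)) x' + BTensor.map k (𝟙 X) (T.h (n + 1)) q' = r ∧
      BTensor.map k (𝟙 X) (T.P.d (n + 2) (n + 1)) x' +
        BTensor.map k (𝟙 X) (T.ι.f (n + 1)) q' = -x ∧
      BTensor.map k (𝟙 X) (T.Q.d (n + 1) n) q' = q := by
  have hex := IsFlat.tensor_exact T.tot T.totD (T.isFlat_tot hR hP hQ)
    hT.totDLinear_zero_surjective hT.totDLinear_exact X n
  let w : BTensor k X (T.tot (n + 1)) := BTensor.map k (𝟙 X) (T.ofR (n + 1)) r +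
    BTensor.map k (𝟙 X) (T.ofP (n + 1)) x + BTensor.map k (𝟙 X) (T.ofQSucc n) q
  have hw : BTensor.map k (𝟙 X) (T.totD n) w = 0 := by
    have h1 := congrArg (BTensor.map k (𝟙 X) (T.ofR n)) hr
    have h2 := congrArg (BTensor.map k (𝟙 X) (T.ofP n)) hx
    have h3 := congrArg (BTensor.map k (𝟙 X) (T.ofQ n)) hq
    simp only [map_add, map_zero, tensor_map_comp] at h1 h2 h3
    change BTensor.map k (𝟙 X) (T.totD n) (_ + _ + _) = 0
    rw [map_add, map_add, tensor_map_comp, tensor_map_comp, tensor_map_comp, ofR_totD, ofP_totD,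
      ofQSucc_totD]
    simp only [BTensor.map_add_right, BTensor.map_neg_right]
    -- The `P`-component of the total differential has a minus sign that `hx` lacks, hence the
    -- difference.
    have h4 : _ - _ = (0 : BTensor k X (T.tot n)) - 0 := congrArg₂ (· - ·) h1 h2
    rw [h3, add_zero, ← sub_zero (0 : BTensor k X (T.tot n)), ← h4]
    abel
  obtain ⟨w', hw'⟩ := (hex w).1 hw
  have hR' : BTensor.map k (𝟙 X) (T.totR (n + 1)) w = r := by
    change BTensor.map k (𝟙 X) (T.totR (n + 1)) (_ + _ + _) = r
    rw [map_add, map_add, tensor_map_comp, tensor_map_comp, tensor_map_comp, ofR_totR, ofP_totR,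
      ofQSucc_totR, BTensor.map_id, BTensor.map_zero_right, BTensor.map_zero_right, add_zero, add_zero]
  have hP' : BTensor.map k (𝟙 X) (T.totP (n + 1)) w = x := by
    change BTensor.map k (𝟙 X) (T.totP (n + 1)) (_ + _ + _) = x
    rw [map_add, map_add, tensor_map_comp, tensor_map_comp, tensor_map_comp, ofR_totP, ofP_totP,
      ofQSucc_totP, BTensor.map_id, BTensor.map_zero_right, BTensor.map_zero_right, add_zero, zero_add]
  have hQ' : BTensor.map k (𝟙 X) (T.totQSucc n) w = q := by
    change BTensor.map k (𝟙 X) (T.totQSucc n) (_ + _ + _) = _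
    rw [map_add, map_add, tensor_map_comp, tensor_map_comp, tensor_map_comp, ofR_totQSucc, ofP_totQSucc,
      ofQSucc_totQSucc, BTensor.map_id, BTensor.map_zero_right, BTensor.map_zero_right, zero_add, zero_add]
  refine ⟨BTensor.map k (𝟙 X) (T.totR (n + 2)) w', BTensor.map k (𝟙 X) (T.totP (n + 2)) w',
    BTensor.map k (𝟙 X) (T.totQSucc (n + 1)) w', ?_, ?_, ?_⟩
  · rw [← hw', tensor_map_comp, totD_totR] at hR'
    simp only [BTensor.map_add_right] at hR'
    rw [← hR', tensor_map_comp, tensor_map_comp, tensor_map_comp]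
  · rw [← hw', tensor_map_comp, totD_totP] at hP'
    simp only [BTensor.map_add_right, BTensor.map_neg_right] at hP'
    rw [← hP', neg_add, neg_neg, neg_neg, tensor_map_comp, tensor_map_comp]
  · rw [← hw', tensor_map_comp, totD_totQSucc] at hQ'
    rw [tensor_map_comp, hQ']

end Triangle

end TriangleTensor

/-! ### The triangle of the induced bar resolution of `B`, the bar resolution of `A` and the
relative resolution. -/

section BarTriangle

variable {k : Type u} [Field k] {A : Type u} [Ring A] [Algebra k A] (B : Subalgebra k A)

/-- The chain map which is a given map in degree zero, and zero in positive degrees. -/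
def homOfDegreeZero {C D : ChainComplex (Bimodule k A) ℕ} (e : C.X 0 ⟶ D.X 0)
    (he : C.d 1 0 ≫ e = 0) : C ⟶ D where
  f n := match n with
    | 0 => e
    | _ + 1 => 0
  comm' i j hij := by
    obtain rfl : j + 1 = i := hij
    cases j with
    | zero => exact Limits.zero_comp.trans he.symm
    | succ j => exact Limits.zero_comp.trans Limits.comp_zero.symm

theorem ind_map_extendLift {U V : Bimodule k B} {N : Bimodule k A} (f : U ⟶ V)
    (g : V ⟶ (res B).obj N) :
    (ind B).map f ≫ extendLift (envIncl B) g = extendLift (envIncl B) (f ≫ g) :=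
  extend_hom_ext (envIncl B) fun u => by
    rw [extendLift_one, ModuleCat.hom_comp, LinearMap.comp_apply]
    exact (congrArg (extendLift (envIncl B) g).hom (extendFunctor_map_mk (envIncl B) f 1 u)).trans
      (extendLift_one (envIncl B) g (f.hom u))

/-- The inclusion of the bar resolution of `B` into that of `A`. -/
def barInclHom (n : ℕ) : (barComplex k B).X n ⟶ (res B).obj ((barComplex k A).X n) :=
  barIncl B (n + 1)

theorem barInclHom_comm (n : ℕ) :
    barInclHom B (n + 1) ≫ (res B).map ((barComplex k A).d (n + 1) n) =
      (barComplex k B).d (n + 1) n ≫ barInclHom B n := by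
  rw [barComplex_d, barComplex_d]
  exact barIncl_comm B (n + 1)

theorem barInclHom_barAug :
    barInclHom B 0 ≫ (res B).map (barAug k A) = barAug k B ≫ inclBimod B :=
  barIncl_comm B 0

/-- The complex of `A`-bimodules induced from the bar resolution of `B`. -/
abbrev indBar : ChainComplex (Bimodule k A) ℕ where
  X n := (ind B).obj ((barComplex k B).X n)
  d i j := (ind B).map ((barComplex k B).d i j)
  shape i j hij := by rw [(barComplex k B).shape i j hij, Functor.map_zero]
  d_comp_d' i j l _ _ := by rw [← Functor.map_comp, HomologicalComplex.d_comp_d, Functor.map_zero]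

/-- The chain map from the induced bar resolution of `B` to the bar resolution of `A`. -/
def indBarHom : indBar B ⟶ barComplex k A where
  f n := extendLift (envIncl B) (barInclHom B n)
  comm' i j hij := by
    obtain rfl : j + 1 = i := hij
    change extendLift (envIncl B) (barInclHom B (j + 1)) ≫ (barComplex k A).d (j + 1) j =
      (ind B).map ((barComplex k B).d (j + 1) j) ≫ extendLift (envIncl B) (barInclHom B j)
    rw [extendLift_comp, barInclHom_comm, ind_map_extendLift]

/-- The map from the induced bar resolution of `B` to `A ⊗_B A`, in degree zero. -/
def indBarAug : (indBar B).X 0 ⟶ (relResolution B).complex.X 0 := (ind B).map (barAug k B)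

theorem d_indBarAug : (indBar B).d 1 0 ≫ indBarAug B = 0 := by
  change (ind B).map ((barComplex k B).d 1 0) ≫ (ind B).map (barAug k B) = 0
  rw [← Functor.map_comp, barComplex_d_barAug, Functor.map_zero]

theorem indBarAug_aug :
    indBarAug B ≫ (relResolution B).aug = (indBarHom B).f 0 ≫ barAug k A := by
  change (ind B).map (barAug k B) ≫ extendLift (envIncl B) (inclBimod B) =
    extendLift (envIncl B) (barInclHom B 0) ≫ barAug k A
  rw [ind_map_extendLift, extendLift_comp, barInclHom_barAug]

/-- The composite and the map concentrated in degree zero agree after the augmentation to `A`. Their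
source consists of induced, hence relatively projective, bimodules, so the comparison theorem gives
a homotopy. -/
theorem exists_barHomotopy {φ : barComplex k A ⟶ (relResolution B).complex}
    (hφ : (relResolution B).IsComparison φ) :
    ∃ h : ∀ n, (indBar B).X n ⟶ (relResolution B).complex.X (n + 1),
      (indBarHom B).f 0 ≫ φ.f 0 = indBarAug B + h 0 ≫ (relResolution B).complex.d 1 0 ∧
      ∀ n, (indBarHom B).f (n + 1) ≫ φ.f (n + 1) = (indBar B).d (n + 1) n ≫ h n +
        h (n + 1) ≫ (relResolution B).complex.d (n + 2) (n + 1) := by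
  obtain ⟨H⟩ := (relResolution B).exists_homotopy (C := indBar B)
    (fun n => isRelProjective_ind _) (indBarHom B ≫ φ)
    (homOfDegreeZero (indBarAug B) (d_indBarAug B)) (by
      rw [HomologicalComplex.comp_f, Category.assoc, hφ]
      exact (indBarAug_aug B).symm)
  refine ⟨fun n => H.hom n (n + 1), ?_, fun n => ?_⟩
  · have h := H.comm 0
    rw [Homotopy.dNext_zero_chainComplex, Homotopy.prevD_chainComplex, zero_add, add_comm] at h
    exact h
  · have h := H.comm (n + 1)
    rw [Homotopy.dNext_succ_chainComplex, Homotopy.prevD_chainComplex] at h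
    exact h.trans (add_zero _)

/-- The triangle formed by the induced bar resolution of `B`, the bar resolution of `A` and the
relative resolution of `A`. -/
def barTriangle {φ : barComplex k A ⟶ (relResolution B).complex}
    (hφ : (relResolution B).IsComparison φ) : Triangle k A where
  Q := indBar B
  P := barComplex k A
  R := (relResolution B).complex
  ι := indBarHom B
  φ := φ
  h := (exists_barHomotopy B hφ).choose
  ε := indBarAug B
  comm_zero := (exists_barHomotopy B hφ).choose_spec.1
  comm_succ := (exists_barHomotopy B hφ).choose_spec.2

variable {B}

theorem barTriangle_isExact (hflat : IsFlat k (quotBimod B))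
    {φ : barComplex k A ⟶ (relResolution B).complex}
    (hφ : (relResolution B).IsComparison φ) : (barTriangle B hφ).IsExact where
  surjective_ε := extendFunctor_map_surjective (envIncl B) _ (barAug_surjective k B)
  exact_ε := ind_exact hflat _ _ (barComplex_exact_zero k B)
  exact_Q n := ind_exact hflat _ _ (barComplex_exact k B n)
  exact_P := barComplex_exact k A
  exact_R := (relResolution B).exact_succ
  -- A comparison map preserves augmentations. If `φ x` is a boundary, then the augmentation kills
  -- `x`, so `x` is a boundary in the bar resolution.
  mem_range_P x hx := by
    obtain ⟨r, hr⟩ := hx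
    refine (barComplex_exact_zero k A x).1 ?_
    rw [← hφ]
    refine (congrArg (relResolution B).aug.hom hr.symm).trans ?_
    exact (relResolution B).exact_zero.apply_apply_eq_zero r

/-- The map `X ⊗ Bar(A) → X ⊗ P` of complexes given by a chain map `Bar(A) → P`. -/
def tensorHom {P : RelResolution B (regular k A)} (φ : barComplex k A ⟶ P.complex)
    (X : Bimodule k A) : hochschildComplex k X ⟶ P.tensor X :=
  ((tensorFunctor k X).mapHomologicalComplex (ComplexShape.down ℕ)).map φ

/-- The homotopy, as a map from the Hochschild complex of `B` to the relative complex of `A`. -/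
def tensorHomotopy {φ : barComplex k A ⟶ (relResolution B).complex}
    (hφ : (relResolution B).IsComparison φ) (X : Bimodule k A) (n : ℕ) :
    (hochschildComplex k ((res B).obj X)).X n →ₗ[k] ((relResolution B).tensor X).X (n + 1) :=
  BTensor.map k (𝟙 X) ((barTriangle B hφ).h n) ∘ₗ toTensorInd B X ((barComplex k B).X n)

theorem tensor_indBarHom (X : Bimodule k A) (n : ℕ)
    (z : BTensor k ((res B).obj X) ((barComplex k B).X n)) :
    BTensor.map k (𝟙 X) ((indBarHom B).f n) (toTensorInd B X ((barComplex k B).X n) z) =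
      tensorRes B X (barInclHom B n) z := by
  refine (tensorRes_comp B X _ (barInclHom B n) (𝟙 _) _ ?_ z).trans ?_
  · refine ModuleCat.hom_ext (LinearMap.ext fun u => ?_)
    exact extendLift_one (envIncl B) (barInclHom B n) u
  · rw [BTensor.map_id]

theorem tensorHomotopy_comm {φ : barComplex k A ⟶ (relResolution B).complex}
    (hφ : (relResolution B).IsComparison φ) (X : Bimodule k A) (n : ℕ)
    (q : (hochschildComplex k ((res B).obj X)).X (n + 1)) :
    ((tensorHom φ X).f (n + 1)).hom
      (((inclComplex B X).f (n + 1)).hom q) =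
      tensorHomotopy hφ X n (((hochschildComplex k ((res B).obj X)).d (n + 1) n).hom q) +
      (((relResolution B).tensor X).d (n + 2) (n + 1)).hom (tensorHomotopy hφ X (n + 1) q) := by
  let h (n : ℕ) : (indBar B).X n ⟶ (relResolution B).complex.X (n + 1) := (barTriangle B hφ).h n
  have hh (n : ℕ) : (indBarHom B).f (n + 1) ≫ φ.f (n + 1) = (indBar B).d (n + 1) n ≫ h n +
    h (n + 1) ≫ (relResolution B).complex.d (n + 2) (n + 1) := (barTriangle B hφ).comm_succ n
  let q' : BTensor k ((res B).obj X) ((barComplex k B).X (n + 1)) := q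
  change BTensor.map k (𝟙 X) (φ.f (n + 1)) (tensorRes B X (barInclHom B (n + 1)) q') =
    BTensor.map k (𝟙 X) (h n) (toTensorInd B X ((barComplex k B).X n)
      (BTensor.map k (𝟙 _) ((barComplex k B).d (n + 1) n) q')) +
    BTensor.map k (𝟙 X) ((relResolution B).complex.d (n + 2) (n + 1))
      (BTensor.map k (𝟙 X) (h (n + 1)) (toTensorInd B X ((barComplex k B).X (n + 1)) q'))
  rw [← tensor_indBarHom, ← toTensorInd_map_right, Triangle.tensor_map_comp,
    Triangle.tensor_map_comp, Triangle.tensor_map_comp, hh, BTensor.map_add_right]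

/-- This is `Triangle.IsExact.exists_of_tensor` for the triangle above, with `X ⊗_{Aᵉ} ind (Bar B)`
rewritten as Hochschild chains of `B`. -/
theorem tensor_total_exact (hflat : IsFlat k (quotBimod B))
    {φ : barComplex k A ⟶ (relResolution B).complex}
    (hφ : (relResolution B).IsComparison φ) (X : Bimodule k A) (n : ℕ)
    (r : ((relResolution B).tensor X).X (n + 2)) (x : (hochschildComplex k X).X (n + 1))
    (q : (hochschildComplex k ((res B).obj X)).X n)
    (hr : (((relResolution B).tensor X).d (n + 2) (n + 1)).hom r +
      ((tensorHom φ X).f (n + 1)).hom x +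
      tensorHomotopy hφ X n q = 0)
    (hx : ((hochschildComplex k X).d (n + 1) n).hom x + ((inclComplex B X).f n).hom q = 0)
    (hq : ∀ j, ((hochschildComplex k ((res B).obj X)).d n j).hom q = 0) :
    ∃ (r' : ((relResolution B).tensor X).X (n + 3)) (x' : (hochschildComplex k X).X (n + 2))
      (q' : (hochschildComplex k ((res B).obj X)).X (n + 1)),
      (((relResolution B).tensor X).d (n + 3) (n + 2)).hom r' +
        ((tensorHom φ X).f (n + 2)).hom x' + tensorHomotopy hφ X (n + 1) q' = r ∧
      ((hochschildComplex k X).d (n + 2) (n + 1)).hom x' +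
        ((inclComplex B X).f (n + 1)).hom q' = -x ∧
      ((hochschildComplex k ((res B).obj X)).d (n + 1) n).hom q' = q := by
  let V := (barComplex k B).X
  have hx' : BTensor.map k (𝟙 X) ((barComplex k A).d (n + 1) n) x +
      BTensor.map k (𝟙 X) ((indBarHom B).f n) (toTensorInd B X (V n) q) = 0 :=
    (congrArg (_ + ·) (tensor_indBarHom X n q)).trans hx
  have hq' : BTensor.map k (𝟙 X) ((barTriangle B hφ).shiftD n) (toTensorInd B X (V n) q) = 0 := by
    cases n with
    | zero => exact BTensor.map_zero_right k _ _
    | succ n =>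
      refine (toTensorInd_map_right B X ((barComplex k B).d (n + 1) n) q).trans ?_
      exact (congrArg (toTensorInd B X (V n)) (hq n)).trans (map_zero _)
  obtain ⟨r', x', q', h1, h2, h3⟩ := (barTriangle_isExact hflat hφ).exists_of_tensor
    (isFlat_relResolution hflat) (fun n => (isProj_barComplex k A n).isFlat)
    (fun n => (isProj_barComplex k B n).isFlat.ind B) X n r x
    (toTensorInd B X (V n) q) hr hx' hq'
  obtain ⟨q', rfl⟩ := toTensorInd_surjective B X (V (n + 1)) q'
  refine ⟨r', x', q', h1, ?_, ?_⟩
  · refine Eq.trans ?_ h2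
    exact congrArg (BTensor.map k (𝟙 X) ((barComplex k A).d (n + 2) (n + 1)) x' + ·)
      (tensor_indBarHom X (n + 1) q').symm
  · apply toTensorInd_injective B X (V n)
    exact (toTensorInd_map_right B X ((barComplex k B).d (n + 1) n) q').symm.trans h3

end BarTriangle

/-! ### Homology classes of cycles in positive degrees. -/

section HomologyClass

variable {k : Type u} [Field k] (C : ChainComplex (ModuleCat.{u} k) ℕ)

/-- A cycle, as an element of the object of cycles. -/
def hcycle (n : ℕ) : LinearMap.ker (C.d (n + 1) n).hom →ₗ[k] C.cycles (n + 1) :=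
  ModuleCat.Hom.hom (C.liftCycles (A := ModuleCat.of k (LinearMap.ker (C.d (n + 1) n).hom))
    (ModuleCat.ofHom (Submodule.subtype _)) n (ChainComplex.next_nat_succ n)
    (ModuleCat.hom_ext (LinearMap.ext fun x => x.2)))

theorem iCycles_hcycle (n : ℕ) (x : LinearMap.ker (C.d (n + 1) n).hom) :
    (C.iCycles (n + 1)).hom (hcycle C n x) = x.1 :=
  LinearMap.congr_fun (congrArg ModuleCat.Hom.hom (C.liftCycles_i
    (A := ModuleCat.of k (LinearMap.ker (C.d (n + 1) n).hom))
    (ModuleCat.ofHom (Submodule.subtype _)) n (ChainComplex.next_nat_succ n)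
    (ModuleCat.hom_ext (LinearMap.ext fun x => x.2)))) x

theorem iCycles_injective (n : ℕ) : Function.Injective (C.iCycles n).hom :=
  (ModuleCat.mono_iff_injective (C.iCycles n)).1 inferInstance

/-- The homology class of a cycle. -/
def hclass (n : ℕ) : LinearMap.ker (C.d (n + 1) n).hom →ₗ[k] C.homology (n + 1) :=
  (C.homologyπ (n + 1)).hom ∘ₗ hcycle C n

theorem hclass_surjective (n : ℕ) : Function.Surjective (hclass C n) := by
  intro y
  obtain ⟨z, rfl⟩ := (ModuleCat.epi_iff_surjective (C.homologyπ (n + 1))).1 inferInstance y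
  have hz : (C.d (n + 1) n).hom ((C.iCycles (n + 1)).hom z) = 0 :=
    LinearMap.congr_fun (congrArg ModuleCat.Hom.hom (C.iCycles_d (n + 1) n)) z
  refine ⟨⟨(C.iCycles (n + 1)).hom z, hz⟩, congrArg (C.homologyπ (n + 1)).hom ?_⟩
  apply iCycles_injective
  rw [iCycles_hcycle]

theorem hclass_eq_zero_iff (n : ℕ) (x : LinearMap.ker (C.d (n + 1) n).hom) :
    hclass C n x = 0 ↔ ∃ y, (C.d (n + 2) (n + 1)).hom y = x.1 := by
  have hi (y : C.X (n + 2)) : (C.iCycles (n + 1)).hom ((C.toCycles (n + 2) (n + 1)).hom y) =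
      (C.d (n + 2) (n + 1)).hom y :=
    LinearMap.congr_fun (congrArg ModuleCat.Hom.hom (C.toCycles_i (n + 2) (n + 1))) y
  have hex := ShortComplex.exact_of_g_is_cokernel
    (ShortComplex.mk _ _ (C.toCycles_comp_homologyπ (n + 2) (n + 1)))
    (C.homologyIsCokernel (n + 2) (n + 1) (ChainComplex.prev ℕ (n + 1)))
  constructor
  · intro hx
    obtain ⟨y, hy⟩ := (ShortComplex.moduleCat_exact_iff _).1 hex (hcycle C n x) hx
    exact ⟨y, (hi y).symm.trans ((congrArg (C.iCycles (n + 1)).hom hy).trans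
      (iCycles_hcycle C n x))⟩
  · rintro ⟨y, hy⟩
    have h : hcycle C n x = (C.toCycles (n + 2) (n + 1)).hom y := by
      apply iCycles_injective
      rw [iCycles_hcycle, hi, hy]
    rw [hclass, LinearMap.comp_apply, h]
    exact LinearMap.congr_fun (congrArg ModuleCat.Hom.hom
      (C.toCycles_comp_homologyπ (n + 2) (n + 1))) y

variable {C} in
theorem hclass_eq_iff {n : ℕ} {x x' : LinearMap.ker (C.d (n + 1) n).hom} :
    hclass C n x = hclass C n x' ↔ ∃ y, (C.d (n + 2) (n + 1)).hom y = x.1 - x'.1 := by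
  rw [← sub_eq_zero, ← map_sub, hclass_eq_zero_iff]
  rfl

theorem homologyMap_hclass {C D : ChainComplex (ModuleCat.{u} k) ℕ} (f : C ⟶ D) (n : ℕ)
    (x : LinearMap.ker (C.d (n + 1) n).hom) (y : LinearMap.ker (D.d (n + 1) n).hom)
    (h : (f.f (n + 1)).hom x.1 = y.1) :
    (HomologicalComplex.homologyMap f (n + 1)).hom (hclass C n x) = hclass D n y := by
  have h1 : (HomologicalComplex.cyclesMap f (n + 1)).hom (hcycle C n x) = hcycle D n y := by
    apply iCycles_injective
    rw [iCycles_hcycle, ← h, ← iCycles_hcycle C n x]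
    exact LinearMap.congr_fun (congrArg ModuleCat.Hom.hom
      (HomologicalComplex.cyclesMap_i f (n + 1))) (hcycle C n x)
  rw [hclass, hclass, LinearMap.comp_apply, LinearMap.comp_apply, ← h1]
  exact LinearMap.congr_fun (congrArg ModuleCat.Hom.hom
    (HomologicalComplex.homologyπ_naturality f (n + 1))) (hcycle C n x)

end HomologyClass

/-! ### The long exact sequence extracted from an exact total complex. -/

section LongExact

variable {k : Type u} [Field k] {C D E : ChainComplex (ModuleCat.{u} k) ℕ} (f : C ⟶ D) (g : D ⟶ E)
  (h : ∀ n, C.X n →ₗ[k] E.X (n + 1))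

/-- The map `h` is a homotopy between zero and the composite of `f` and `g` in positive degrees, and
the total complex of `C → D → E` is exact in positive degrees. -/
structure IsTotalExact : Prop where
  comm : ∀ n (q : C.X (n + 1)), (g.f (n + 1)).hom ((f.f (n + 1)).hom q) =
    h n ((C.d (n + 1) n).hom q) + (E.d (n + 2) (n + 1)).hom (h (n + 1) q)
  exact : ∀ n (r : E.X (n + 2)) (x : D.X (n + 1)) (q : C.X n),
    (E.d (n + 2) (n + 1)).hom r + (g.f (n + 1)).hom x + h n q = 0 →
    (D.d (n + 1) n).hom x + (f.f n).hom q = 0 → (∀ j, (C.d n j).hom q = 0) →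
    ∃ (r' : E.X (n + 3)) (x' : D.X (n + 2)) (q' : C.X (n + 1)),
      (E.d (n + 3) (n + 2)).hom r' + (g.f (n + 2)).hom x' + h (n + 1) q' = r ∧
      (D.d (n + 2) (n + 1)).hom x' + (f.f (n + 1)).hom q' = -x ∧
      (C.d (n + 1) n).hom q' = q

theorem chain_f_d_apply {C D : ChainComplex (ModuleCat.{u} k) ℕ} (f : C ⟶ D) (i j : ℕ) (x : C.X i) :
    (f.f j).hom ((C.d i j).hom x) = (D.d i j).hom ((f.f i).hom x) :=
  LinearMap.congr_fun (congrArg ModuleCat.Hom.hom (f.comm i j).symm) x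

/-- The pairs `(x, q)` with `q` a cycle and `d x = - f q`. -/
def connectingPairs (n : ℕ) : Submodule k (D.X (n + 2) × C.X (n + 1)) :=
  LinearMap.ker (((D.d (n + 2) (n + 1)).hom.coprod (f.f (n + 1)).hom).prod
    ((C.d (n + 1) n).hom ∘ₗ LinearMap.snd k _ _))

variable {f g h}

theorem mem_connectingPairs {n : ℕ} {x : D.X (n + 2)} {q : C.X (n + 1)} :
    (x, q) ∈ connectingPairs f n ↔
      (D.d (n + 2) (n + 1)).hom x + (f.f (n + 1)).hom q = 0 ∧ (C.d (n + 1) n).hom q = 0 :=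
  Prod.ext_iff

theorem IsTotalExact.d_eq_zero (H : IsTotalExact f g h) {n : ℕ} {x : D.X (n + 2)} {q : C.X (n + 1)}
    (hxq : (x, q) ∈ connectingPairs f n) :
    (E.d (n + 2) (n + 1)).hom ((g.f (n + 2)).hom x + h (n + 1) q) = 0 := by
  obtain ⟨h1, h2⟩ := mem_connectingPairs.1 hxq
  have h3 := H.comm n q
  rw [h2, map_zero, zero_add] at h3
  rw [map_add, ← chain_f_d_apply, ← h3, ← map_add, h1, map_zero]

/-- The cycle `g x + h q`. -/
def IsTotalExact.toE (H : IsTotalExact f g h) (n : ℕ) :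
    connectingPairs f n →ₗ[k] LinearMap.ker (E.d (n + 2) (n + 1)).hom :=
  LinearMap.codRestrict _
    (((g.f (n + 2)).hom.coprod (h (n + 1))) ∘ₗ (connectingPairs f n).subtype)
    fun v => H.d_eq_zero v.2

/-- The cycle `q`. -/
def toC (f : C ⟶ D) (n : ℕ) : connectingPairs f n →ₗ[k] LinearMap.ker (C.d (n + 1) n).hom :=
  LinearMap.codRestrict _ (LinearMap.snd k _ _ ∘ₗ (connectingPairs f n).subtype)
    fun v => (mem_connectingPairs.1 v.2).2

theorem IsTotalExact.toE_val (H : IsTotalExact f g h) (n : ℕ) (v : connectingPairs f n) :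
    (H.toE n v).1 = (g.f (n + 2)).hom v.1.1 + h (n + 1) v.1.2 := rfl

/-- For a cycle `r`, the triple `(r, 0, 0)` is a total cycle, hence a total boundary. This writes
`r` as `g x' + h q'` up to a boundary, so the connecting map need only be given on such cycles. -/
theorem IsTotalExact.hclass_toE_surjective (H : IsTotalExact f g h) (n : ℕ) :
    Function.Surjective (hclass E (n + 1) ∘ₗ H.toE n) := by
  intro y
  obtain ⟨⟨r, hr⟩, rfl⟩ := hclass_surjective E (n + 1) y
  obtain ⟨r', x', q', h1, h2, h3⟩ := H.exact n r 0 0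
    (by rw [map_zero, map_zero, add_zero, add_zero]; exact hr)
    (by rw [map_zero, map_zero, add_zero]) (fun j => map_zero _)
  refine ⟨⟨(x', q'), mem_connectingPairs.2 ⟨by rw [h2, neg_zero], h3⟩⟩, ?_⟩
  refine hclass_eq_iff.2 ⟨-r', ?_⟩
  change _ = (g.f (n + 2)).hom x' + h (n + 1) q' - r
  rw [map_neg, ← h1]
  abel

/-- This is what makes `[g x + h q] ↦ [q]` well defined: if `g x + h q = d e`, then `(-e, x, q)` is
a total cycle, and exactness exhibits `q` as a boundary. -/
theorem IsTotalExact.hclass_toC_eq_zero (H : IsTotalExact f g h) (n : ℕ) (v : connectingPairs f n)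
    (hv : hclass E (n + 1) (H.toE n v) = 0) : hclass C n (toC f n v) = 0 := by
  obtain ⟨e, he⟩ := (hclass_eq_zero_iff E (n + 1) _).1 hv
  obtain ⟨⟨x, q⟩, hxq⟩ := v
  obtain ⟨hx, hq⟩ := mem_connectingPairs.1 hxq
  have he' : (E.d (n + 3) (n + 2)).hom e = (g.f (n + 2)).hom x + h (n + 1) q := he
  obtain ⟨r', x', q', h1, h2, h3⟩ := H.exact (n + 1) (-e) x q
    (by rw [map_neg, he']; abel) hx (fun j => by
      by_cases hj : j = n
      · rw [hj, hq]
      · rw [C.shape (n + 1) j fun hj' => hj (Nat.succ_injective hj')]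
        rfl)
  exact (hclass_eq_zero_iff C n _).2 ⟨q', h3⟩

/-- The connecting map. -/
theorem IsTotalExact.exists_connecting (H : IsTotalExact f g h) (n : ℕ) :
    ∃ δ : E.homology (n + 2) →ₗ[k] C.homology (n + 1),
      ∀ v, δ (hclass E (n + 1) (H.toE n v)) = hclass C n (toC f n v) := by
  -- A linear section over the field chooses representatives; the result is independent of the
  -- choice by the preceding lemma.
  obtain ⟨s, hs⟩ := LinearMap.exists_rightInverse_of_surjective _
    (LinearMap.range_eq_top.2 (H.hclass_toE_surjective n))
  refine ⟨hclass C n ∘ₗ toC f n ∘ₗ s, fun v => ?_⟩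
  have h1 : hclass E (n + 1) (H.toE n (s (hclass E (n + 1) (H.toE n v)) - v)) = 0 := by
    rw [map_sub, map_sub, sub_eq_zero]
    exact LinearMap.congr_fun hs _
  have h2 := H.hclass_toC_eq_zero n _ h1
  rw [map_sub, map_sub, sub_eq_zero] at h2
  exact h2

theorem IsTotalExact.exact_middle (H : IsTotalExact f g h) (n : ℕ) :
    Function.Exact (HomologicalComplex.homologyMap f (n + 1)).hom
      (HomologicalComplex.homologyMap g (n + 1)).hom := by
  intro y
  obtain ⟨⟨x, hx⟩, rfl⟩ := hclass_surjective D n y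
  have hx' : (D.d (n + 1) n).hom x = 0 := hx
  have hgx : (E.d (n + 1) n).hom ((g.f (n + 1)).hom x) = 0 := by
    rw [← chain_f_d_apply, hx', map_zero]
  rw [homologyMap_hclass g n ⟨x, hx⟩ ⟨_, hgx⟩ rfl, hclass_eq_zero_iff]
  constructor
  · rintro ⟨r, hr⟩
    -- If `g x = d r`, then `(-r, x, 0)` is a total cycle. Its bounding triple shows that `x` is
    -- homologous to `f (-q')`.
    obtain ⟨r', x', q', h1, h2, h3⟩ := H.exact n (-r) x 0
      (by rw [map_neg, hr, map_zero, add_zero, neg_add_cancel])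
      (by rw [map_zero, add_zero, hx']) (fun j => map_zero _)
    refine ⟨hclass C n ⟨-q', by rw [LinearMap.mem_ker, map_neg, h3, neg_zero]⟩, ?_⟩
    rw [homologyMap_hclass f n _ ⟨(f.f (n + 1)).hom (-q'), by
      rw [LinearMap.mem_ker, ← chain_f_d_apply, map_neg, h3, neg_zero, map_zero]⟩ rfl]
    refine hclass_eq_iff.2 ⟨x', ?_⟩
    change _ = (f.f (n + 1)).hom (-q') - x
    rw [map_neg, eq_sub_iff_add_eq, eq_neg_iff_add_eq_zero, add_right_comm, h2, neg_add_cancel]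
  · rintro ⟨z, hz⟩
    obtain ⟨⟨q, hq⟩, rfl⟩ := hclass_surjective C n z
    have hq' : (C.d (n + 1) n).hom q = 0 := hq
    rw [homologyMap_hclass f n _ ⟨(f.f (n + 1)).hom q, by
      rw [LinearMap.mem_ker, ← chain_f_d_apply, hq', map_zero]⟩ rfl] at hz
    obtain ⟨y, hy⟩ := hclass_eq_iff.1 hz
    have hy' : (D.d (n + 2) (n + 1)).hom y = (f.f (n + 1)).hom q - x := hy
    -- Here `d y = f q - x`, and `g f q = d h q` because `q` is a cycle.
    refine ⟨h (n + 1) q - (g.f (n + 2)).hom y, ?_⟩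
    have hc := H.comm n q
    rw [hq', map_zero, zero_add] at hc
    rw [map_sub, ← hc, ← chain_f_d_apply, hy', map_sub, sub_sub_cancel]

theorem IsTotalExact.exact_right (H : IsTotalExact f g h) (n : ℕ)
    {δ : E.homology (n + 2) →ₗ[k] C.homology (n + 1)}
    (hδ : ∀ v, δ (hclass E (n + 1) (H.toE n v)) = hclass C n (toC f n v)) :
    Function.Exact (HomologicalComplex.homologyMap g (n + 2)).hom δ := by
  intro y
  constructor
  · intro hy
    obtain ⟨v, rfl⟩ := H.hclass_toE_surjective n y
    have h1 : hclass C n (toC f n v) = 0 := (hδ v).symm.trans hy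
    obtain ⟨q', hq'⟩ := (hclass_eq_zero_iff C n _).1 h1
    obtain ⟨⟨x, q⟩, hxq⟩ := v
    obtain ⟨hx, hq⟩ := mem_connectingPairs.1 hxq
    obtain rfl : (C.d (n + 2) (n + 1)).hom q' = q := hq'
    -- When `q = d q'`, correcting `x` by `f q'` gives a cycle. Its image under `g` differs from `g
    -- x + h q` by the boundary of `h q'`.
    have h2 : (D.d (n + 2) (n + 1)).hom (x + (f.f (n + 2)).hom q') = 0 := by
      rw [map_add, ← chain_f_d_apply, hx]
    have h3 : (E.d (n + 2) (n + 1)).hom ((g.f (n + 2)).hom (x + (f.f (n + 2)).hom q')) = 0 := by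
      rw [← chain_f_d_apply, h2, map_zero]
    refine ⟨hclass D (n + 1) ⟨_, h2⟩, ?_⟩
    rw [homologyMap_hclass g (n + 1) _ ⟨_, h3⟩ rfl]
    refine hclass_eq_iff.2 ⟨h (n + 2) q', ?_⟩
    rw [H.toE_val]
    change _ = (g.f (n + 2)).hom (x + (f.f (n + 2)).hom q') -
      ((g.f (n + 2)).hom x + h (n + 1) ((C.d (n + 2) (n + 1)).hom q'))
    rw [map_add, H.comm (n + 1)]
    abel
  · rintro ⟨z, rfl⟩
    obtain ⟨⟨x, hx⟩, rfl⟩ := hclass_surjective D (n + 1) z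
    -- The class of `g x` is represented by the pair with `q = 0`, so the connecting map kills it.
    let v : connectingPairs f n := ⟨(x, 0), mem_connectingPairs.2
      ⟨by rw [map_zero, add_zero]; exact hx, map_zero _⟩⟩
    rw [homologyMap_hclass g (n + 1) _ (H.toE n v) (by
      rw [H.toE_val]
      change _ = (g.f (n + 2)).hom x + h (n + 1) 0
      rw [map_zero, add_zero]), hδ]
    have : toC f n v = 0 := rfl
    rw [this, map_zero]

/-- A cycle `q` occurs in a pair `(x, q)` exactly when `f q` is a boundary, namely of `-x`. -/
theorem IsTotalExact.exact_left (H : IsTotalExact f g h) (n : ℕ)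
    {δ : E.homology (n + 2) →ₗ[k] C.homology (n + 1)}
    (hδ : ∀ v, δ (hclass E (n + 1) (H.toE n v)) = hclass C n (toC f n v)) :
    Function.Exact δ (HomologicalComplex.homologyMap f (n + 1)).hom := by
  intro y
  constructor
  · intro hy
    obtain ⟨⟨q, hq⟩, rfl⟩ := hclass_surjective C n y
    have hq' : (C.d (n + 1) n).hom q = 0 := hq
    rw [homologyMap_hclass f n _ ⟨(f.f (n + 1)).hom q, by
      rw [LinearMap.mem_ker, ← chain_f_d_apply, hq', map_zero]⟩ rfl, hclass_eq_zero_iff] at hy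
    obtain ⟨x, hx⟩ := hy
    exact ⟨_, hδ ⟨(-x, q), mem_connectingPairs.2
      ⟨by rw [map_neg, hx, neg_add_cancel], hq'⟩⟩⟩
  · rintro ⟨z, rfl⟩
    obtain ⟨v, rfl⟩ := H.hclass_toE_surjective n z
    rw [LinearMap.comp_apply, hδ]
    obtain ⟨⟨x, q⟩, hxq⟩ := v
    obtain ⟨hx, hq⟩ := mem_connectingPairs.1 hxq
    rw [homologyMap_hclass f n _ ⟨(f.f (n + 1)).hom q, by
      rw [LinearMap.mem_ker, ← chain_f_d_apply, hq, map_zero]⟩ rfl, hclass_eq_zero_iff]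
    exact ⟨-x, by rw [map_neg, neg_eq_iff_add_eq_zero, hx]⟩

end LongExact

/-! ### The Jacobi-Zariski sequence for an arbitrary relative resolution. -/

section JacobiZariski

variable {k : Type u} [Field k] {A : Type u} [Ring A] [Algebra k A] {B : Subalgebra k A}

theorem isTotalExact_relResolution (hflat : IsFlat k (quotBimod B))
    {φ : barComplex k A ⟶ (relResolution B).complex}
    (hφ : (relResolution B).IsComparison φ) (X : Bimodule k A) :
    IsTotalExact (inclComplex B X) (tensorHom φ X) (tensorHomotopy hφ X) where
  comm := tensorHomotopy_comm hφ X
  exact := tensor_total_exact hflat hφ X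

/-- The Jacobi-Zariski sequence at degree `n + 1`, for the resolution by relative covers. -/
theorem exists_connecting_relResolution (hflat : IsFlat k (quotBimod B))
    {φ : barComplex k A ⟶ (relResolution B).complex}
    (hφ : (relResolution B).IsComparison φ) (X : Bimodule k A) (n : ℕ) :
    ∃ δ : (relResolution B).relTor X (n + 2) ⟶ HH k ((res B).obj X) (n + 1),
      Function.Exact (mapI B X (n + 1)).hom (mapK φ X (n + 1)).hom ∧
      Function.Exact (mapK φ X (n + 2)).hom δ.hom ∧
      Function.Exact δ.hom (mapI B X (n + 1)).hom := by
  have H := isTotalExact_relResolution hflat hφ X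
  obtain ⟨δ, hδ⟩ := H.exists_connecting n
  exact ⟨ModuleCat.ofHom (X := (relResolution B).relTor X (n + 2))
    (Y := HH k ((res B).obj X) (n + 1)) δ,
    H.exact_middle n, H.exact_right n hδ, H.exact_left n hδ⟩

/-- The Jacobi-Zariski sequence at degree `n + 1`. -/
theorem exists_connecting (hflat : IsFlat k (quotBimod B)) {P : RelResolution B (regular k A)}
    {φ : barComplex k A ⟶ P.complex} (hφ : P.IsComparison φ) (X : Bimodule k A) (n : ℕ) :
    ∃ δ : P.relTor X (n + 2) ⟶ HH k ((res B).obj X) (n + 1),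
      Function.Exact (mapI B X (n + 1)).hom (mapK φ X (n + 1)).hom ∧
      Function.Exact (mapK φ X (n + 2)).hom δ.hom ∧
      Function.Exact δ.hom (mapI B X (n + 1)).hom := by
  -- Composing `φ` with this equivalence gives a comparison map to the explicit resolution, for
  -- which the sequence is known. The equivalence then identifies the relative homologies compatibly
  -- with `K`.
  obtain ⟨e, he⟩ := P.exists_homotopyEquiv (relResolution B)
  have hψ : (relResolution B).IsComparison (φ ≫ e.hom) := by
    rw [RelResolution.IsComparison, HomologicalComplex.comp_f, Category.assoc, he, hφ]
  obtain ⟨δ, h1, h2, h3⟩ := exists_connecting_relResolution hflat hψ X n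
  let E : HomotopyEquiv (P.tensor X) ((relResolution B).tensor X) :=
    (tensorFunctor k X).mapHomotopyEquiv e
  let i (m : ℕ) : P.relTor X m ≅ (relResolution B).relTor X m := E.toHomologyIso m
  have hi (m : ℕ) (z : HH k X m) :
      (mapK (φ ≫ e.hom) X m).hom z = (i m).hom.hom ((mapK φ X m).hom z) := by
    have h : mapK (φ ≫ e.hom) X m = mapK φ X m ≫ (i m).hom := by
      refine Eq.trans ?_ (HomologicalComplex.homologyMap_comp _ _ _)
      exact congrArg (fun f => HomologicalComplex.homologyMap f m) (Functor.map_comp _ _ _)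
    rw [h]
    rfl
  have hinj (m : ℕ) : Function.Injective (i m).hom.hom :=
    (ModuleCat.mono_iff_injective (i m).hom).1 inferInstance
  have hsurj (m : ℕ) : Function.Surjective (i m).hom.hom :=
    (ModuleCat.epi_iff_surjective (i m).hom).1 inferInstance
  refine ⟨(i (n + 2)).hom ≫ δ, fun y => ?_, fun y => ?_, fun y => ?_⟩
  · rw [← h1 y, hi, map_eq_zero_iff _ (hinj _)]
  · refine (h2 ((i (n + 2)).hom.hom y)).trans ⟨?_, ?_⟩
    · rintro ⟨z, hz⟩
      exact ⟨z, hinj _ ((hi _ z).symm.trans hz)⟩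
    · rintro ⟨z, rfl⟩
      exact ⟨z, hi _ z⟩
  · refine (h3 y).trans ⟨?_, ?_⟩
    · rintro ⟨z, rfl⟩
      obtain ⟨z, rfl⟩ := hsurj _ z
      exact ⟨z, rfl⟩
    · rintro ⟨z, rfl⟩
      exact ⟨_, rfl⟩

end JacobiZariski

end

end JZ

open JZ
theorem mainTheorem4 {k : Type u} [Field k] {A : Type u} [Ring A] [Algebra k A]
    (B : Subalgebra k A) (hflat : IsFlat k (quotBimod B)) (X : Bimodule k A) :
    Nonempty (RelResolution B (regular k A)) ∧
    ∀ P : RelResolution B (regular k A),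
      (∃ φ : barComplex k A ⟶ P.complex, P.IsComparison φ) ∧
      ∀ φ : barComplex k A ⟶ P.complex, P.IsComparison φ →
        ∃ δ : ∀ m : ℕ, P.relTor X (m + 1) ⟶ HH k ((res B).obj X) m,
          (∀ m : ℕ, 2 ≤ m →
            Function.Exact (mapI B X m).hom (mapK φ X m).hom ∧
            Function.Exact (mapK φ X (m + 1)).hom (δ m).hom ∧
            Function.Exact (δ m).hom (mapI B X m).hom) ∧
          (Module.Finite k A → Module.Finite k X → ∀ m : ℕ, 1 ≤ m →
            Function.Exact (mapI B X m).hom (mapK φ X m).hom ∧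
            Function.Exact (mapK φ X (m + 1)).hom (δ m).hom ∧
            Function.Exact (δ m).hom (mapI B X m).hom) := by
  refine ⟨⟨relResolution B⟩, fun P => ⟨P.exists_isComparison, fun φ hφ => ?_⟩⟩
  choose δ hδ using exists_connecting hflat hφ X
  -- The connecting maps were built with target in degree `n + 1`. The one with target in degree
  -- zero is no part of the sequence and is set to zero.
  let δ' : ∀ m : ℕ, P.relTor X (m + 1) ⟶ HH k ((res B).obj X) m
    | 0 => 0
    | n + 1 => δ n
  have key : ∀ m : ℕ, 1 ≤ m →
      Function.Exact (mapI B X m).hom (mapK φ X m).hom ∧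
      Function.Exact (mapK φ X (m + 1)).hom (δ' m).hom ∧
      Function.Exact (δ' m).hom (mapI B X m).hom := by
    intro m hm
    obtain ⟨n, rfl⟩ := Nat.exists_eq_add_of_le' hm
    exact hδ n
  exact ⟨δ', fun m hm => key m (by omega), fun _ _ => key⟩
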